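/- Work in dimension $d=2$, on the torus $\mathbb T^2$ of side $2\pi$, with Fourier basis $e_k(x)=(2\pi)^{-1}e^{\iota k\cdot x}$ and $\mathbb Z^2_0=\mathbb Z^2\setminus\{0\}$. Fix $\mathfrak w\in\mathbb R^2\setminus\{0\}$; $|\cdot|$ is the Euclidean norm. Let $\Gamma=\bigoplus_{n\ge0}\Gamma_n$ be the Fock space: $\psi=(\psi_n)_n\in\Gamma$ if each $\psi_n$ is a symmetric element of $L^2((\mathbb T^2)^n)$ with zero average in each variable, so that it is given by its Fourier coefficients $\hat\psi_n(k_{1:n})$, $k_{1:n}\in(\mathbb Z^2_0)^n$, and $\|\psi\|^2=\sum_n n!\,\|\psi_n\|_{L^2}^2<\infty$; correspondingly $\langle\psi,\phi\rangle=\sum_n n!\,\langle\psi_n,\phi_n\rangle_{L^2}$. For $\varepsilon\in(0,1)$ put $\lambda_\varepsilon=(\log\varepsilon^{-2})^{-1/2}$, $$\mathrm L^\varepsilon(x)=\lambda_\varepsilon^2\log\Big(1+\frac1{\varepsilon^2x}\Big),\qquad G(x)=\frac1{|\mathfrak w|^{2}}\Big[\Big(\frac{3|\mathfrak w|^2}{2\pi}x+1\Big)^{2/3}-1\Big].$$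 With $|k_{1:n}|^2=\sum_i|k_i|^2$, let $\mathcal N$, $\mathcal L_0$, $\mathcal L_0^{\mathfrak w}$, $\mathcal G^\varepsilon=G(\mathrm L^\varepsilon(-\mathcal L_0))$ be the operators that act on $\Gamma_n$ as multiplication of $\hat\psi_n(k_{1:n})$ by $n$, $-\frac12|k_{1:n}|^2$, $-\frac12\sum_i(\mathfrak w\cdot k_i)^2$, $G(\mathrm L^\varepsilon(\frac12|k_{1:n}|^2))$, respectively. Let $\mathbb J^\varepsilon_{\ell,m}=\mathbf 1\{0<\varepsilon|\ell|\le1,\ 0<\varepsilon|m|\le1,\ 0<\varepsilon|\ell+m|\le1\}$, and define, for $f\in\Gamma_n$, the element $\mathcal A^\varepsilon_+f\in\Gamma_{n+1}$ by $$\widehat{\mathcal A^\varepsilon_+f}(k_{1:n+1})=-\frac{2\iota}{2\pi}\frac{\lambda_\varepsilon}{n+1}\sum_{1\le i<j\le n+1}[\mathfrak w\cdot(k_i+k_j)]\,\mathbb J^\varepsilon_{k_i,k_j}\,\hat f(k_i+k_j,k_{\{1:n+1\}\setminus\{i,j\}}),$$ and $\mathcal A^\varepsilon_-=-(\mathcal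 A^\varepsilon_+)^*$, that is, $\mathcal A^\varepsilon_-f=0$ for $n\le1$ and, for $f\in\Gamma_n$ with $n\ge2$, $$\widehat{\mathcal A^\varepsilon_-f}(k_{1:n-1})=-\frac{\iota}{2\pi}\,n\lambda_\varepsilon\sum_{j=1}^{n-1}(\mathfrak w\cdot k_j)\sum_{\ell+m=k_j}\mathbb J^\varepsilon_{\ell,m}\,\hat f(\ell,m,k_{\{1:n-1\}\setminus\{j\}}).$$ Set $$\mathcal R^\varepsilon=-\mathcal A^\varepsilon_-(-\mathcal L_0-\mathcal L_0^{\mathfrak w}\mathcal G^\varepsilon)^{-1}\mathcal A^\varepsilon_++\mathcal L_0^{\mathfrak w}\mathcal G^\varepsilon ,$$ an operator that maps each $\Gamma_n$ to itself. **Lemma (Replacement Lemma).** There is a constant $C>0$, depending only on $\mathfrak w$, such that for all $\varepsilon\in(0,1)$: 1. for all $\psi_1,\psi_2\in\Gamma$ with $\mathcal N(-\mathcal L_0)^{1/2}\psi_i\in\Gamma$, $i=1,2$, each component $(\mathcal R^\varepsilon\psi_1)_n$ belongs to $\Gamma_n$, the series $\langle\mathcal R^\varepsilon\psi_1,\psi_2\rangle=\sum_n\langle(\mathcal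 R^\varepsilon\psi_1)_n,(\psi_2)_n\rangle$ converges absolutely, and $$|\langle\mathcal R^\varepsilon\psi_1,\psi_2\rangle|\le C\lambda_\varepsilon^2\,\|\mathcal N(-\mathcal L_0)^{1/2}\psi_1\|\,\|\mathcal N(-\mathcal L_0)^{1/2}\psi_2\|;$$ 2. consequently $\mathcal L_0^{\mathfrak w}\mathcal G^\varepsilon$ is an approximate fixed point, chaos by chaos, of the operator equation $\mathcal L_0^{\mathfrak w}\mathcal G^\varepsilon=\mathcal A^\varepsilon_-(-\mathcal L_0-\mathcal L_0^{\mathfrak w}\mathcal G^\varepsilon)^{-1}\mathcal A^\varepsilon_+$, in the sense that for every $n\ge1$ and $\psi\in\Gamma_n$ one has $(-\mathcal L_0)^{-1/2}\mathcal R^\varepsilon(-\mathcal L_0)^{-1/2}\psi\in\Gamma_n$ and $$\|(-\mathcal L_0)^{-1/2}\mathcal R^\varepsilon(-\mathcal L_0)^{-1/2}\psi\|\le C\lambda_\varepsilon^2n^2\|\psi\|.$$ -/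

import Mathlib

noncomputable section

namespace Burgers2D

/-- Momenta: points of `ℤ²`. -/
abbrev Z2 := Fin 2 → ℤ

/-- A sequence `(ψ_n)_n` of kernels, given by their Fourier coefficients `ψ̂_n(k_1, …, k_n)` with
respect to the orthonormal basis `e_{k_1} ⊗ ⋯ ⊗ e_{k_n}` of `L²((𝕋²)ⁿ)`, where
`e_k(x) = (2π)⁻¹ exp(i k·x)` and `𝕋²` is the torus of side `2π`. -/
abbrev Family := (n : ℕ) → (Fin n → Z2) → ℂ

/-- `|k|²` for `k ∈ ℤ²` (Euclidean). -/
def sqNorm (k : Z2) : ℝ := ∑ a, (k a : ℝ) ^ 2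

/-- `𝔴 · k`. -/
def dot (w : EuclideanSpace ℝ (Fin 2)) (k : Z2) : ℝ := ∑ a, w a * (k a : ℝ)

/-- `f` is the Fourier transform of an element of the `n`-th Fock space: a symmetric, square
integrable function on `(𝕋²)ⁿ` that has zero average in each of its variables. (Kernels are
complex-valued; the real-valued ones are those with `f (-k) = conj (f k)`.) -/
structure IsKernel (n : ℕ) (f : (Fin n → Z2) → ℂ) : Prop where
  symm : ∀ (σ : Equiv.Perm (Fin n)) (k : Fin n → Z2), f (k ∘ σ) = f k
  zero_mean : ∀ k : Fin n → Z2, (∃ i, k i = 0) → f k = 0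
  sq_summable : Summable fun k => ‖f k‖ ^ 2

/-- `ψ` belongs to the Fock space `⨁_{n ≥ 0} Γ_n`: every component is a kernel and
`∑_n n! ‖ψ_n‖²_{L²} < ∞`. -/
structure MemFock (ψ : Family) : Prop where
  kernel : ∀ n, IsKernel n (ψ n)
  summable : Summable fun n => (n.factorial : ℝ) * ∑' k, ‖ψ n k‖ ^ 2

/-- `ψ` is concentrated on the `n`-th chaos. -/
def InChaos (n : ℕ) (ψ : Family) : Prop := ∀ m, m ≠ n → ψ m = 0

/-- The scalar product `⟨f, g⟩ = ∑_n n! ⟨f_n, g_n⟩_{L²}` of the Fock space. -/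
def fockInner (f g : Family) : ℂ :=
  ∑' n, (n.factorial : ℂ) * ∑' k, f n k * (starRingEnd ℂ) (g n k)

/-- The norm `‖f‖ = (∑_n n! ‖f_n‖²_{L²})^{1/2}` of the Fock space. -/
def fockNorm (f : Family) : ℝ :=
  Real.sqrt (∑' n, (n.factorial : ℝ) * ∑' k, ‖f n k‖ ^ 2)

/-- The operator, diagonal in Fourier variables, with symbol `m`. -/
def multiplier (m : (n : ℕ) → (Fin n → Z2) → ℝ) (ψ : Family) : Family :=
  fun n k => (m n k : ℂ) * ψ n k

/-- The number operator `𝒩`. -/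
def number : Family → Family := multiplier fun n _ => (n : ℝ)

/-- Symbol `½|k_{1:n}|² = ½ ∑_i |k_i|²` of `-ℒ₀`. -/
def symNegL0 (n : ℕ) (k : Fin n → Z2) : ℝ := (1 / 2) * ∑ i, sqNorm (k i)

/-- Symbol `-½ (𝔴·k)²_{1:n} = -½ ∑_i (𝔴·k_i)²` of `ℒ₀^𝔴`, i.e. of `½(𝔴·∇)²` acting on each of the
variables. -/
def symL0w (w : EuclideanSpace ℝ (Fin 2)) (n : ℕ) (k : Fin n → Z2) : ℝ :=
  -((1 / 2) * ∑ i, dot w (k i) ^ 2)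

/-- `(-ℒ₀)^{1/2}`. -/
def sqrtNegL0 : Family → Family := multiplier fun n k => Real.sqrt (symNegL0 n k)

/-- `(-ℒ₀)^{-1/2}`, on the chaoses of order at least one. -/
def invSqrtNegL0 : Family → Family := multiplier fun n k => (Real.sqrt (symNegL0 n k))⁻¹

/-- `ℒ₀^𝔴`. -/
def L0w (w : EuclideanSpace ℝ (Fin 2)) : Family → Family := multiplier (symL0w w)

/-- The coupling constant `λ_ε = (log ε⁻²)^{-1/2}`. -/
def lam (ε : ℝ) : ℝ := 1 / Real.sqrt (Real.log (ε ^ (-2 : ℤ)))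

/-- `L^ε(x) = λ_ε² log(1 + 1/(ε² x))`. -/
def Leps (ε x : ℝ) : ℝ := lam ε ^ 2 * Real.log (1 + 1 / (ε ^ 2 * x))

/-- `G(x) = |𝔴|⁻² [(3|𝔴|² x/(2π) + 1)^{2/3} - 1]`. -/
def G (w : EuclideanSpace ℝ (Fin 2)) (x : ℝ) : ℝ :=
  1 / ‖w‖ ^ 2 * ((3 * ‖w‖ ^ 2 / (2 * Real.pi) * x + 1) ^ ((2 : ℝ) / 3) - 1)

/-- Symbol `G(L^ε(½|k_{1:n}|²))` of `𝒢^ε`. -/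
def symG (ε : ℝ) (w : EuclideanSpace ℝ (Fin 2)) (n : ℕ) (k : Fin n → Z2) : ℝ :=
  G w (Leps ε (symNegL0 n k))

/-- `𝒢^ε = G(L^ε(-ℒ₀))`. -/
def Geps (ε : ℝ) (w : EuclideanSpace ℝ (Fin 2)) : Family → Family := multiplier (symG ε w)

/-- `(-ℒ₀ - ℒ₀^𝔴 𝒢^ε)⁻¹`, on the chaoses of order at least one (where the symbol that is inverted
is positive at nonzero momenta). -/
def resolvent (ε : ℝ) (w : EuclideanSpace ℝ (Fin 2)) : Family → Family :=
  multiplier fun n k => (symNegL0 n k - symL0w w n k * symG ε w n k)⁻¹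

open Classical in
/-- The cut-off `𝕁^ε_{ℓ,m} = 1{0 < ε|ℓ| ≤ 1, 0 < ε|m| ≤ 1, 0 < ε|ℓ+m| ≤ 1}`, Euclidean norms. -/
def cutoff (ε : ℝ) (l m : Z2) : ℝ :=
  if (0 < ε * √(sqNorm l) ∧ ε * √(sqNorm l) ≤ 1) ∧ (0 < ε * √(sqNorm m) ∧ ε * √(sqNorm m) ≤ 1) ∧
      (0 < ε * √(sqNorm (l + m)) ∧ ε * √(sqNorm (l + m)) ≤ 1)
  then 1 else 0

/-- The momenta obtained from `k_1, …, k_{n+1}` by replacing `k_i` by `k_i + k_j` and deleting `k_j`: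
up to the order (immaterial for symmetric kernels), `(k_i + k_j, k_{{1:n+1} ∖ {i,j}})`. -/
def merge {n : ℕ} (k : Fin (n + 1) → Z2) (i j : Fin (n + 1)) : Fin n → Z2 :=
  j.removeNth (Function.update k i (k i + k j))

/-- The momenta obtained from `k_1, …, k_n` by splitting `k_j` into `l` and `k_j - l`:
up to the order, `(l, k_j - l, k_{{1:n} ∖ {j}})`. -/
def split {n : ℕ} (k : Fin n → Z2) (j : Fin n) (l : Z2) : Fin (n + 1) → Z2 :=
  Fin.cons l (Function.update k j (k j - l))

/-- The creation operator `𝒜^ε_+`. -/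
def Aplus (ε : ℝ) (w : EuclideanSpace ℝ (Fin 2)) (ψ : Family) : Family
  | 0, _ => 0
  | n + 1, k =>
    -(2 * Complex.I / (2 * Real.pi)) * ((lam ε : ℂ) / (n + 1)) *
      ∑ i : Fin (n + 1), ∑ j ∈ Finset.Ioi i,
        (dot w (k i + k j) : ℂ) * (cutoff ε (k i) (k j) : ℂ) * ψ n (merge k i j)

/-- The annihilation operator `𝒜^ε_-`, vanishing on the first chaos. The numerical factor is the one
for which `𝒜^ε_- = -(𝒜^ε_+)^*`, see `Aplus_adjoint`. The sum over `l` has finitely many nonzero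
terms. -/
def Aminus (ε : ℝ) (w : EuclideanSpace ℝ (Fin 2)) (ψ : Family) : Family :=
  fun n k =>
    -(Complex.I / (2 * Real.pi)) * ((n : ℂ) + 1) * (lam ε : ℂ) *
      ∑ j : Fin n, (dot w (k j) : ℂ) *
        ∑' l : Z2, (cutoff ε l (k j - l) : ℂ) * ψ (n + 1) (split k j l)

/-- The operator `-𝒜^ε_- (-ℒ₀ - ℒ₀^𝔴 𝒢^ε)⁻¹ 𝒜^ε_+ + ℒ₀^𝔴 𝒢^ε`. -/
def replacementOp (ε : ℝ) (w : EuclideanSpace ℝ (Fin 2)) (ψ : Family) : Family :=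
  -Aminus ε w (resolvent ε w (Aplus ε w ψ)) + L0w w (Geps ε w ψ)

/-! Helper facts: the creation and annihilation operators are, up to sign, adjoint. -/

theorem sqNorm_finite (R : ℝ) : {l : Z2 | sqNorm l ≤ R}.Finite := by
  have hs : {l : Z2 | sqNorm l ≤ R} ⊆ Set.Icc (fun _ => -⌈R⌉) (fun _ => ⌈R⌉) := by
    intro l hl
    have key : ∀ a, |l a| ≤ ⌈R⌉ := by
      intro a
      have h1 : (l a : ℝ) ^ 2 ≤ sqNorm l :=
        Finset.single_le_sum (f := fun a => (l a : ℝ) ^ 2) (fun _ _ => sq_nonneg _)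
          (Finset.mem_univ a)
      have h2 : |l a| ≤ l a ^ 2 := by
        rw [← sq_abs]
        nlinarith [abs_nonneg (l a), Int.le_self_sq |l a|]
      have h3 : ((l a ^ 2 : ℤ) : ℝ) ≤ (⌈R⌉ : ℝ) := by
        push_cast
        exact (h1.trans hl).trans (Int.le_ceil R)
      exact h2.trans (by exact_mod_cast h3)
    exact ⟨fun a => (abs_le.1 (key a)).1, fun a => (abs_le.1 (key a)).2⟩
  exact (Set.finite_Icc _ _).subset hs

theorem cutoff_finite {ε : ℝ} (hε : 0 < ε) :
    ∃ B : Finset Z2, ∀ l m, cutoff ε l m ≠ 0 → l ∈ B ∧ l + m ∈ B := by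
  classical
  refine ⟨(sqNorm_finite ((1 / ε) ^ 2)).toFinset, fun l m h => ?_⟩
  have aux : ∀ p : Z2, ε * √(sqNorm p) ≤ 1 → sqNorm p ≤ (1 / ε) ^ 2 := by
    intro p hp
    have : √(sqNorm p) ≤ 1 / ε := by rw [le_div_iff₀ hε]; linarith
    exact (Real.sqrt_le_left (by positivity)).1 this
  unfold cutoff at h
  split_ifs at h with h'
  · exact ⟨(Set.Finite.mem_toFinset _).2 (aux l h'.1.2),
      (Set.Finite.mem_toFinset _).2 (aux (l + m) h'.2.2.2)⟩
  · exact absurd rfl h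

theorem cutoff_comm (ε : ℝ) (l m : Z2) : cutoff ε l m = cutoff ε m l := by
  unfold cutoff
  rw [add_comm m l]
  congr 1
  simp only [eq_iff_iff]
  tauto

theorem cutoff_le_one (ε : ℝ) (l m : Z2) : |cutoff ε l m| ≤ 1 := by
  unfold cutoff; split_ifs <;> simp

theorem merge_comm {n : ℕ} {f : (Fin n → Z2) → ℂ} (hf : IsKernel n f) (k : Fin (n + 1) → Z2)
    (i j : Fin (n + 1)) : f (merge k j i) = f (merge k i j) := by
  let e : {x : Fin (n + 1) // x ≠ i} ≃ {x : Fin (n + 1) // x ≠ j} :=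
    (Equiv.swap i j).subtypeEquiv fun a => by
      rw [Ne, Ne, not_iff_not, Equiv.swap_apply_eq_iff, Equiv.swap_apply_right]
  let σ : Equiv.Perm (Fin n) :=
    ((finSuccAboveEquiv i).trans e).trans (finSuccAboveEquiv j).symm
  have hσ : ∀ a, j.succAbove (σ a) = Equiv.swap i j (i.succAbove a) := by
    intro a
    have := (finSuccAboveEquiv j).apply_symm_apply (e (finSuccAboveEquiv i a))
    exact congrArg Subtype.val this
  rw [← hf.symm σ (merge k i j)]
  congr 1
  funext a
  simp only [merge, Function.comp, Fin.removeNth, hσ]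
  have ha : i.succAbove a ≠ i := Fin.succAbove_ne i a
  by_cases h : i.succAbove a = j
  · rw [h, Equiv.swap_apply_right, Function.update_self, Function.update_self, add_comm]
  · rw [Equiv.swap_apply_of_ne_of_ne ha h, Function.update_of_ne h, Function.update_of_ne ha]

/-- Splitting, with the two new momenta put in the places `j` and `j.succAbove a`. -/
def splitEquiv {n : ℕ} (j : Fin (n + 1)) (a : Fin n) :
    (Z2 × (Fin n → Z2)) ≃ (Fin (n + 1) → Z2) where
  toFun p := Fin.insertNth (α := fun _ => Z2) j p.1 (Function.update p.2 a (p.2 a - p.1))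
  invFun k := (k j, merge k (j.succAbove a) j)
  left_inv p := by
    refine Prod.ext (by simp) ?_
    funext b
    simp only [merge, Fin.removeNth]
    by_cases h : b = a
    · subst h; simp
    · rw [Function.update_of_ne (by simpa using h)]; simp [h]
  right_inv k := by
    funext b
    refine Fin.succAboveCases j ?_ (fun b => ?_) b
    · simp
    · by_cases h : b = a
      · subst h; simp [merge, Fin.removeNth]
      · simp [merge, Fin.removeNth, h]

theorem split_symm {n : ℕ} {g : (Fin (n + 1) → Z2) → ℂ} (hg : IsKernel (n + 1) g)
    (j : Fin (n + 1)) (a : Fin n) (l : Z2) (q : Fin n → Z2) :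
    g (splitEquiv j a (l, q)) = g (split q a l) := by
  have := hg.symm (Fin.cycleRange j).symm⁻¹ (splitEquiv j a (l, q))
  rw [← hg.symm (Fin.cycleRange j) (split q a l)]
  congr 1
  simp only [splitEquiv, split, Equiv.coe_fn_mk, Fin.cons_comp_cycleRange]

theorem sum_lt_eq {n : ℕ} (X : Fin (n + 1) → Fin (n + 1) → ℂ)
    (hX : ∀ i j, i ≠ j → X i j = X j i) :
    2 * ∑ i, ∑ j ∈ Finset.Ioi i, X i j = ∑ j, ∑ a, X (j.succAbove a) j := by
  have h1 : ∀ j, ∑ a, X (j.succAbove a) j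
      = (∑ i ∈ Finset.Iio j, X i j) + ∑ i ∈ Finset.Ioi j, X i j := by
    intro j
    have h2 : ∑ a, X (j.succAbove a) j = ∑ i ∈ ({j}ᶜ : Finset (Fin (n + 1))), X i j := by
      rw [← Fin.image_succAbove_univ, Finset.sum_image
        (fun _ _ _ _ h => Fin.succAbove_right_injective h)]
    rw [h2, ← Finset.sum_union]
    · congr 1
      ext i
      simp [lt_or_lt_iff_ne]
    · exact Finset.disjoint_left.2 fun i hi hi' => by
        simp at hi hi'
        exact absurd hi (not_lt.2 hi'.le)
  simp only [h1, Finset.sum_add_distrib]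
  have h3 : ∑ j, ∑ i ∈ Finset.Iio j, X i j = ∑ i, ∑ j ∈ Finset.Ioi i, X i j :=
    Finset.sum_comm' (by simp)
  have h4 : ∑ j, ∑ i ∈ Finset.Ioi j, X i j = ∑ i, ∑ j ∈ Finset.Ioi i, X i j :=
    Finset.sum_congr rfl fun i _ => Finset.sum_congr rfl fun j hj =>
      hX j i (Finset.mem_Ioi.1 hj).ne'
  rw [h3, h4]
  ring

set_option maxHeartbeats 1000000 in
/-- `𝒜^ε_- = -(𝒜^ε_+)^*`: for `f` in the `n`-th and `g` in the `(n+1)`-th Fock space,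
`⟨𝒜^ε_+ f, g⟩ = -⟨f, 𝒜^ε_- g⟩`. -/
theorem Aplus_adjoint {ε : ℝ} (hε : 0 < ε) (w : EuclideanSpace ℝ (Fin 2)) (n : ℕ) (f g : Family)
    (hf : IsKernel n (f n)) (hg : IsKernel (n + 1) (g (n + 1))) :
    ((n + 1).factorial : ℂ) * ∑' k, Aplus ε w f (n + 1) k * (starRingEnd ℂ) (g (n + 1) k)
      = -((n.factorial : ℂ) * ∑' k, f n k * (starRingEnd ℂ) (Aminus ε w g n k)) := by
  classical
  obtain ⟨B, hB⟩ := cutoff_finite hε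
  set D : ℝ := ∑ p ∈ B, |dot w p| with hD
  -- the common value of all the pieces
  let t : Fin n → Z2 × (Fin n → Z2) → ℂ := fun a p =>
    (dot w (p.2 a) : ℂ) * (cutoff ε p.1 (p.2 a - p.1) : ℂ) * f n p.2 *
      (starRingEnd ℂ) (g (n + 1) (split p.2 a p.1))
  have ht : ∀ a, Summable (t a) := by
    intro a
    have s1 : Summable fun p : Z2 × (Fin n → Z2) => (if p.1 ∈ B then (1 : ℝ) else 0) * ‖f n p.2‖ ^ 2 :=
      Summable.mul_of_nonneg (f := fun l : Z2 => if l ∈ B then (1 : ℝ) else 0)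
        (summable_of_ne_finset_zero (s := B) fun b hb => by simp [hb]) hf.sq_summable
        (fun l => by dsimp; split_ifs <;> simp) (fun _ => sq_nonneg _)
    have s2 : Summable fun p : Z2 × (Fin n → Z2) => ‖g (n + 1) (split p.2 a p.1)‖ ^ 2 := by
      have := (splitEquiv (0 : Fin (n + 1)) a).summable_iff.2 hg.sq_summable
      refine this.congr fun p => ?_
      simp only [Function.comp]
      rw [← split_symm hg 0 a p.1 p.2]
    refine Summable.of_norm_bounded ((s1.add s2).mul_left D) fun p => ?_
    by_cases h : cutoff ε p.1 (p.2 a - p.1) = 0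
    · simp only [t, h]
      have hD0 : 0 ≤ D := Finset.sum_nonneg fun _ _ => abs_nonneg _
      have : 0 ≤ (if p.1 ∈ B then (1 : ℝ) else 0) := by split_ifs <;> simp
      simp only [Complex.ofReal_zero, mul_zero, zero_mul, norm_zero]
      positivity
    · obtain ⟨h1, h2⟩ := hB _ _ h
      rw [add_sub_cancel] at h2
      have h3 : |dot w (p.2 a)| ≤ D :=
        Finset.single_le_sum (f := fun p => |dot w p|) (fun _ _ => abs_nonneg _) h2
      have h4 := cutoff_le_one ε p.1 (p.2 a - p.1)
      simp only [t, norm_mul, Complex.norm_real, Real.norm_eq_abs, RCLike.norm_conj, if_pos h1,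
        one_mul]
      set x := ‖f n p.2‖
      set y := ‖g (n + 1) (split p.2 a p.1)‖
      have hx : 0 ≤ x := norm_nonneg _
      have hy : 0 ≤ y := norm_nonneg _
      have h5 : |dot w (p.2 a)| * |cutoff ε p.1 (p.2 a - p.1)| ≤ D * 1 :=
        mul_le_mul h3 h4 (abs_nonneg _) ((abs_nonneg _).trans h3)
      calc _ ≤ D * 1 * x * y := by gcongr
        _ = D * (x * y) := by ring
        _ ≤ D * (x ^ 2 + y ^ 2) := by
          have : 0 ≤ D := (abs_nonneg _).trans h3
          gcongr
          nlinarith [sq_nonneg (x - y)]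
  -- the pieces of `⟨𝒜_+ f, g⟩`
  let X : (Fin (n + 1) → Z2) → Fin (n + 1) → Fin (n + 1) → ℂ := fun k i j =>
    (dot w (k i + k j) : ℂ) * (cutoff ε (k i) (k j) : ℂ) * f n (merge k i j) *
      (starRingEnd ℂ) (g (n + 1) k)
  have hXs : ∀ k i j, i ≠ j → X k i j = X k j i := by
    intro k i j _
    simp only [X]
    rw [add_comm, cutoff_comm, merge_comm hf k j i]
  have hXt : ∀ (j : Fin (n + 1)) (a : Fin n),
      (fun k => X k (j.succAbove a) j) ∘ splitEquiv j a = t a := by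
    intro j a
    funext p
    obtain ⟨l, q⟩ := p
    have e1 : (splitEquiv j a (l, q)) j = l := by simp [splitEquiv]
    have e2 : (splitEquiv j a (l, q)) (j.succAbove a) = q a - l := by simp [splitEquiv]
    have e3 : merge (splitEquiv j a (l, q)) (j.succAbove a) j = q :=
      congrArg Prod.snd ((splitEquiv j a).left_inv (l, q))
    simp only [Function.comp, X, t]
    rw [e1, e2, e3, split_symm hg, sub_add_cancel, cutoff_comm]
  have hsum : ∀ (j : Fin (n + 1)) (a : Fin n), HasSum (fun k => X k (j.succAbove a) j) (∑' p, t a p) := by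
    intro j a
    rw [← (splitEquiv j a).hasSum_iff, hXt]
    exact (ht a).hasSum
  have hL : HasSum (fun k => Aplus ε w f (n + 1) k * (starRingEnd ℂ) (g (n + 1) k))
      (-(2 * Complex.I / (2 * Real.pi)) * ((lam ε : ℂ) / (n + 1)) *
        (1 / 2 * ∑ _j : Fin (n + 1), ∑ a, ∑' p, t a p)) := by
    have h1 : HasSum (fun k => ∑ j, ∑ a, X k (j.succAbove a) j)
        (∑ _j : Fin (n + 1), ∑ a, ∑' p, t a p) :=
      hasSum_sum fun j _ => hasSum_sum fun a _ => hsum j a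
    refine ((h1.mul_left (1 / 2)).mul_left
      (-(2 * Complex.I / (2 * Real.pi)) * ((lam ε : ℂ) / (n + 1)))).congr_fun ?_
    intro k
    rw [← sum_lt_eq (X k) (hXs k)]
    simp only [Aplus, X, ← Finset.sum_mul]
    ring
  have hR : ∀ a, HasSum (fun q : Fin n → Z2 => f n q * ((dot w (q a) : ℂ) *
      (starRingEnd ℂ) (∑' l : Z2, (cutoff ε l (q a - l) : ℂ) * g (n + 1) (split q a l))))
      (∑' p, t a p) := by
    intro a
    have h1 := ((ht a).prod_symm).hasSum
    have h2 : ∑' p : (Fin n → Z2) × Z2, t a p.swap = ∑' p, t a p :=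
      (Equiv.prodComm _ _).tsum_eq (t a)
    rw [h2] at h1
    refine (h1.prod_fiberwise fun q => ?_)
    have h3 : Summable fun l : Z2 => (cutoff ε l (q a - l) : ℂ) * g (n + 1) (split q a l) :=
      summable_of_ne_finset_zero (s := B) fun l hl => by
        have : cutoff ε l (q a - l) = 0 := by
          by_contra h
          exact hl (hB _ _ h).1
        simp [this]
    have h4 := (h3.hasSum.map (starRingEnd ℂ) Complex.continuous_conj).mul_left
      (f n q * (dot w (q a) : ℂ))
    rw [mul_assoc] at h4
    refine h4.congr_fun ?_
    intro l
    simp [t]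
    ring
  have hR' : HasSum (fun q => f n q * (starRingEnd ℂ) (Aminus ε w g n q))
      (Complex.I / (2 * Real.pi) * ((n : ℂ) + 1) * (lam ε : ℂ) * ∑ a, ∑' p, t a p) := by
    refine ((hasSum_sum fun a (_ : a ∈ Finset.univ) => hR a).mul_left
      (Complex.I / (2 * Real.pi) * ((n : ℂ) + 1) * (lam ε : ℂ))).congr_fun ?_
    intro q
    simp only [Aminus, map_mul, map_neg, map_sum, map_div₀, Complex.conj_I, map_add, map_one,
      Complex.conj_ofReal, map_natCast, map_ofNat, Finset.mul_sum]
    refine Finset.sum_congr rfl fun a _ => ?_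
    ring
  rw [hL.tsum_eq, hR'.tsum_eq, Nat.factorial_succ]
  have hn : (n : ℂ) + 1 ≠ 0 := by exact_mod_cast n.succ_ne_zero
  simp only [Finset.sum_const, Finset.card_univ, Fintype.card_fin, nsmul_eq_mul]
  push_cast
  field_simp

end Burgers2D

end

open Burgers2D

/-! The operator `𝒜^ε_-` splits a momentum `k_j` into `l` and `k_j - l`; `𝒜^ε_+` merges a pair. If
the merged pair is the one just produced, the original momenta return and the contribution is a
Fourier multiplier (the diagonal part); every other pair gives the off-diagonal part. The identity
`replacementOp_eq` records this decomposition.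

Diagonal part. The multiplier is a sum over `j` of `(𝔴·k_j)²` times the difference of `λ_ε²/(2π²)
∑_l 𝕁 · resolvent` and `½ G(L^ε(A))`, where `A = ½|k_{1:n}|²`. The lattice sum is logarithmically
large, so `λ_ε²` is compensated and the leading order must cancel exactly. The sum is compared with
the integral of `density`, in which the quadratic form has been made to factor into a radial and an
angular part and the sharp cut-off is replaced by `1/(1 + ε²(|z|² + A))`. The angular integral is
`2π/√(1 + |𝔴|² g)`, with `g` the symbol of `𝒢^ε`. Since `G' = 1/(π√(1 + |𝔴|² G))` and `d/dy log(1 +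
1/(ε²y)) = -1/(y(1 + ε²y))`, the radial integrand is then an exact derivative and the integral
equals `π² λ_ε⁻² G(L^ε(A))` (`lintegral_density`). This is where the formula for `G` comes from.

The replacement error in each unit cell is bounded by lattice weights `K/(⟨l⟩(|l|² + K²))` with `K =
√A` and `K = 1/ε`. Their sums are bounded uniformly in `K` (`tsum_weight_le`), so the bracket is
`O(λ_ε²)` (`diagonal_estimate`).

Off-diagonal part. Two distinct pairs each contain an index absent from the other. Calling these
indices `b` and `d`, Cauchy–Schwarz with the ratio `|κ_d|/|κ_b|` turns the free sum over `κ_b` into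
a sum of the same weight with `K = |κ_d|`, with no logarithm, so the prefactor `λ_ε²` survives
(`pair_bound`). There are `O(n³)` choices of `j` and of the other pair, and symmetry gains `1/n`
because one coordinate carries only the share `2/n` of the energy (`tsum_sqNorm_coord`). This leaves
`n²`, one factor for each `𝒩`.

`chaos_bound` combines both parts on one chaos. The first claim follows by Cauchy–Schwarz over the
chaoses, the second by duality. -/

noncomputable section

namespace Burgers2D

open MeasureTheory Set Filter Topology
open scoped ENNReal

/-! ### Lattice sums as integrals over unit cells; polar coordinates -/

/-- The lattice point at the lower left corner of the unit cell that contains `z`. -/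
def floorPt (z : ℝ × ℝ) : Z2 := ![⌊z.1⌋, ⌊z.2⌋]

theorem measurable_floorPt : Measurable floorPt := by
  refine measurable_pi_iff.2 fun a => ?_
  fin_cases a
  · exact Int.measurable_floor.comp measurable_fst
  · exact Int.measurable_floor.comp measurable_snd

/-- Unit cells have area one. A lattice sum is therefore exactly the integral of a step function,
and sums and integrals can be compared pointwise in the plane. -/
theorem map_floorPt : (volume : Measure (ℝ × ℝ)).map floorPt = Measure.count := by
  refine Measure.ext_of_singleton fun l => ?_
  rw [Measure.map_apply measurable_floorPt (measurableSet_singleton l), Measure.count_singleton]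
  have : floorPt ⁻¹' {l} = Ico (l 0 : ℝ) (l 0 + 1) ×ˢ Ico (l 1 : ℝ) (l 1 + 1) := by
    ext z
    simp only [mem_preimage, mem_singleton_iff, floorPt, mem_prod, mem_Ico, ← Int.floor_eq_iff,
      funext_iff, Fin.forall_fin_two, Matrix.cons_val_zero, Matrix.cons_val_one]
  rw [this, Measure.volume_eq_prod, Measure.prod_prod]
  simp

theorem lintegral_comp_floorPt (F : Z2 → ℝ≥0∞) : ∫⁻ z, F (floorPt z) = ∑' l, F l := by
  rw [← lintegral_count, ← map_floorPt, lintegral_map (measurable_of_countable F) measurable_floorPt]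

theorem lintegral_polar {f : ℝ × ℝ → ℝ≥0∞} (hf : Measurable f) :
    ∫⁻ z, f z = ∫⁻ r in Ioi (0 : ℝ), ENNReal.ofReal r *
      ∫⁻ θ in Ioo (-Real.pi) Real.pi, f (r * Real.cos θ, r * Real.sin θ) := by
  rw [← lintegral_comp_polarCoord_symm, polarCoord_target, Measure.volume_eq_prod,
    ← Measure.prod_restrict, lintegral_prod]
  · refine lintegral_congr fun r => ?_
    simp only [polarCoord_symm_apply, smul_eq_mul]
    rw [lintegral_const_mul]
    exact hf.comp (by fun_prop)
  · refine Measurable.aemeasurable ?_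
    simp only [polarCoord_symm_apply, smul_eq_mul]
    exact (by fun_prop : Measurable fun z : ℝ × ℝ => ENNReal.ofReal z.1).mul
      (hf.comp (by fun_prop))

theorem lintegral_Ioi_of_hasDerivAt {F F' : ℝ → ℝ} {a l : ℝ}
    (hF : ∀ x ∈ Ici a, HasDerivAt F (F' x) x) (h0 : ∀ x ∈ Ioi a, 0 ≤ F' x)
    (hl : Tendsto F atTop (𝓝 l)) :
    ∫⁻ x in Ioi a, ENNReal.ofReal (F' x) = ENNReal.ofReal (l - F a) := by
  rw [← integral_Ioi_of_hasDerivAt_of_nonneg' hF h0 hl, ofReal_integral_eq_lintegral_ofReal]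
  · exact integrableOn_Ioi_deriv_of_nonneg' hF h0 hl
  · exact (ae_restrict_iff' measurableSet_Ioi).2 (ae_of_all _ h0)

/-! ### Lattice weights with uniformly bounded sums -/

theorem sqNorm_eq (k : Z2) : sqNorm k = (k 0 : ℝ) ^ 2 + (k 1 : ℝ) ^ 2 := by
  simp [sqNorm, Fin.sum_univ_two]

theorem sqNorm_nonneg (k : Z2) : 0 ≤ sqNorm k := by
  rw [sqNorm_eq]; positivity

theorem one_le_sqNorm {k : Z2} (hk : k ≠ 0) : 1 ≤ sqNorm k := by
  have h : 0 < k 0 ^ 2 + k 1 ^ 2 := by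
    by_contra h
    apply hk
    have h0 : k 0 = 0 := by nlinarith [sq_nonneg (k 0), sq_nonneg (k 1)]
    have h1 : k 1 = 0 := by nlinarith [sq_nonneg (k 0), sq_nonneg (k 1)]
    funext a
    fin_cases a <;> simp [h0, h1]
  rw [sqNorm_eq]
  exact_mod_cast h

/-- The lattice weight `K / (⟨l⟩ (|l|² + K²))`, whose sum over `l` is bounded uniformly in `K`. -/
def weight (K : ℝ) (l : Z2) : ℝ := K / (√(sqNorm l + 1) * (sqNorm l + K ^ 2))

theorem weight_nonneg {K : ℝ} (hK : 0 ≤ K) (l : Z2) : 0 ≤ weight K l := by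
  have := sqNorm_nonneg l
  unfold weight; positivity

theorem floorPt_bounds (z : ℝ × ℝ) :
    |z.1 - floorPt z 0| ≤ 1 ∧ |z.2 - floorPt z 1| ≤ 1 := by
  simp only [floorPt, Matrix.cons_val_zero, Matrix.cons_val_one, abs_le]
  have h1 := Int.floor_le z.1
  have h2 := Int.lt_floor_add_one z.1
  have h3 := Int.floor_le z.2
  have h4 := Int.lt_floor_add_one z.2
  refine ⟨⟨?_, ?_⟩, ⟨?_, ?_⟩⟩ <;> linarith

theorem sq_le_sqNorm_floorPt (z : ℝ × ℝ) :
    z.1 ^ 2 + z.2 ^ 2 ≤ 2 * sqNorm (floorPt z) + 4 := by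
  obtain ⟨h1, h2⟩ := floorPt_bounds z
  rw [sqNorm_eq]
  have := sq_le_one_iff_abs_le_one _ |>.2 h1
  have := sq_le_one_iff_abs_le_one _ |>.2 h2
  nlinarith [sq_nonneg (z.1 - 2 * floorPt z 0), sq_nonneg (z.2 - 2 * floorPt z 1)]

theorem sqNorm_floorPt_le (z : ℝ × ℝ) :
    sqNorm (floorPt z) ≤ 2 * (z.1 ^ 2 + z.2 ^ 2) + 4 := by
  obtain ⟨h1, h2⟩ := floorPt_bounds z
  rw [sqNorm_eq]
  have := sq_le_one_iff_abs_le_one _ |>.2 h1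
  have := sq_le_one_iff_abs_le_one _ |>.2 h2
  nlinarith [sq_nonneg (2 * z.1 - floorPt z 0), sq_nonneg (2 * z.2 - floorPt z 1)]

theorem weight_floorPt_le {K : ℝ} (hK : 1 / 2 ≤ K) (z : ℝ × ℝ) :
    weight K (floorPt z) ≤
      60 * (K / (√(z.1 ^ 2 + z.2 ^ 2 + 1) * (z.1 ^ 2 + z.2 ^ 2 + K ^ 2))) := by
  have h := sq_le_sqNorm_floorPt z
  set a := sqNorm (floorPt z) with ha
  have ha0 : 0 ≤ a := sqNorm_nonneg _
  set b := z.1 ^ 2 + z.2 ^ 2 with hb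
  have hb0 : 0 ≤ b := by positivity
  have hK0 : 0 < K := by linarith
  have h1 : √(b + 1) ≤ 3 * √(a + 1) := by
    rw [Real.sqrt_le_left (by positivity), mul_pow, Real.sq_sqrt (by positivity)]
    linarith
  have h2 : b + K ^ 2 ≤ 20 * (a + K ^ 2) := by nlinarith
  rw [weight, ← ha, mul_div_assoc', div_le_div_iff₀ (by positivity) (by positivity)]
  calc K * (√(b + 1) * (b + K ^ 2)) ≤ K * (3 * √(a + 1) * (20 * (a + K ^ 2))) := by gcongr
    _ = _ := by ring

/-- In polar coordinates the Jacobian `r` cancels the factor `⟨z⟩⁻¹`, leaving `∫ K/(r² + K²) dr =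
π/2`, which does not depend on `K`. This scale invariance is why the errors below cost no logarithm.
-/
theorem tsum_weight_le {K : ℝ} (hK : 1 / 2 ≤ K) :
    ∑' l, ENNReal.ofReal (weight K l) ≤ ENNReal.ofReal (60 * Real.pi ^ 2) := by
  have hK0 : 0 < K := by linarith
  rw [← lintegral_comp_floorPt]
  calc ∫⁻ z, ENNReal.ofReal (weight K (floorPt z))
      ≤ ∫⁻ z : ℝ × ℝ, ENNReal.ofReal
        (60 * (K / (√(z.1 ^ 2 + z.2 ^ 2 + 1) * (z.1 ^ 2 + z.2 ^ 2 + K ^ 2)))) :=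
        lintegral_mono fun z => ENNReal.ofReal_le_ofReal (weight_floorPt_le hK z)
    _ ≤ ∫⁻ r in Ioi (0 : ℝ), ENNReal.ofReal (120 * Real.pi) *
          ENNReal.ofReal (K / (r ^ 2 + K ^ 2)) := by
        rw [lintegral_polar (by fun_prop)]
        refine setLIntegral_mono' measurableSet_Ioi fun r hr => ?_
        have hr : 0 < r := hr
        have h1 : ∀ θ : ℝ, (r * Real.cos θ) ^ 2 + (r * Real.sin θ) ^ 2 = r ^ 2 := fun θ => by
          rw [mul_pow, mul_pow, ← mul_add, Real.cos_sq_add_sin_sq, mul_one]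
        simp only [h1, lintegral_const, Measure.restrict_apply MeasurableSet.univ, univ_inter,
          Real.volume_Ioo]
        rw [← ENNReal.ofReal_mul (by positivity), ← ENNReal.ofReal_mul (by positivity),
          ← ENNReal.ofReal_mul (by positivity)]
        refine ENNReal.ofReal_le_ofReal ?_
        have h2 : r ≤ √(r ^ 2 + 1) := Real.le_sqrt_of_sq_le (by linarith)
        have h3 : r * (K / (√(r ^ 2 + 1) * (r ^ 2 + K ^ 2))) ≤ K / (r ^ 2 + K ^ 2) := by
          rw [mul_div_assoc', div_le_div_iff₀ (by positivity) (by positivity)]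
          have : 0 ≤ K * (r ^ 2 + K ^ 2) := by positivity
          nlinarith
        have := Real.pi_pos
        calc r * (60 * (K / (√(r ^ 2 + 1) * (r ^ 2 + K ^ 2))) * (Real.pi - -Real.pi))
            = 120 * Real.pi * (r * (K / (√(r ^ 2 + 1) * (r ^ 2 + K ^ 2)))) := by ring
          _ ≤ _ := by gcongr
    _ = ENNReal.ofReal (60 * Real.pi ^ 2) := by
        rw [lintegral_const_mul _ (by fun_prop), lintegral_Ioi_of_hasDerivAt
          (F := fun r => Real.arctan (r / K)) (l := Real.pi / 2)]
        · rw [zero_div, Real.arctan_zero, sub_zero, ← ENNReal.ofReal_mul (by positivity)]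
          congr 1; ring
        · intro r _
          convert (((hasDerivAt_id r).div_const K).arctan) using 1
          simp only [id_eq]
          field_simp
          ring_nf
          simp
        · intro r _; positivity
        · exact (Real.tendsto_arctan_atTop.mono_right nhdsWithin_le_nhds).comp
            (tendsto_id.atTop_div_const hK0)

/-! ### The angular integral -/

section Angular

variable {p q b : ℝ}

/-- With `u = p cos θ + q sin θ`, `v = u'` and `s = √(1 + b(p² + q²))`, the usual primitive `s⁻¹
arctan(s⁻¹ tan φ)`, `φ` being the angle to `(p, q)`, jumps where `u = 0`. Writing that arctangent as
`φ` plus a difference of angles and applying the subtraction formula for `tan` gives the form used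
here: its denominator `s u² + v²` never vanishes, so it is smooth on the whole line. -/
theorem hasDerivAt_angular (hpq : 0 < p ^ 2 + q ^ 2) (hb : 0 ≤ b) (θ : ℝ) :
    HasDerivAt (fun θ => (1 / √(1 + b * (p ^ 2 + q ^ 2))) * (θ + Real.arctan
        ((√(1 + b * (p ^ 2 + q ^ 2)) - 1) *
          ((p * Real.cos θ + q * Real.sin θ) * (q * Real.cos θ - p * Real.sin θ)) /
          (√(1 + b * (p ^ 2 + q ^ 2)) * (p * Real.cos θ + q * Real.sin θ) ^ 2 +
            (q * Real.cos θ - p * Real.sin θ) ^ 2))))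
      (1 / (1 + b * (p * Real.cos θ + q * Real.sin θ) ^ 2)) θ := by
  set W := p ^ 2 + q ^ 2 with hW
  have hs2 : √(1 + b * W) ^ 2 = 1 + b * W := Real.sq_sqrt (by positivity)
  have hs : 0 < √(1 + b * W) := Real.sqrt_pos.2 (by positivity)
  set s := √(1 + b * W)
  have hu : HasDerivAt (fun θ => p * Real.cos θ + q * Real.sin θ)
      (q * Real.cos θ - p * Real.sin θ) θ := by
    refine (((Real.hasDerivAt_cos θ).const_mul p).fun_add
      ((Real.hasDerivAt_sin θ).const_mul q)).congr_deriv ?_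
    ring
  have hv : HasDerivAt (fun θ => q * Real.cos θ - p * Real.sin θ)
      (-(p * Real.cos θ + q * Real.sin θ)) θ := by
    refine (((Real.hasDerivAt_cos θ).const_mul q).fun_sub
      ((Real.hasDerivAt_sin θ).const_mul p)).congr_deriv ?_
    ring
  have huv : (p * Real.cos θ + q * Real.sin θ) ^ 2 + (q * Real.cos θ - p * Real.sin θ) ^ 2 = W := by
    have := Real.cos_sq_add_sin_sq θ
    rw [hW]
    linear_combination (p ^ 2 + q ^ 2) * this
  have hden : 0 < s * (p * Real.cos θ + q * Real.sin θ) ^ 2 +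
      (q * Real.cos θ - p * Real.sin θ) ^ 2 := by
    rcases eq_or_ne (p * Real.cos θ + q * Real.sin θ) 0 with h | h
    · rw [h] at huv ⊢
      nlinarith
    · positivity
  have hd := (((hasDerivAt_id' θ).fun_add ((((hu.fun_mul hv).const_mul (s - 1)).fun_div
    (((hu.fun_pow 2).const_mul s).fun_add (hv.fun_pow 2)) hden.ne').arctan)).const_mul (1 / s))
  refine (hd.congr_deriv ?_)
  clear hd hu hv
  generalize p * Real.cos θ + q * Real.sin θ = u at *
  generalize q * Real.cos θ - p * Real.sin θ = v at *
  have h1 : 0 < 1 + b * u ^ 2 := by positivity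
  have h4 : s ^ 2 * u ^ 2 + v ^ 2 = W * (1 + b * u ^ 2) := by rw [hs2, ← huv]; ring
  have h2 : (s * u ^ 2 + v ^ 2) ^ 2 + ((s - 1) * (u * v)) ^ 2 = W ^ 2 * (1 + b * u ^ 2) := by
    rw [sq W, mul_assoc, ← h4, ← huv]
    ring
  have h3 : 1 + ((s - 1) * (u * v) / (s * u ^ 2 + v ^ 2)) ^ 2 =
      W ^ 2 * (1 + b * u ^ 2) / (s * u ^ 2 + v ^ 2) ^ 2 := by
    rw [← h2]; field_simp
  rw [h3]
  have h5 : ∀ M X : ℝ, M ≠ 0 → 1 / (W ^ 2 * (1 + b * u ^ 2) / M ^ 2) * (X / M ^ 2) =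
      X / (W ^ 2 * (1 + b * u ^ 2)) := fun M X hM => by field_simp
  rw [h5 _ _ hden.ne', mul_add, mul_one]
  rw [div_mul_div_comm, one_mul, div_add_div _ _ hs.ne' (by positivity), div_eq_div_iff
    (by positivity) h1.ne']
  push_cast
  -- Once `b u²` is expressed through `s`, `u`, `v` and `W = u² + v²` is substituted, a rational
  -- identity in `s`, `u`, `v` remains.
  have h6 : b * u ^ 2 = (s ^ 2 * u ^ 2 + v ^ 2) / W - 1 := by rw [h4]; field_simp; ring
  rw [h6]
  field_simp
  rw [← huv]
  ring

theorem lintegral_angular (hpq : 0 < p ^ 2 + q ^ 2) (hb : 0 ≤ b) :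
    ∫⁻ θ in Ioo (-Real.pi) Real.pi,
        ENNReal.ofReal (1 / (1 + b * (p * Real.cos θ + q * Real.sin θ) ^ 2)) =
      ENNReal.ofReal (2 * Real.pi / √(1 + b * (p ^ 2 + q ^ 2))) := by
  have hc : Continuous fun θ => 1 / (1 + b * (p * Real.cos θ + q * Real.sin θ) ^ 2) :=
    continuous_const.div (by fun_prop) fun θ => by positivity
  rw [restrict_Ioo_eq_restrict_Ioc, ← ofReal_integral_eq_lintegral_ofReal
    (hc.integrableOn_Icc.mono_set Ioc_subset_Icc_self) (ae_of_all _ fun θ => by positivity),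
    ← intervalIntegral.integral_of_le (by linarith [Real.pi_pos]),
    intervalIntegral.integral_eq_sub_of_hasDerivAt (fun θ _ => hasDerivAt_angular hpq hb θ)
      (hc.intervalIntegrable _ _)]
  congr 1
  -- The arctangent terms agree at `π` and `-π`, so only the linear term contributes, namely `2π/s`.
  simp only [Real.cos_neg, Real.cos_pi, Real.sin_neg, Real.sin_pi]
  ring_nf

end Angular

/-! ### The differential equation for `G` and the radial integral -/

section Radial

variable {ε : ℝ} {w : EuclideanSpace ℝ (Fin 2)}

theorem norm_sq_eq (w : EuclideanSpace ℝ (Fin 2)) : ‖w‖ ^ 2 = w 0 ^ 2 + w 1 ^ 2 := by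
  simp [EuclideanSpace.real_norm_sq_eq, Fin.sum_univ_two]

theorem lam_sq (h0 : 0 < ε) (h1 : ε < 1) : lam ε ^ 2 = 1 / Real.log (ε ^ (-2 : ℤ)) := by
  have : 0 < Real.log (ε ^ (-2 : ℤ)) := by
    refine Real.log_pos ?_
    rw [zpow_neg, zpow_ofNat]
    exact (one_lt_inv₀ (by positivity)).2 (by nlinarith)
  rw [lam, div_pow, one_pow, Real.sq_sqrt this.le]

theorem lam_sq_pos (h0 : 0 < ε) (h1 : ε < 1) : 0 < lam ε ^ 2 := by
  rw [lam_sq h0 h1]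
  refine one_div_pos.2 (Real.log_pos ?_)
  rw [zpow_neg, zpow_ofNat]
  exact (one_lt_inv₀ (by positivity)).2 (by nlinarith)

theorem Leps_nonneg (ε : ℝ) {y : ℝ} (hy : 0 ≤ y) : 0 ≤ Leps ε y :=
  mul_nonneg (sq_nonneg _) (Real.log_nonneg (by
    have : 0 ≤ 1 / (ε ^ 2 * y) := by positivity
    linarith))

theorem hasDerivAt_Leps (h0 : 0 < ε) {y : ℝ} (hy : 0 < y) :
    HasDerivAt (Leps ε) (-(lam ε ^ 2 / (y * (1 + ε ^ 2 * y)))) y := by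
  have h : HasDerivAt (fun y => 1 + 1 / (ε ^ 2 * y)) (-(1 / (ε ^ 2 * y ^ 2))) y := by
    have := (((hasDerivAt_id' y).const_mul (ε ^ 2)).fun_inv (by positivity)).const_add 1
    simp only [one_div]
    refine this.congr_deriv ?_
    field_simp
  refine ((h.log (by positivity)).const_mul (lam ε ^ 2)).congr_deriv ?_
  field_simp
  ring

/-- The symbol of `𝒢^ε` as a function of the symbol of `-ℒ₀`. -/
def gSym (ε : ℝ) (w : EuclideanSpace ℝ (Fin 2)) (y : ℝ) : ℝ := G w (Leps ε y)

theorem slope_pos (w : EuclideanSpace ℝ (Fin 2)) {x : ℝ} (hx : 0 ≤ x) :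
    0 < 3 * ‖w‖ ^ 2 / (2 * Real.pi) * x + 1 := by
  have := Real.pi_pos
  positivity

theorem gSym_nonneg (ε : ℝ) (w : EuclideanSpace ℝ (Fin 2)) {y : ℝ} (hy : 0 ≤ y) : 0 ≤ gSym ε w y := by
  have h := Leps_nonneg ε hy
  have h2 : 0 ≤ 3 * ‖w‖ ^ 2 / (2 * Real.pi) * Leps ε y := by
    have := Real.pi_pos
    positivity
  have h3 : (1 : ℝ) ≤ (3 * ‖w‖ ^ 2 / (2 * Real.pi) * Leps ε y + 1) ^ ((2 : ℝ) / 3) :=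
    Real.one_le_rpow (by linarith) (by norm_num)
  exact mul_nonneg (by positivity) (by linarith)

/-- The power `2/3` in `G` makes `1 + |𝔴|² G` the square of a cube root; this cube root is also the
reciprocal of the power that appears on differentiating `G`. -/
theorem sqrt_one_add_gSym (hw : w ≠ 0) {y : ℝ} (hy : 0 ≤ y) :
    √(1 + gSym ε w y * ‖w‖ ^ 2) =
      (3 * ‖w‖ ^ 2 / (2 * Real.pi) * Leps ε y + 1) ^ ((1 : ℝ) / 3) := by
  have hn : ‖w‖ ≠ 0 := norm_ne_zero_iff.2 hw
  have hp := slope_pos w (Leps_nonneg ε hy)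
  have : 1 + gSym ε w y * ‖w‖ ^ 2 =
      ((3 * ‖w‖ ^ 2 / (2 * Real.pi) * Leps ε y + 1) ^ ((1 : ℝ) / 3)) ^ 2 := by
    rw [← Real.rpow_natCast (_ ^ (1 / 3 : ℝ)), ← Real.rpow_mul hp.le, gSym, G]
    field_simp
    norm_num
  rw [this, Real.sqrt_sq (by positivity)]

/-- This is the equation `G' = 1/(π√(1 + |𝔴|² G))` composed with `L^ε`. The factor `1 + ε²y` comes
from `L^ε` and dictates the smooth cut-off in `density`. -/
theorem hasDerivAt_gSym (h0 : 0 < ε) (hw : w ≠ 0) {y : ℝ} (hy : 0 < y) :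
    HasDerivAt (gSym ε w) (-(lam ε ^ 2 / Real.pi /
      (y * (1 + ε ^ 2 * y) * √(1 + gSym ε w y * ‖w‖ ^ 2)))) y := by
  have hn : ‖w‖ ≠ 0 := norm_ne_zero_iff.2 hw
  have hp := slope_pos w (Leps_nonneg ε hy.le)
  have := Real.pi_pos
  have h1 := (((((hasDerivAt_Leps h0 hy).const_mul (3 * ‖w‖ ^ 2 / (2 * Real.pi))).add_const 1)
    |>.rpow_const (p := 2 / 3) (Or.inl hp.ne')).sub_const 1).const_mul (1 / ‖w‖ ^ 2)
  refine h1.congr_deriv ?_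
  rw [sqrt_one_add_gSym hw hy.le, show (2 : ℝ) / 3 - 1 = -(1 / 3) by norm_num,
    Real.rpow_neg hp.le]
  have : 0 < (3 * ‖w‖ ^ 2 / (2 * Real.pi) * Leps ε y + 1) ^ ((1 : ℝ) / 3) := by positivity
  generalize (3 * ‖w‖ ^ 2 / (2 * Real.pi) * Leps ε y + 1) ^ ((1 : ℝ) / 3) = X at *
  field_simp

theorem tendsto_gSym (ε : ℝ) (h0 : 0 < ε) (w : EuclideanSpace ℝ (Fin 2)) :
    Tendsto (gSym ε w) atTop (𝓝 0) := by
  have h1 : Tendsto (fun y : ℝ => 1 + 1 / (ε ^ 2 * y)) atTop (𝓝 1) := by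
    have : Tendsto (fun y : ℝ => ε ^ 2 * y) atTop atTop :=
      tendsto_id.const_mul_atTop (by positivity)
    simpa using (this.inv_tendsto_atTop).const_add 1
  have h2 : Tendsto (Leps ε) atTop (𝓝 0) := by
    have := (h1.log one_ne_zero).const_mul (lam ε ^ 2)
    rwa [Real.log_one, mul_zero] at this
  have h3 := (((h2.const_mul (3 * ‖w‖ ^ 2 / (2 * Real.pi))).add_const 1).rpow_const
    (p := 2 / 3) (Or.inl (by simp))).sub_const 1 |>.const_mul (1 / ‖w‖ ^ 2)
  have h4 : (1 / ‖w‖ ^ 2) * ((3 * ‖w‖ ^ 2 / (2 * Real.pi) * 0 + 1) ^ ((2 : ℝ) / 3) - 1) = 0 := by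
    simp
  rwa [h4] at h3

theorem measurable_gSym (ε : ℝ) (w : EuclideanSpace ℝ (Fin 2)) : Measurable (gSym ε w) := by
  unfold gSym G Leps
  fun_prop

/-- The continuum counterpart, with a smooth cut-off, of the summand of the diagonal part of
`𝒜^ε_- (-ℒ₀ - ℒ₀^𝔴 𝒢^ε)⁻¹ 𝒜^ε_+`. -/
def density (ε : ℝ) (w : EuclideanSpace ℝ (Fin 2)) (A : ℝ) (z : ℝ × ℝ) : ℝ :=
  1 / ((1 + ε ^ 2 * (z.1 ^ 2 + z.2 ^ 2 + A)) * ((z.1 ^ 2 + z.2 ^ 2 + A) *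
    (1 + gSym ε w (z.1 ^ 2 + z.2 ^ 2 + A) * ((w 0 * z.1 + w 1 * z.2) ^ 2 / (z.1 ^ 2 + z.2 ^ 2)))))

theorem measurable_density (ε : ℝ) (w : EuclideanSpace ℝ (Fin 2)) (A : ℝ) :
    Measurable (density ε w A) := by
  have := (measurable_gSym ε w).comp (by fun_prop : Measurable fun z : ℝ × ℝ => z.1 ^ 2 + z.2 ^ 2 + A)
  simp only [Function.comp_def] at this
  unfold density
  fun_prop

/-- After the angular integration, the radial integrand is the derivative of `-π² λ_ε⁻² g(r² + A)`,
where `g` is `gSym`. It tends to zero at infinity, so only the value at `r = 0` remains. -/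
theorem lintegral_density (h0 : 0 < ε) (h1 : ε < 1) (hw : w ≠ 0) {A : ℝ} (hA : 0 < A) :
    ∫⁻ z, ENNReal.ofReal (density ε w A z) =
      ENNReal.ofReal (Real.pi ^ 2 / lam ε ^ 2 * gSym ε w A) := by
  have hl := lam_sq_pos h0 h1
  have hpi := Real.pi_pos
  have hF : ∀ r ∈ Ici (0 : ℝ), HasDerivAt (fun r => -(Real.pi ^ 2 / lam ε ^ 2 * gSym ε w (r ^ 2 + A)))
      (r * (1 / ((1 + ε ^ 2 * (r ^ 2 + A)) * (r ^ 2 + A))) *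
        (2 * Real.pi / √(1 + gSym ε w (r ^ 2 + A) * ‖w‖ ^ 2))) r := by
    intro r _
    have hY : 0 < r ^ 2 + A := by positivity
    have hg := gSym_nonneg ε w hY.le
    have hd := (((hasDerivAt_gSym h0 hw hY).comp r (((hasDerivAt_id' r).fun_pow 2).add_const A))
      |>.const_mul (Real.pi ^ 2 / lam ε ^ 2)).neg
    refine hd.congr_deriv ?_
    have hl' : lam ε ≠ 0 := fun h => by simp [h] at hl
    have : 0 < √(1 + gSym ε w (r ^ 2 + A) * ‖w‖ ^ 2) := Real.sqrt_pos.2 (by positivity)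
    generalize √(1 + gSym ε w (r ^ 2 + A) * ‖w‖ ^ 2) = X at *
    field_simp
    push_cast
    ring
  have hlim : Tendsto (fun r => -(Real.pi ^ 2 / lam ε ^ 2 * gSym ε w (r ^ 2 + A))) atTop (𝓝 0) := by
    have : Tendsto (fun r : ℝ => r ^ 2 + A) atTop atTop :=
      tendsto_atTop_add_const_right _ _ (tendsto_pow_atTop two_ne_zero)
    simpa using (((tendsto_gSym ε h0 w).comp this).const_mul (Real.pi ^ 2 / lam ε ^ 2)).neg
  have hmain := lintegral_Ioi_of_hasDerivAt hF (fun r hr => by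
    have hr : 0 < r := hr
    positivity) hlim
  rw [show Real.pi ^ 2 / lam ε ^ 2 * gSym ε w A =
    0 - -(Real.pi ^ 2 / lam ε ^ 2 * gSym ε w ((0 : ℝ) ^ 2 + A)) by norm_num, ← hmain,
    lintegral_polar (measurable_density ε w A).ennreal_ofReal]
  refine setLIntegral_congr_fun measurableSet_Ioi fun r hr => ?_
  have hr : 0 < r := hr
  have hY : 0 < r ^ 2 + A := by positivity
  have hg := gSym_nonneg ε w hY.le
  have h2 : ∀ θ : ℝ, (r * Real.cos θ) ^ 2 + (r * Real.sin θ) ^ 2 = r ^ 2 := fun θ => by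
    rw [mul_pow, mul_pow, ← mul_add, Real.cos_sq_add_sin_sq, mul_one]
  have h3 : ∀ θ : ℝ, density ε w A (r * Real.cos θ, r * Real.sin θ) =
      1 / ((1 + ε ^ 2 * (r ^ 2 + A)) * (r ^ 2 + A)) *
        (1 / (1 + gSym ε w (r ^ 2 + A) * (w 0 * Real.cos θ + w 1 * Real.sin θ) ^ 2)) := by
    intro θ
    have h4 : (w 0 * (r * Real.cos θ) + w 1 * (r * Real.sin θ)) ^ 2 / r ^ 2 =
        (w 0 * Real.cos θ + w 1 * Real.sin θ) ^ 2 := by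
      field_simp
    simp only [density, h2, h4]
    rw [div_mul_div_comm, one_mul, mul_assoc]
  simp only [h3]
  have hwp : 0 < w 0 ^ 2 + w 1 ^ 2 := by
    rw [← norm_sq_eq]
    have : 0 < ‖w‖ := norm_pos_iff.2 hw
    positivity
  have h5 : ∀ θ : ℝ, ENNReal.ofReal (1 / ((1 + ε ^ 2 * (r ^ 2 + A)) * (r ^ 2 + A)) *
        (1 / (1 + gSym ε w (r ^ 2 + A) * (w 0 * Real.cos θ + w 1 * Real.sin θ) ^ 2))) =
      ENNReal.ofReal (1 / ((1 + ε ^ 2 * (r ^ 2 + A)) * (r ^ 2 + A))) *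
      ENNReal.ofReal (1 / (1 + gSym ε w (r ^ 2 + A) *
        (w 0 * Real.cos θ + w 1 * Real.sin θ) ^ 2)) := fun θ =>
    ENNReal.ofReal_mul (by positivity)
  simp only [h5]
  rw [lintegral_const_mul _ (by fun_prop), lintegral_angular hwp hg, ← mul_assoc, norm_sq_eq,
    ← ENNReal.ofReal_mul hr.le, ← ENNReal.ofReal_mul (by positivity)]

end Radial

/-! ### Size and regularity of the symbol of `𝒢^ε` -/

section Symbol

variable {ε : ℝ} {w : EuclideanSpace ℝ (Fin 2)}

theorem gSym_le_Leps (hw : w ≠ 0) {y : ℝ} (hy : 0 ≤ y) : gSym ε w y ≤ Leps ε y / Real.pi := by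
  have hn : 0 < ‖w‖ := norm_pos_iff.2 hw
  have hL := Leps_nonneg ε hy
  have := Real.pi_pos
  have h := rpow_one_add_le_one_add_mul_self
    (s := 3 * ‖w‖ ^ 2 / (2 * Real.pi) * Leps ε y) (p := 2 / 3)
    (by have : 0 ≤ 3 * ‖w‖ ^ 2 / (2 * Real.pi) * Leps ε y := by positivity
        linarith) (by norm_num) (by norm_num)
  rw [gSym, G, add_comm]
  calc 1 / ‖w‖ ^ 2 * ((1 + 3 * ‖w‖ ^ 2 / (2 * Real.pi) * Leps ε y) ^ ((2 : ℝ) / 3) - 1)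
      ≤ 1 / ‖w‖ ^ 2 * (2 / 3 * (3 * ‖w‖ ^ 2 / (2 * Real.pi) * Leps ε y)) := by
        gcongr
        linarith
    _ = Leps ε y / Real.pi := by field_simp

theorem Leps_le {y : ℝ} (h0 : 0 < ε) (hy : 0 < y) : Leps ε y ≤ lam ε ^ 2 * (1 / (ε ^ 2 * y)) := by
  refine mul_le_mul_of_nonneg_left ?_ (sq_nonneg _)
  have := Real.log_le_sub_one_of_pos (x := 1 + 1 / (ε ^ 2 * y)) (by positivity)
  linarith

/-- At energies of order `ε⁻²` or more, the symbol is itself `O(λ_ε²)`. The decay in `y` also makes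
`ℒ₀^𝔴 𝒢^ε` bounded for fixed `ε`. -/
theorem gSym_le_inv (hw : w ≠ 0) {y : ℝ} (h0 : 0 < ε) (hy : 0 < y) :
    gSym ε w y ≤ lam ε ^ 2 * (1 / (ε ^ 2 * y)) := by
  refine (gSym_le_Leps hw hy.le).trans (le_trans ?_ (Leps_le h0 hy))
  exact div_le_self (Leps_nonneg ε hy.le) (by linarith [Real.pi_gt_three])

theorem lam_sq_le (h0 : 0 < ε) (h1 : ε ≤ 1 / 2) : lam ε ^ 2 ≤ 1 := by
  rw [lam_sq h0 (by linarith)]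
  have h4 : (4 : ℝ) ≤ ε ^ (-2 : ℤ) := by
    rw [zpow_neg, zpow_ofNat, le_inv_comm₀ (by norm_num) (by positivity)]
    nlinarith
  have : 1 ≤ Real.log (ε ^ (-2 : ℤ)) := by
    rw [Real.le_log_iff_exp_le (by positivity)]
    linarith [Real.exp_one_lt_d9]
  rw [div_le_one (by linarith)]
  exact this

/-- With `u = ε⁻² ≥ 4` one has `1 + 8u ≤ u³`, hence `L^ε ≤ 3 < π`. The threshold `1/8` is the lower
bound for the energy of a split configuration in `abs_summand_sub_density_le`. -/
theorem gSym_le_one (hw : w ≠ 0) {y : ℝ} (h0 : 0 < ε) (h1 : ε ≤ 1 / 2) (hy : 1 / 8 ≤ y) :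
    gSym ε w y ≤ 1 := by
  have hL : Leps ε y ≤ 3 := by
    have h4 : (4 : ℝ) ≤ ε ^ (-2 : ℤ) := by
      rw [zpow_neg, zpow_ofNat, le_inv_comm₀ (by norm_num) (by positivity)]
      nlinarith
    have hlog : 0 < Real.log (ε ^ (-2 : ℤ)) := Real.log_pos (by linarith)
    rw [Leps, lam_sq h0 (by linarith), one_div_mul_eq_div, div_le_iff₀ hlog]
    have : 3 * Real.log (ε ^ (-2 : ℤ)) = Real.log ((ε ^ (-2 : ℤ)) ^ 3) := by
      rw [Real.log_pow]; norm_num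
    rw [this]
    refine Real.log_le_log (by positivity) ?_
    have h2 : 1 / (ε ^ 2 * y) ≤ 8 * ε ^ (-2 : ℤ) := by
      rw [zpow_neg, zpow_ofNat, div_le_iff₀ (by positivity)]
      have : 8 * (ε ^ 2)⁻¹ * (ε ^ 2 * y) = 8 * y := by field_simp
      linarith
    generalize ε ^ (-2 : ℤ) = u at *
    nlinarith [mul_nonneg (by linarith : 0 ≤ u - 4) (by linarith : 0 ≤ u),
      mul_nonneg (mul_nonneg (by linarith : 0 ≤ u - 4) (by linarith : 0 ≤ u))
        (by linarith : 0 ≤ u)]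
  refine (gSym_le_Leps hw (by linarith)).trans ?_
  rw [div_le_one Real.pi_pos]
  linarith [Real.pi_gt_three]

/-- The derivative is at most `λ_ε²/(πy)`, and `λ_ε ≤ 1` when `ε ≤ 1/2`. -/
theorem abs_gSym_sub_le (hw : w ≠ 0) (h0 : 0 < ε) (h1 : ε ≤ 1 / 2) {m x y : ℝ} (hm : 0 < m)
    (hx : m ≤ x) (hy : m ≤ y) : |gSym ε w x - gSym ε w y| ≤ 1 / m * |x - y| := by
  refine (convex_Ici m).norm_image_sub_le_of_norm_hasDerivWithin_le (f := gSym ε w)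
    (fun z hz => (hasDerivAt_gSym h0 hw (hm.trans_le hz)).hasDerivWithinAt) (fun z hz => ?_) hy hx
  have hz : m ≤ z := hz
  have hz0 : 0 < z := hm.trans_le hz
  have hg := gSym_nonneg ε w hz0.le
  have hs : 1 ≤ √(1 + gSym ε w z * ‖w‖ ^ 2) := Real.one_le_sqrt.2 (by
    have : 0 ≤ gSym ε w z * ‖w‖ ^ 2 := by positivity
    linarith)
  have hl := lam_sq_le h0 h1
  have hpi := Real.pi_gt_three
  rw [norm_neg, Real.norm_of_nonneg (by positivity), div_div]
  refine div_le_div₀ zero_le_one hl hm ?_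
  calc m ≤ z := hz
    _ = 1 * (z * 1 * 1) := by ring
    _ ≤ Real.pi * (z * (1 + ε ^ 2 * z) * √(1 + gSym ε w z * ‖w‖ ^ 2)) := by
      gcongr
      · linarith
      · nlinarith [sq_nonneg ε, mul_nonneg (sq_nonneg ε) hz0.le]

end Symbol

/-! ### Comparison of the resolvent symbol with its continuum model, cell by cell -/

/-- The difference of the denominators is split into changes of the Laplacian symbol, of the
directional symbol and of `g`. Each is `O(s)`: in the last, `P ≲ V y` cancels the Lipschitz constant
`9/y`. Both denominators are comparable to `y` from below. -/
theorem abs_inv_sub_inv_le {x Y Q P g₁ g₂ y s V : ℝ} (hy : 0 < y) (hx : y ≤ 4 * x) (h1 : y ≤ 9 * Y)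
    (h2 : Y ≤ 9 * y) (hQ : 0 ≤ Q) (hP : 0 ≤ P) (hPV : P ≤ V * Y) (hg₁ : 0 ≤ g₁) (hg₁' : g₁ ≤ 1)
    (hg₂ : 0 ≤ g₂) (hxY : |x - Y| ≤ 10 * s) (hQP : |Q - P| ≤ 12 * V * s)
    (hg : |g₁ - g₂| ≤ 1 / (y / 9) * |x - Y|) (hV : 0 ≤ V) :
    |1 / (x + Q * g₁) - 1 / (Y + P * g₂)| ≤ 30000 * (1 + V) * (s / y ^ 2) := by
  have hs : 0 ≤ s := by nlinarith [abs_nonneg (x - Y)]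
  have hx0 : 0 < x := by linarith
  have hY0 : 0 < Y := by linarith
  have hD : x ≤ x + Q * g₁ := by nlinarith [mul_nonneg hQ hg₁]
  have hD' : Y ≤ Y + P * g₂ := by nlinarith [mul_nonneg hP hg₂]
  have hnum : |(Y + P * g₂) - (x + Q * g₁)| ≤ 830 * (1 + V) * s := by
    have e : (Y + P * g₂) - (x + Q * g₁) = -((x - Y) + (Q - P) * g₁ + P * (g₁ - g₂)) := by ring
    rw [e, abs_neg]
    have a1 : |(Q - P) * g₁| ≤ 12 * V * s := by
      rw [abs_mul, abs_of_nonneg hg₁]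
      nlinarith [abs_nonneg (Q - P)]
    have a2 : |P * (g₁ - g₂)| ≤ 810 * V * s := by
      rw [abs_mul, abs_of_nonneg hP]
      calc P * |g₁ - g₂| ≤ (V * (9 * y)) * (1 / (y / 9) * (10 * s)) := by
            refine mul_le_mul (hPV.trans (by gcongr)) (hg.trans (by gcongr)) (abs_nonneg _)
              (by positivity)
        _ = 810 * V * s := by field_simp; ring
    calc _ ≤ |x - Y| + |(Q - P) * g₁| + |P * (g₁ - g₂)| := abs_add_three _ _ _
      _ ≤ 10 * s + 12 * V * s + 810 * V * s := by gcongr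
      _ ≤ _ := by nlinarith [mul_nonneg hV hs]
  rw [div_sub_div _ _ (by linarith) (by linarith), abs_div, one_mul, mul_one,
    abs_of_pos (show 0 < (x + Q * g₁) * (Y + P * g₂) by
      apply mul_pos <;> linarith), mul_div_assoc', div_le_div_iff₀ (by
      apply mul_pos <;> linarith) (by positivity)]
  have hden : y ^ 2 ≤ 36 * ((x + Q * g₁) * (Y + P * g₂)) := by
    calc y ^ 2 = y * y := sq y
      _ ≤ (4 * (x + Q * g₁)) * (9 * (Y + P * g₂)) := by
        apply mul_le_mul <;> nlinarith
      _ = _ := by ring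
  calc _ ≤ (830 * (1 + V) * s) * (36 * ((x + Q * g₁) * (Y + P * g₂))) := by gcongr
    _ ≤ _ := by
      have : 0 ≤ (1 + V) * s * ((x + Q * g₁) * (Y + P * g₂)) := by
        have : 0 ≤ (x + Q * g₁) * (Y + P * g₂) := by
          apply mul_nonneg <;> linarith
        positivity
      nlinarith

theorem cutoff_eq {ε : ℝ} (h0 : 0 < ε) (l m : Z2) [Decidable ((l ≠ 0 ∧ ε ^ 2 * sqNorm l ≤ 1) ∧
      (m ≠ 0 ∧ ε ^ 2 * sqNorm m ≤ 1) ∧ (l + m ≠ 0 ∧ ε ^ 2 * sqNorm (l + m) ≤ 1))] :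
    cutoff ε l m = if (l ≠ 0 ∧ ε ^ 2 * sqNorm l ≤ 1) ∧ (m ≠ 0 ∧ ε ^ 2 * sqNorm m ≤ 1) ∧
      (l + m ≠ 0 ∧ ε ^ 2 * sqNorm (l + m) ≤ 1) then 1 else 0 := by
  have h1 : ∀ p : Z2, 0 < ε * √(sqNorm p) ↔ p ≠ 0 := by
    intro p
    rw [mul_pos_iff_of_pos_left h0, Real.sqrt_pos]
    refine ⟨fun h hp => ?_, fun h => by linarith [one_le_sqNorm h]⟩
    rw [hp, sqNorm_eq] at h
    simp at h
  have h2 : ∀ p : Z2, ε * √(sqNorm p) ≤ 1 ↔ ε ^ 2 * sqNorm p ≤ 1 := by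
    intro p
    rw [← abs_of_nonneg (by positivity : 0 ≤ ε * √(sqNorm p)), ← sq_le_one_iff_abs_le_one, mul_pow,
      Real.sq_sqrt (sqNorm_nonneg p)]
  unfold cutoff
  simp only [h1, h2]

theorem dot_eq (w : EuclideanSpace ℝ (Fin 2)) (k : Z2) : dot w k = w 0 * k 0 + w 1 * k 1 := by
  simp [dot, Fin.sum_univ_two]

theorem dot_sq_le (w : EuclideanSpace ℝ (Fin 2)) (k : Z2) :
    dot w k ^ 2 ≤ ‖w‖ ^ 2 * sqNorm k := by
  rw [dot_eq, norm_sq_eq, sqNorm_eq]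
  nlinarith [sq_nonneg (w 0 * k 1 - w 1 * k 0)]

theorem sqNorm_sub (p l : Z2) : sqNorm (p - l) =
    sqNorm p - 2 * ((p 0 : ℝ) * l 0 + p 1 * l 1) + sqNorm l := by
  simp only [sqNorm_eq, Pi.sub_apply, Int.cast_sub]
  ring

theorem dot_sub (w : EuclideanSpace ℝ (Fin 2)) (p l : Z2) : dot w (p - l) = dot w p - dot w l := by
  simp only [dot_eq, Pi.sub_apply, Int.cast_sub]
  ring

theorem abs_le_of_sq_le_sq_mul {t c s : ℝ} (hc : 0 ≤ c) (hs : 0 ≤ s) (h : t ^ 2 ≤ c ^ 2 * s ^ 2) :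
    |t| ≤ c * s :=
  abs_le_of_sq_le_sq (by rw [mul_pow]; exact h) (by positivity)

/-- A point of the unit cell with corner `l` has, up to errors of lower order, the same symbol as
the pair `(l, p - l)` of momenta. -/
theorem symbol_perturbation (w : EuclideanSpace ℝ (Fin 2)) {p : Z2} {K₂ W₂ A : ℝ} (hK : 0 ≤ K₂)
    (hW : 0 ≤ W₂) (hWK : W₂ ≤ ‖w‖ ^ 2 * K₂) (hA : A = 1 / 2 * (sqNorm p + K₂)) (hA1 : 1 / 2 ≤ A)
    (z : ℝ × ℝ) (l : Z2) (hl : l = floorPt z) :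
    |1 / 2 * (sqNorm l + sqNorm (p - l) + K₂) - (z.1 ^ 2 + z.2 ^ 2 + A)| ≤
        10 * √(A * (sqNorm l + A)) ∧
      |1 / 2 * (dot w l ^ 2 + dot w (p - l) ^ 2 + W₂) - (z.1 ^ 2 + z.2 ^ 2 + A) *
        ((w 0 * z.1 + w 1 * z.2) ^ 2 / (z.1 ^ 2 + z.2 ^ 2))| ≤
        12 * ‖w‖ ^ 2 * √(A * (sqNorm l + A)) := by
  obtain ⟨hd0, hd1⟩ := floorPt_bounds z
  rw [← hl] at hd0 hd1
  have hd0' := (sq_le_one_iff_abs_le_one _).2 hd0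
  have hd1' := (sq_le_one_iff_abs_le_one _).2 hd1
  set V := ‖w‖ ^ 2 with hV
  have hV0 : 0 ≤ V := sq_nonneg _
  have hL0 := sqNorm_nonneg l
  have hp0 := sqNorm_nonneg p
  set L := sqNorm l with hL
  -- The error scale `s = √(A(L + A))` dominates `A` and, up to constants, `|l||p|`. Since `A ≥
  -- 1/2`, it also dominates `|l|` and `1`, which control the displacement within the cell.
  have hs2 : √(A * (L + A)) ^ 2 = A * (L + A) := Real.sq_sqrt (by positivity)
  have hs0 : 0 ≤ √(A * (L + A)) := Real.sqrt_nonneg _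
  have hsA : A ≤ √(A * (L + A)) := Real.le_sqrt_of_sq_le (by nlinarith only [hA1, hL0])
  have hLs : L ≤ 2 * √(A * (L + A)) ^ 2 := by rw [hs2]; nlinarith only [hA1, hL0]
  have hLps : L * sqNorm p ≤ 2 * √(A * (L + A)) ^ 2 := by
    have : sqNorm p ≤ 2 * A := by rw [hA]; linarith
    rw [hs2]; nlinarith only [mul_le_mul_of_nonneg_left this hL0, mul_nonneg hL0 hL0, hA1, sq_nonneg A]
  set s := √(A * (L + A))
  have hLe : L = (l 0 : ℝ) ^ 2 + (l 1 : ℝ) ^ 2 := sqNorm_eq l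
  have hpe : sqNorm p = (p 0 : ℝ) ^ 2 + (p 1 : ℝ) ^ 2 := sqNorm_eq p
  have hz0 : z.1 = l 0 + (z.1 - l 0) := by ring
  have hz1 : z.2 = l 1 + (z.2 - l 1) := by ring
  set d0 := z.1 - l 0
  set d1 := z.2 - l 1
  have hVe : V = w 0 ^ 2 + w 1 ^ 2 := norm_sq_eq w
  constructor
  · have b1 : |(l 0 : ℝ) * p 0 + l 1 * p 1| ≤ 2 * s := by
      refine abs_le_of_sq_le_sq_mul (by norm_num) hs0 ?_
      have : ((l 0 : ℝ) * p 0 + l 1 * p 1) ^ 2 ≤ L * sqNorm p := by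
        rw [hLe, hpe]; nlinarith only [sq_nonneg ((l 0 : ℝ) * p 1 - l 1 * p 0)]
      nlinarith only [sq_nonneg s, this, hLps]
    have b2 : |(l 0 : ℝ) * d0 + l 1 * d1| ≤ 2 * s := by
      refine abs_le_of_sq_le_sq_mul (by norm_num) hs0 ?_
      have : ((l 0 : ℝ) * d0 + l 1 * d1) ^ 2 ≤ L * (d0 ^ 2 + d1 ^ 2) := by
        rw [hLe]; nlinarith only [sq_nonneg ((l 0 : ℝ) * d1 - l 1 * d0)]
      have h2 : d0 ^ 2 + d1 ^ 2 ≤ 2 := by linarith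
      nlinarith only [mul_le_mul_of_nonneg_left h2 hL0, this, hLs]
    have e : 1 / 2 * (L + sqNorm (p - l) + K₂) - (z.1 ^ 2 + z.2 ^ 2 + A) =
        -(((l 0 : ℝ) * p 0 + l 1 * p 1) + 2 * (l 0 * d0 + l 1 * d1) + (d0 ^ 2 + d1 ^ 2)) := by
      rw [sqNorm_sub, ← hL, hA, hz0, hz1, hLe]; ring
    rw [e, abs_neg]
    have b3 : |d0 ^ 2 + d1 ^ 2| ≤ 4 * s := by
      rw [abs_of_nonneg (by positivity)]; linarith
    have b4 := abs_add_three ((l 0 : ℝ) * p 0 + l 1 * p 1) (2 * (l 0 * d0 + l 1 * d1))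
      (d0 ^ 2 + d1 ^ 2)
    rw [abs_mul 2, abs_of_pos (two_pos : (0 : ℝ) < 2)] at b4
    linarith
  · set e := w 0 * d0 + w 1 * d1 with he
    have hde : e ^ 2 ≤ 2 * V := by
      have : e ^ 2 ≤ V * (d0 ^ 2 + d1 ^ 2) := by
        rw [he, hVe]; nlinarith only [sq_nonneg (w 0 * d1 - w 1 * d0)]
      have h2 : d0 ^ 2 + d1 ^ 2 ≤ 2 := by linarith
      nlinarith only [mul_le_mul_of_nonneg_left h2 hV0, this]
    have hdl : dot w l ^ 2 ≤ V * L := dot_sq_le w l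
    have hdp : dot w p ^ 2 ≤ V * sqNorm p := dot_sq_le w p
    have hwz : w 0 * z.1 + w 1 * z.2 = dot w l + e := by
      rw [dot_eq, he, hz0, hz1]; ring
    have b1 : |dot w l * dot w p| ≤ (2 * V) * s := by
      refine abs_le_of_sq_le_sq_mul (by positivity) hs0 ?_
      calc (dot w l * dot w p) ^ 2 = dot w l ^ 2 * dot w p ^ 2 := mul_pow _ _ _
        _ ≤ (V * L) * (V * sqNorm p) := by gcongr
        _ = V ^ 2 * (L * sqNorm p) := by ring
        _ ≤ V ^ 2 * (2 * s ^ 2) := by gcongr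
        _ ≤ _ := by nlinarith only [mul_nonneg (sq_nonneg V) (sq_nonneg s)]
    have b2 : |dot w l * e| ≤ (2 * V) * s := by
      refine abs_le_of_sq_le_sq_mul (by positivity) hs0 ?_
      calc (dot w l * e) ^ 2 = dot w l ^ 2 * e ^ 2 := mul_pow _ _ _
        _ ≤ (V * L) * (2 * V) := by gcongr
        _ = 2 * V ^ 2 * L := by ring
        _ ≤ 2 * V ^ 2 * (2 * s ^ 2) := by gcongr
        _ = _ := by ring
    have b3 : |1 / 2 * (dot w p ^ 2 + W₂)| ≤ V * s := by
      rw [abs_of_nonneg (by positivity)]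
      have : dot w p ^ 2 + W₂ ≤ 2 * (V * A) := by rw [hA]; linarith
      nlinarith only [this, mul_le_mul_of_nonneg_left hsA hV0]
    have b4 : |e ^ 2| ≤ 4 * V * s := by
      rw [abs_of_nonneg (by positivity)]
      nlinarith only [hde, mul_le_mul_of_nonneg_left (hA1.trans hsA) hV0]
    -- Replacing `(𝔴·z)²` by `(|z|² + A)(𝔴·z)²/|z|²` costs at most `A|𝔴|²`. It makes the denominator
    -- of `density` a radial factor times one whose angular dependence is explicit.
    have b5 : |(w 0 * z.1 + w 1 * z.2) ^ 2 - (z.1 ^ 2 + z.2 ^ 2 + A) *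
        ((w 0 * z.1 + w 1 * z.2) ^ 2 / (z.1 ^ 2 + z.2 ^ 2))| ≤ V * s := by
      -- At the origin the quotient is `0/0 = 0` and both terms vanish.
      rcases eq_or_ne (z.1 ^ 2 + z.2 ^ 2) 0 with h | h
      · have h0 : z.1 = 0 := by nlinarith only [h, sq_nonneg z.1, sq_nonneg z.2]
        have h1 : z.2 = 0 := by nlinarith only [h, sq_nonneg z.1, sq_nonneg z.2]
        rw [h0, h1]
        simp only [mul_zero, add_zero, ne_eq, OfNat.ofNat_ne_zero, not_false_eq_true, zero_pow,
          zero_div, sub_zero, abs_zero]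
        positivity
      · have hpos : 0 < z.1 ^ 2 + z.2 ^ 2 := lt_of_le_of_ne (by positivity) h.symm
        have e2 : (w 0 * z.1 + w 1 * z.2) ^ 2 - (z.1 ^ 2 + z.2 ^ 2 + A) *
          ((w 0 * z.1 + w 1 * z.2) ^ 2 / (z.1 ^ 2 + z.2 ^ 2)) =
          -(A * ((w 0 * z.1 + w 1 * z.2) ^ 2 / (z.1 ^ 2 + z.2 ^ 2))) := by
          field_simp; ring
        rw [e2, abs_neg, abs_of_nonneg (by positivity)]
        have : (w 0 * z.1 + w 1 * z.2) ^ 2 / (z.1 ^ 2 + z.2 ^ 2) ≤ V := by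
          rw [div_le_iff₀ hpos, hVe]
          nlinarith only [sq_nonneg (w 0 * z.2 - w 1 * z.1)]
        calc _ ≤ A * V := by gcongr
          _ ≤ _ := by nlinarith only [mul_le_mul_of_nonneg_left hsA hV0]
    generalize (z.1 ^ 2 + z.2 ^ 2 + A) *
        ((w 0 * z.1 + w 1 * z.2) ^ 2 / (z.1 ^ 2 + z.2 ^ 2)) = P at *
    have e3 : 1 / 2 * (dot w l ^ 2 + dot w (p - l) ^ 2 + W₂) - P =
        1 / 2 * (dot w p ^ 2 + W₂) - dot w l * dot w p - 2 * (dot w l * e) - e ^ 2 +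
          ((w 0 * z.1 + w 1 * z.2) ^ 2 - P) := by
      rw [dot_sub, hwz]; ring
    rw [e3]
    rw [abs_le] at *
    constructor <;> linarith [b1.1, b1.2, b2.1, b2.2, b3.1, b3.2, b4.1, b4.2, b5.1, b5.2]

/-- The left side is `√A (L + A)^{-3/2}`, and `⟨l⟩ ≲ √(L + A)` because `A ≥ 1/2`. -/
theorem sqrt_mul_div_sq_le_weight {A L : ℝ} (hA : 1 / 2 ≤ A) (hL : 0 ≤ L) :
    √(A * (L + A)) / (L + A) ^ 2 ≤ 2 * (√A / (√(L + 1) * (L + √A ^ 2))) := by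
  have hA0 : 0 < A := by linarith
  rw [Real.sq_sqrt hA0.le, Real.sqrt_mul hA0.le]
  have h1 : √(L + 1) ≤ 2 * √(L + A) := by
    rw [Real.sqrt_le_left (by positivity), mul_pow, Real.sq_sqrt (by positivity)]
    linarith
  have h2 : √(L + A) * √(L + A) = L + A := Real.mul_self_sqrt (by positivity)
  have h3 : 0 < √(L + A) := Real.sqrt_pos.2 (by positivity)
  rw [mul_div_assoc', div_le_div_iff₀ (by positivity) (by positivity)]
  calc √A * √(L + A) * (√(L + 1) * (L + A))
      ≤ √A * √(L + A) * ((2 * √(L + A)) * (L + A)) := by gcongr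
    _ = 2 * √A * (√(L + A) * √(L + A)) * (L + A) := by ring
    _ = _ := by rw [h2]; ring

/-- For `|l| ≤ 1/ε` the weight at scale `1/ε` is bounded below by a multiple of `ε²`. -/
theorem sq_le_weight {ε L : ℝ} (h0 : 0 < ε) (h1 : ε ≤ 1 / 2) (hL : 0 ≤ L) (hε : ε ^ 2 * L ≤ 1) :
    ε ^ 2 ≤ 3 * ((1 / ε) / (√(L + 1) * (L + (1 / ε) ^ 2))) := by
  have hε2 : 0 < ε ^ 2 := by positivity
  have hεs : ε ^ 2 ≤ 1 / 4 := by nlinarith only [h0, h1]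
  have a1 : √(L + 1) ≤ 3 / 2 * (1 / ε) := by
    rw [Real.sqrt_le_left (by positivity), mul_pow, div_pow, div_pow, one_pow, mul_one_div,
      le_div_iff₀ hε2]
    nlinarith only [hε, hεs]
  have a2 : L + (1 / ε) ^ 2 ≤ 2 * (1 / ε) ^ 2 := by
    have : L ≤ (1 / ε) ^ 2 := by
      rw [div_pow, one_pow, le_div_iff₀ hε2]; linarith
    linarith
  rw [mul_div_assoc', le_div_iff₀ (by positivity)]
  calc _ ≤ ε ^ 2 * ((3 / 2 * (1 / ε)) * (2 * (1 / ε) ^ 2)) := by gcongr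
    _ = _ := by field_simp

/-- If `L ≤ 2A`, then `⟨l⟩ ≲ √A` and the weight at scale `√A` already dominates `1/Y`. Otherwise
`ε⁻² ≲ L + A`, and the extra decay `1/(ε²Y²)` of the smooth cut-off is dominated by the weight at
scale `1/ε`. -/
theorem tail_le_weight {ε L A Y : ℝ} (h0 : 0 < ε) (hL : 0 ≤ L) (hA : 1 / 2 ≤ A)
    (hY : L + A ≤ 9 * Y) (h : L ≤ 2 * A ∨ 1 ≤ 3 * (ε ^ 2 * (L + A))) :
    1 / Y / (1 + ε ^ 2 * Y) ≤ 2000 * (√A / (√(L + 1) * (L + √A ^ 2)) +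
      (1 / ε) / (√(L + 1) * (L + (1 / ε) ^ 2))) := by
  have hA0 : 0 < A := by linarith
  have hy0 : 0 < L + A := by linarith
  have hY0 : 0 < Y := by linarith
  have hε2 : 0 < ε ^ 2 := by positivity
  have hwA : 0 ≤ √A / (√(L + 1) * (L + √A ^ 2)) := by positivity
  have hwε : 0 ≤ (1 / ε) / (√(L + 1) * (L + (1 / ε) ^ 2)) := by positivity
  rcases h with hc | hc
  · have a1 : √(L + 1) ≤ 2 * √A := by
      rw [Real.sqrt_le_left (by positivity), mul_pow, Real.sq_sqrt hA0.le]
      linarith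
    have a2 : 1 / Y ≤ 18 * (√A / (√(L + 1) * (L + √A ^ 2))) := by
      rw [Real.sq_sqrt hA0.le, mul_div_assoc', div_le_div_iff₀ hY0 (by positivity)]
      calc 1 * (√(L + 1) * (L + A)) ≤ 1 * ((2 * √A) * (9 * Y)) := by gcongr
        _ = _ := by ring
    calc _ ≤ 1 / Y := div_le_self (by positivity) (by nlinarith only [mul_pos hε2 hY0])
      _ ≤ 18 * (√A / (√(L + 1) * (L + √A ^ 2))) := a2
      _ ≤ _ := by linarith
  · have hsL : √(L + 1) ≤ 2 * √(L + A) := by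
      rw [Real.sqrt_le_left (by positivity), mul_pow, Real.sq_sqrt (by positivity)]
      linarith
    have hsy : √(L + A) * √(L + A) = L + A := Real.mul_self_sqrt hy0.le
    have hsy0 : 0 < √(L + A) := Real.sqrt_pos.2 hy0
    have a0 : 1 ≤ 2 * (ε * √(L + A)) := by
      have h2 : (1 : ℝ) ^ 2 ≤ (2 * (ε * √(L + A))) ^ 2 := by
        rw [mul_pow, mul_pow, Real.sq_sqrt hy0.le]; linarith
      exact le_of_sq_le_sq h2 (by positivity)
    have a3 : (1 / ε) ^ 2 ≤ 3 * (L + A) := by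
      rw [div_pow, one_pow, div_le_iff₀ hε2]; linarith
    have b1 : √(L + 1) * (L + (1 / ε) ^ 2) ≤ (2 * √(L + A)) * (4 * (L + A)) := by
      gcongr
      linarith
    have b2 : ε ^ 2 * (L + A) ^ 2 ≤ 81 * (Y * (1 + ε ^ 2 * Y)) := by
      have h2 : (L + A) ^ 2 ≤ (9 * Y) ^ 2 := by gcongr
      nlinarith only [mul_le_mul_of_nonneg_left h2 hε2.le, hY0]
    have a2 : 1 / Y / (1 + ε ^ 2 * Y) ≤ 2000 * ((1 / ε) / (√(L + 1) * (L + (1 / ε) ^ 2))) := by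
      rw [div_div, mul_div_assoc', div_le_div_iff₀ (by positivity) (by positivity)]
      calc 1 * (√(L + 1) * (L + (1 / ε) ^ 2))
          ≤ (2 * (ε * √(L + A))) * ((2 * √(L + A)) * (4 * (L + A))) := by gcongr
        _ = 16 * (1 / ε) * (ε ^ 2 * ((√(L + A) * √(L + A)) * (L + A))) := by field_simp; ring
        _ = 16 * (1 / ε) * (ε ^ 2 * (L + A) ^ 2) := by rw [hsy, sq (L + A)]
        _ ≤ 16 * (1 / ε) * (81 * (Y * (1 + ε ^ 2 * Y))) := by gcongr
        _ = 1296 * ((1 / ε) * (Y * (1 + ε ^ 2 * Y))) := by ring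
        _ ≤ 2000 * ((1 / ε) * (Y * (1 + ε ^ 2 * Y))) := by gcongr; norm_num
        _ = _ := by ring
    linarith

/-- Comparison, in a unit cell, of the summand of the diagonal part of
`𝒜^ε_- (-ℒ₀ - ℒ₀^𝔴 𝒢^ε)⁻¹ 𝒜^ε_+` with its continuum counterpart. -/
theorem abs_summand_sub_density_le {ε : ℝ} {w : EuclideanSpace ℝ (Fin 2)} (hw : w ≠ 0) (h0 : 0 < ε)
    (h1 : ε ≤ 1 / 2) {p : Z2} (hp : p ≠ 0) (hpε : ε ^ 2 * sqNorm p ≤ 1) {K₂ W₂ A : ℝ} (hK : 0 ≤ K₂)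
    (hW : 0 ≤ W₂) (hWK : W₂ ≤ ‖w‖ ^ 2 * K₂) (hA : A = 1 / 2 * (sqNorm p + K₂))
    (z : ℝ × ℝ) (l : Z2) (hl : l = floorPt z) :
    |cutoff ε l (p - l) * (1 / (1 / 2 * (sqNorm l + sqNorm (p - l) + K₂) +
        1 / 2 * (dot w l ^ 2 + dot w (p - l) ^ 2 + W₂) *
        gSym ε w (1 / 2 * (sqNorm l + sqNorm (p - l) + K₂)))) - density ε w A z| ≤
      100000 * (1 + ‖w‖ ^ 2) * (weight √A l + weight (1 / ε) l) := by
  classical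
  have hA1 : 1 / 2 ≤ A := by
    have := one_le_sqNorm hp
    rw [hA]; linarith
  have hA0 : 0 < A := by linarith
  obtain ⟨hxY, hQP⟩ := symbol_perturbation w hK hW hWK hA hA1 z l hl
  have hYy := sq_le_sqNorm_floorPt z
  have hyY := sqNorm_floorPt_le z
  rw [← hl] at hYy hyY
  have hL0 := sqNorm_nonneg l
  have hpl := sqNorm_nonneg (p - l)
  have hpar : sqNorm p ≤ 2 * sqNorm l + 2 * sqNorm (p - l) := by
    simp only [sqNorm_eq, Pi.sub_apply, Int.cast_sub]
    nlinarith only [sq_nonneg ((p 0 : ℝ) - 2 * l 0), sq_nonneg ((p 1 : ℝ) - 2 * l 1)]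
  have hpar2 : sqNorm (p - l) ≤ 3 * sqNorm l + 3 / 2 * sqNorm p := by
    simp only [sqNorm_eq, Pi.sub_apply, Int.cast_sub]
    nlinarith only [sq_nonneg ((p 0 : ℝ) + 2 * l 0), sq_nonneg ((p 1 : ℝ) + 2 * l 1)]
  set L := sqNorm l with hL
  set x := 1 / 2 * (L + sqNorm (p - l) + K₂) with hx
  set Q := 1 / 2 * (dot w l ^ 2 + dot w (p - l) ^ 2 + W₂) with hQ
  have hV0 : 0 ≤ ‖w‖ ^ 2 := sq_nonneg _
  have hR0 : 0 ≤ z.1 ^ 2 + z.2 ^ 2 := by positivity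
  have hPV : (w 0 * z.1 + w 1 * z.2) ^ 2 / (z.1 ^ 2 + z.2 ^ 2) ≤ ‖w‖ ^ 2 := by
    refine div_le_of_le_mul₀ hR0 hV0 ?_
    rw [norm_sq_eq]
    nlinarith only [sq_nonneg (w 0 * z.2 - w 1 * z.1)]
  have hP0 : 0 ≤ (w 0 * z.1 + w 1 * z.2) ^ 2 / (z.1 ^ 2 + z.2 ^ 2) := by positivity
  rw [density]
  set c := (w 0 * z.1 + w 1 * z.2) ^ 2 / (z.1 ^ 2 + z.2 ^ 2)
  set R := z.1 ^ 2 + z.2 ^ 2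
  set V := ‖w‖ ^ 2
  have hy0 : 0 < L + A := by linarith
  have hY0 : 0 < R + A := by linarith
  -- By `hpar`, `|p|² ≤ 2|l|² + 2|p - l|²`: splitting a momentum cannot lower the energy by more
  -- than a constant factor.
  have hxy : L + A ≤ 4 * x := by rw [hA, hx]; linarith
  have hyY9 : L + A ≤ 9 * (R + A) := by linarith
  have hYy9 : R + A ≤ 9 * (L + A) := by linarith
  have hg1 := gSym_nonneg ε w (y := x) (by linarith)
  have hg1' := gSym_le_one (y := x) hw h0 h1 (by linarith)
  have hg2 := gSym_nonneg ε w (y := R + A) (by linarith)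
  have hg := abs_gSym_sub_le hw h0 h1 (m := (L + A) / 9) (by linarith) (x := x) (y := R + A)
    (by linarith) (by linarith)
  have hmain := abs_inv_sub_inv_le hy0 hxy hyY9 hYy9 (by positivity) (by positivity : 0 ≤ (R + A) * c)
    (by rw [mul_comm]; gcongr : (R + A) * c ≤ V * (R + A)) hg1 hg1' hg2 hxY hQP hg hV0
  have hmain2 : |1 / (x + Q * gSym ε w x) - 1 / (R + A + (R + A) * c * gSym ε w (R + A))| ≤
      60000 * (1 + V) * weight √A l := by
    refine hmain.trans ?_
    have := sqrt_mul_div_sq_le_weight hA1 hL0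
    rw [weight, ← hL]
    calc _ ≤ 30000 * (1 + V) * (2 * (√A / (√(L + 1) * (L + √A ^ 2)))) := by gcongr
      _ = _ := by ring
  have hD : 1 / ((1 + ε ^ 2 * (R + A)) * ((R + A) * (1 + gSym ε w (R + A) * c))) =
      1 / (R + A + (R + A) * c * gSym ε w (R + A)) / (1 + ε ^ 2 * (R + A)) := by
    rw [div_div]; congr 1; ring
  have hwA : 0 ≤ weight √A l := weight_nonneg (Real.sqrt_nonneg _) l
  have hwε : 0 ≤ weight (1 / ε) l := weight_nonneg (by positivity) l
  have hD' : R + A ≤ R + A + (R + A) * c * gSym ε w (R + A) := by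
    have : 0 ≤ (R + A) * c * gSym ε w (R + A) := by positivity
    linarith
  rw [hD, cutoff_eq h0]
  generalize R + A + (R + A) * c * gSym ε w (R + A) = D at *
  generalize x + Q * gSym ε w x = D₁ at *
  have hD0 : 0 < D := by linarith
  have hε2 : 0 < ε ^ 2 := by positivity
  split_ifs with hJ
  · obtain ⟨⟨-, hlε⟩, -⟩ := hJ
    -- Inside the sharp cut-off, inserting the smooth one changes the summand by at most `ε²`, since
    -- `R + A ≤ D`.
    have e1 : |1 / D - 1 / D / (1 + ε ^ 2 * (R + A))| ≤ ε ^ 2 := by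
      have : 1 / D - 1 / D / (1 + ε ^ 2 * (R + A)) =
          ε ^ 2 * ((R + A) / D) / (1 + ε ^ 2 * (R + A)) := by
        field_simp; ring
      rw [this, abs_of_nonneg (by positivity)]
      calc _ ≤ ε ^ 2 * ((R + A) / D) := div_le_self (by positivity) (by nlinarith only [mul_pos hε2 hY0])
        _ ≤ ε ^ 2 * 1 := by gcongr; exact (div_le_one hD0).2 hD'
        _ = ε ^ 2 := mul_one _
    have e2 : ε ^ 2 ≤ 3 * weight (1 / ε) l := sq_le_weight h0 h1 hL0 hlε
    rw [one_mul]
    calc _ ≤ |1 / D₁ - 1 / D| + |1 / D - 1 / D / (1 + ε ^ 2 * (R + A))| := abs_sub_le _ _ _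
      _ ≤ 60000 * (1 + V) * weight √A l + 3 * weight (1 / ε) l :=
        add_le_add hmain2 (e1.trans e2)
      _ ≤ _ := by nlinarith only [hwA, hwε, mul_nonneg hV0 hwA, mul_nonneg hV0 hwε]
  · rw [zero_mul, zero_sub, abs_neg, abs_of_nonneg (by positivity)]
    have hDle : 1 / D / (1 + ε ^ 2 * (R + A)) ≤ 1 / (R + A) / (1 + ε ^ 2 * (R + A)) := by
      gcongr
    refine hDle.trans ?_
    -- If both alternatives fail, then `|l|² > 2A ≥ |p|²` excludes `l = 0` and `l = p`, while `|p -
    -- l|² ≤ 3(L + A) < ε⁻²`. All the conditions of the cut-off would hold, contrary to `hJ`.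
    have hcases : L ≤ 2 * A ∨ 1 ≤ 3 * (ε ^ 2 * (L + A)) := by
      by_contra! hcon
      obtain ⟨hc1, hc2⟩ := hcon
      apply hJ
      have hpA : sqNorm p ≤ 2 * A := by rw [hA]; linarith
      refine ⟨⟨?_, ?_⟩, ⟨?_, ?_⟩, ⟨?_, ?_⟩⟩
      · rintro rfl
        rw [hL, sqNorm_eq] at hc1
        norm_num at hc1
        linarith
      · rw [← hL]; nlinarith only [hc2, mul_nonneg hε2.le hA0.le, mul_nonneg hε2.le hL0]
      · intro h
        rw [sub_eq_zero] at h
        rw [← h] at hL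
        linarith
      · have : sqNorm (p - l) ≤ 3 * (L + A) := by linarith
        nlinarith only [hc2, mul_le_mul_of_nonneg_left this hε2.le]
      · rwa [add_sub_cancel]
      · rwa [add_sub_cancel]
    refine (tail_le_weight h0 hL0 hA1 hyY9 hcases).trans ?_
    change 2000 * (weight √A l + weight (1 / ε) l) ≤ _
    gcongr
    linarith

/-! ### The diagonal part -/

/-- The symbol of the resolvent `(-ℒ₀ - ℒ₀^𝔴 𝒢^ε)⁻¹`. -/
def symRes (ε : ℝ) (w : EuclideanSpace ℝ (Fin 2)) (n : ℕ) (k : Fin n → Z2) : ℝ :=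
  (symNegL0 n k - symL0w w n k * symG ε w n k)⁻¹

theorem sum_split {n : ℕ} (F : Z2 → ℝ) (k : Fin n → Z2) (j : Fin n) (l : Z2) :
    ∑ i, F (split k j l i) = F l + F (k j - l) + ∑ i ∈ Finset.univ.erase j, F (k i) := by
  rw [Fin.sum_univ_succ, ← Finset.add_sum_erase _ _ (Finset.mem_univ j), add_assoc]
  simp only [split, Fin.cons_zero, Fin.cons_succ, Function.update_self]
  congr 2
  refine Finset.sum_congr rfl fun i hi => ?_
  rw [Function.update_of_ne (Finset.ne_of_mem_erase hi)]

theorem symRes_split (ε : ℝ) (w : EuclideanSpace ℝ (Fin 2)) {n : ℕ} (k : Fin n → Z2) (j : Fin n)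
    (l : Z2) : symRes ε w (n + 1) (split k j l) =
      1 / (1 / 2 * (sqNorm l + sqNorm (k j - l) + ∑ i ∈ Finset.univ.erase j, sqNorm (k i)) +
        1 / 2 * (dot w l ^ 2 + dot w (k j - l) ^ 2 + ∑ i ∈ Finset.univ.erase j, dot w (k i) ^ 2) *
        gSym ε w (1 / 2 * (sqNorm l + sqNorm (k j - l) +
          ∑ i ∈ Finset.univ.erase j, sqNorm (k i)))) := by
  have h1 := sum_split sqNorm k j l
  have h2 := sum_split (fun p => dot w p ^ 2) k j l
  rw [symRes, symG, symL0w, symNegL0, h1, h2, neg_mul, sub_neg_eq_add, ← one_div]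
  rfl

theorem symNegL0_eq {n : ℕ} (k : Fin n → Z2) (j : Fin n) :
    symNegL0 n k = 1 / 2 * (sqNorm (k j) + ∑ i ∈ Finset.univ.erase j, sqNorm (k i)) := by
  rw [Finset.add_sum_erase _ (fun i => sqNorm (k i)) (Finset.mem_univ j), symNegL0]

theorem cutoff_nonneg (ε : ℝ) (l m : Z2) : 0 ≤ cutoff ε l m := by
  unfold cutoff; split_ifs <;> simp

theorem symNegL0_nonneg (n : ℕ) (k : Fin n → Z2) : 0 ≤ symNegL0 n k :=
  mul_nonneg (by norm_num) (Finset.sum_nonneg fun _ _ => sqNorm_nonneg _)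

theorem symL0w_nonpos (w : EuclideanSpace ℝ (Fin 2)) (n : ℕ) (k : Fin n → Z2) :
    symL0w w n k ≤ 0 :=
  neg_nonpos.2 (mul_nonneg (by norm_num) (Finset.sum_nonneg fun _ _ => sq_nonneg _))

theorem symG_nonneg (ε : ℝ) (w : EuclideanSpace ℝ (Fin 2)) (n : ℕ) (k : Fin n → Z2) :
    0 ≤ symG ε w n k := gSym_nonneg ε w (symNegL0_nonneg n k)

theorem symNegL0_le_resolvent (ε : ℝ) (w : EuclideanSpace ℝ (Fin 2)) (n : ℕ) (k : Fin n → Z2) :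
    symNegL0 n k ≤ symNegL0 n k - symL0w w n k * symG ε w n k := by
  have := mul_nonneg (neg_nonneg.2 (symL0w_nonpos w n k)) (symG_nonneg ε w n k)
  linarith

theorem symRes_nonneg (ε : ℝ) (w : EuclideanSpace ℝ (Fin 2)) (n : ℕ) (k : Fin n → Z2) :
    0 ≤ symRes ε w n k :=
  inv_nonneg.2 ((symNegL0_nonneg n k).trans (symNegL0_le_resolvent ε w n k))

theorem summable_cutoff_mul {ε : ℝ} (h0 : 0 < ε) (p : Z2) (F : Z2 → ℝ) :
    Summable fun l => cutoff ε l (p - l) * F l := by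
  obtain ⟨B, hB⟩ := cutoff_finite h0
  refine summable_of_ne_finset_zero (s := B) fun l hl => ?_
  have : cutoff ε l (p - l) = 0 := by
    by_contra h
    exact hl (hB _ _ h).1
  rw [this, zero_mul]

theorem tsum_ofReal_cutoff_mul {ε : ℝ} (h0 : 0 < ε) (p : Z2) {F : Z2 → ℝ} (hF : ∀ l, 0 ≤ F l) :
    ∑' l, ENNReal.ofReal (cutoff ε l (p - l) * F l) =
      ENNReal.ofReal (∑' l, cutoff ε l (p - l) * F l) :=
  (ENNReal.ofReal_tsum_of_nonneg (fun l => mul_nonneg (cutoff_nonneg _ _ _) (hF l))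
    (summable_cutoff_mul h0 p F)).symm

/-- The cellwise comparison is integrated over the plane, in both directions. The two weights, at
scales `√A` and `1/ε`, contribute `60π²` each. -/
theorem diagonal_of_le_half {ε : ℝ} {w : EuclideanSpace ℝ (Fin 2)} (hw : w ≠ 0) (h0 : 0 < ε)
    (h1 : ε ≤ 1 / 2) {n : ℕ} {k : Fin n → Z2} {j : Fin n} (hk : k j ≠ 0)
    (hkε : ε ^ 2 * sqNorm (k j) ≤ 1) :
    |(∑' l, cutoff ε l (k j - l) * symRes ε w (n + 1) (split k j l)) -
      Real.pi ^ 2 / lam ε ^ 2 * symG ε w n k| ≤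
      100000 * (1 + ‖w‖ ^ 2) * (120 * Real.pi ^ 2) := by
  have hA := symNegL0_eq k j
  have hK : 0 ≤ ∑ i ∈ Finset.univ.erase j, sqNorm (k i) :=
    Finset.sum_nonneg fun _ _ => sqNorm_nonneg _
  have hA1 : 1 / 2 ≤ symNegL0 n k := by
    have := one_le_sqNorm hk
    rw [hA]; linarith
  have hWK : ∑ i ∈ Finset.univ.erase j, dot w (k i) ^ 2 ≤
      ‖w‖ ^ 2 * ∑ i ∈ Finset.univ.erase j, sqNorm (k i) := by
    rw [Finset.mul_sum]
    exact Finset.sum_le_sum fun i _ => dot_sq_le w (k i)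
  set A := symNegL0 n k with hAdef
  have hpt := fun z : ℝ × ℝ => abs_summand_sub_density_le hw h0 h1 hk hkε hK
    (Finset.sum_nonneg fun i _ => sq_nonneg (dot w (k i))) hWK hA z (floorPt z) rfl
  simp only [← symRes_split] at hpt
  set a : Z2 → ℝ := fun l => cutoff ε l (k j - l) * symRes ε w (n + 1) (split k j l) with ha
  set E : Z2 → ℝ := fun l => 100000 * (1 + ‖w‖ ^ 2) * (weight √A l + weight (1 / ε) l) with hE
  have hE0 : ∀ l, 0 ≤ E l := fun l => by
    have := weight_nonneg (Real.sqrt_nonneg A) l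
    have := weight_nonneg (one_div_nonneg.2 h0.le) l
    positivity
  have ha0 : ∀ l, 0 ≤ a l := fun l => mul_nonneg (cutoff_nonneg _ _ _) (symRes_nonneg _ _ _ _)
  have hd0 : ∀ z, 0 ≤ density ε w A z := fun z => by
    have := gSym_nonneg ε w (y := z.1 ^ 2 + z.2 ^ 2 + A) (by positivity)
    unfold density
    positivity
  have hEsum : ∑' l, ENNReal.ofReal (E l) ≤
      ENNReal.ofReal (100000 * (1 + ‖w‖ ^ 2) * (120 * Real.pi ^ 2)) := by
    have hA2 : 1 / 2 ≤ √A := Real.le_sqrt_of_sq_le (by linarith)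
    have hε2 : 1 / 2 ≤ 1 / ε := by
      rw [div_le_div_iff₀ two_pos h0]; linarith
    have e : ∀ l, ENNReal.ofReal (E l) = ENNReal.ofReal (100000 * (1 + ‖w‖ ^ 2)) *
        (ENNReal.ofReal (weight √A l) + ENNReal.ofReal (weight (1 / ε) l)) := fun l => by
      rw [← ENNReal.ofReal_add (weight_nonneg (Real.sqrt_nonneg A) l)
        (weight_nonneg (one_div_nonneg.2 h0.le) l), ← ENNReal.ofReal_mul (by positivity)]
    simp only [e]
    rw [ENNReal.tsum_mul_left, ENNReal.tsum_add, ENNReal.ofReal_mul (q := 120 * Real.pi ^ 2) (by positivity)]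
    refine mul_le_mul_right ?_ _
    refine (add_le_add (tsum_weight_le hA2) (tsum_weight_le hε2)).trans_eq ?_
    rw [← ENNReal.ofReal_add (by positivity) (by positivity)]
    congr 1; ring
  have hS : ∑' l, ENNReal.ofReal (a l) = ENNReal.ofReal (∑' l, a l) :=
    tsum_ofReal_cutoff_mul h0 _ fun l => symRes_nonneg _ _ _ _
  have hI := lintegral_density h0 (by linarith) hw (lt_of_lt_of_le one_half_pos hA1)
  have hI0 : 0 ≤ Real.pi ^ 2 / lam ε ^ 2 * gSym ε w A :=
    mul_nonneg (by positivity) (gSym_nonneg ε w (by linarith))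
  have hS0 : 0 ≤ ∑' l, a l := tsum_nonneg ha0
  have hmeas : Measurable fun z => ENNReal.ofReal (density ε w A z) :=
    (measurable_density ε w A).ennreal_ofReal
  have hC : 0 ≤ 100000 * (1 + ‖w‖ ^ 2) * (120 * Real.pi ^ 2) := by positivity
  -- Working with `ℝ≥0∞`-valued integrals, the two one-sided bounds need no integrability of the
  -- differences.
  have up : ENNReal.ofReal (∑' l, a l) ≤ ENNReal.ofReal (Real.pi ^ 2 / lam ε ^ 2 * gSym ε w A +
      100000 * (1 + ‖w‖ ^ 2) * (120 * Real.pi ^ 2)) := by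
    rw [← hS, ENNReal.ofReal_add hI0 hC, ← hI]
    refine le_trans ?_ (add_le_add_right hEsum _)
    rw [← lintegral_comp_floorPt, ← lintegral_comp_floorPt, ← lintegral_add_left hmeas]
    refine lintegral_mono fun z => ?_
    rw [← ENNReal.ofReal_add (hd0 z) (hE0 _)]
    exact ENNReal.ofReal_le_ofReal (by linarith [(abs_le.1 (hpt z)).2])
  have lo : ENNReal.ofReal (Real.pi ^ 2 / lam ε ^ 2 * gSym ε w A) ≤ ENNReal.ofReal ((∑' l, a l) +
      100000 * (1 + ‖w‖ ^ 2) * (120 * Real.pi ^ 2)) := by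
    rw [← hI, ENNReal.ofReal_add hS0 hC, ← hS]
    refine le_trans ?_ (add_le_add_right hEsum _)
    rw [← ENNReal.tsum_add, ← lintegral_comp_floorPt]
    refine lintegral_mono fun z => ?_
    rw [← ENNReal.ofReal_add (ha0 _) (hE0 _)]
    exact ENNReal.ofReal_le_ofReal (by linarith [(abs_le.1 (hpt z)).1])
  rw [ENNReal.ofReal_le_ofReal_iff (by positivity)] at up lo
  change |(∑' l, a l) - Real.pi ^ 2 / lam ε ^ 2 * gSym ε w A| ≤ _
  rw [abs_le]
  constructor <;> linarith

/-- For `ε > 1/2` the cut-off leaves only `1 ≤ |l|² ≤ 4`. There the resolvent is at most `2`, and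
`24 * weight 1 l` is at least `2`, so the uniform bound on the weight counts these points. -/
theorem tsum_cutoff_mul_symRes_le {ε : ℝ} {w : EuclideanSpace ℝ (Fin 2)} (h0 : 0 < ε)
    (h : 1 / 2 < ε) {n : ℕ} (k : Fin n → Z2) (j : Fin n) :
    ∑' l, cutoff ε l (k j - l) * symRes ε w (n + 1) (split k j l) ≤ 24 * (60 * Real.pi ^ 2) := by
  classical
  rw [← ENNReal.ofReal_le_ofReal_iff (by positivity),
    ← tsum_ofReal_cutoff_mul h0 _ fun l => symRes_nonneg _ _ _ _, ENNReal.ofReal_mul (by norm_num)]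
  refine le_trans ?_ (mul_le_mul_right (tsum_weight_le (K := 1) (by norm_num)) _)
  rw [← ENNReal.tsum_mul_left]
  refine ENNReal.tsum_le_tsum fun l => ?_
  rw [← ENNReal.ofReal_mul (by norm_num)]
  refine ENNReal.ofReal_le_ofReal ?_
  have hw0 := weight_nonneg zero_le_one l
  rw [cutoff_eq h0]
  split_ifs with hJ
  · obtain ⟨⟨hl, hlε⟩, -⟩ := hJ
    have hL := one_le_sqNorm hl
    have hL4 : sqNorm l ≤ 4 := by
      have : 1 / 4 ≤ ε ^ 2 := by nlinarith
      nlinarith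
    have hs : √(sqNorm l + 1) ≤ 12 / 5 := by
      rw [Real.sqrt_le_left (by norm_num)]; norm_num; linarith
    have hs0 : 0 < √(sqNorm l + 1) := Real.sqrt_pos.2 (by positivity)
    have h1 : symRes ε w (n + 1) (split k j l) ≤ 2 := by
      have e : 1 / 2 ≤ symNegL0 (n + 1) (split k j l) := by
        rw [symNegL0, sum_split]
        have := sqNorm_nonneg (k j - l)
        have : 0 ≤ ∑ i ∈ Finset.univ.erase j, sqNorm (k i) :=
          Finset.sum_nonneg fun _ _ => sqNorm_nonneg _
        linarith
      rw [symRes, inv_le_comm₀ (by linarith [symNegL0_le_resolvent ε w (n + 1) (split k j l)])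
        two_pos]
      linarith [symNegL0_le_resolvent ε w (n + 1) (split k j l)]
    have h2 : 2 ≤ 24 * weight 1 l := by
      rw [weight, mul_one_div, le_div_iff₀ (by positivity)]
      calc 2 * (√(sqNorm l + 1) * (sqNorm l + 1 ^ 2)) ≤ 2 * (12 / 5 * (4 + 1 ^ 2)) := by gcongr
        _ = 24 := by norm_num
    linarith
  · linarith

/-- The diagonal part of `-𝒜^ε_- (-ℒ₀ - ℒ₀^𝔴 𝒢^ε)⁻¹ 𝒜^ε_+` is `-ℒ₀^𝔴 𝒢^ε`, up to an error of
order `λ_ε²`. -/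
theorem diagonal_estimate {w : EuclideanSpace ℝ (Fin 2)} (hw : w ≠ 0) :
    ∃ C : ℝ, 0 < C ∧ ∀ ε : ℝ, 0 < ε → ε < 1 → ∀ (n : ℕ) (k : Fin n → Z2) (j : Fin n), k j ≠ 0 →
      |lam ε ^ 2 / (2 * Real.pi ^ 2) *
        (∑' l, cutoff ε l (k j - l) * symRes ε w (n + 1) (split k j l)) -
        1 / 2 * symG ε w n k| ≤ C * lam ε ^ 2 := by
  refine ⟨100000 * (1 + ‖w‖ ^ 2) * 120 + 8 + 24 * 60, by positivity, fun ε h0 h1 n k j hk => ?_⟩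
  have hl := lam_sq_pos h0 h1
  have hpi := Real.pi_pos
  -- Outside this regime nothing has to cancel: the lattice sum is empty or bounded, and the symbol
  -- of `𝒢^ε` is at most `8λ_ε²`.
  by_cases hc : ε ≤ 1 / 2 ∧ ε ^ 2 * sqNorm (k j) ≤ 1
  · have h := diagonal_of_le_half hw h0 hc.1 hk hc.2
    set S := ∑' l, cutoff ε l (k j - l) * symRes ε w (n + 1) (split k j l)
    have e : lam ε ^ 2 / (2 * Real.pi ^ 2) * S - 1 / 2 * symG ε w n k =
        lam ε ^ 2 / (2 * Real.pi ^ 2) * (S - Real.pi ^ 2 / lam ε ^ 2 * symG ε w n k) := by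
      have hl' : lam ε ≠ 0 := fun h => by simp [h] at hl
      field_simp
    rw [e, abs_mul, abs_of_nonneg (by positivity)]
    calc _ ≤ lam ε ^ 2 / (2 * Real.pi ^ 2) *
          (100000 * (1 + ‖w‖ ^ 2) * (120 * Real.pi ^ 2)) := by gcongr
      _ = (100000 * (1 + ‖w‖ ^ 2) * 60) * lam ε ^ 2 := by field_simp; ring
      _ ≤ _ := by
        gcongr
        nlinarith [sq_nonneg ‖w‖]
  · have hA := symNegL0_eq k j
    have hK : 0 ≤ ∑ i ∈ Finset.univ.erase j, sqNorm (k i) :=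
      Finset.sum_nonneg fun _ _ => sqNorm_nonneg _
    have hp1 := one_le_sqNorm hk
    have hA0 : 0 < symNegL0 n k := by rw [hA]; linarith
    -- Either `ε²|k_j|² > 1`, and then `ε²A ≥ 1/2`, or `ε > 1/2`, and then `A ≥ 1/2` gives `1/4 ·
    -- 1/2`.
    have hεA : 1 / 8 ≤ ε ^ 2 * symNegL0 n k := by
      by_cases h2 : ε ≤ 1 / 2
      · have h3 : 1 < ε ^ 2 * sqNorm (k j) := by
          by_contra h3
          exact hc ⟨h2, not_lt.1 h3⟩
        rw [hA]
        nlinarith [mul_nonneg (sq_nonneg ε) hK]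
      · have h3 : 1 / 4 ≤ ε ^ 2 := by nlinarith
        have h4 : 1 / 2 ≤ symNegL0 n k := by rw [hA]; linarith
        nlinarith
    have hg : symG ε w n k ≤ 8 * lam ε ^ 2 := by
      refine (gSym_le_inv hw h0 hA0).trans ?_
      rw [mul_comm]
      gcongr
      rw [div_le_iff₀ (by linarith)]
      linarith
    have hS : ∑' l, cutoff ε l (k j - l) * symRes ε w (n + 1) (split k j l) ≤
        24 * (60 * Real.pi ^ 2) := by
      by_cases h2 : ε ≤ 1 / 2
      · have h3 : ¬ ε ^ 2 * sqNorm (k j) ≤ 1 := fun h3 => hc ⟨h2, h3⟩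
        have : ∀ l, cutoff ε l (k j - l) = 0 := fun l => by
          classical
          rw [cutoff_eq h0, if_neg]
          rintro ⟨-, -, -, h4⟩
          rw [add_sub_cancel] at h4
          exact h3 h4
        simp only [this, zero_mul, tsum_zero]
        positivity
      · exact tsum_cutoff_mul_symRes_le h0 (not_le.1 h2) k j
    have hS0 : 0 ≤ ∑' l, cutoff ε l (k j - l) * symRes ε w (n + 1) (split k j l) :=
      tsum_nonneg fun l => mul_nonneg (cutoff_nonneg _ _ _) (symRes_nonneg _ _ _ _)
    have hg0 := symG_nonneg ε w n k
    set S := ∑' l, cutoff ε l (k j - l) * symRes ε w (n + 1) (split k j l)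
    have hS1 : lam ε ^ 2 / (2 * Real.pi ^ 2) * S ≤ 720 * lam ε ^ 2 := by
      calc _ ≤ lam ε ^ 2 / (2 * Real.pi ^ 2) * (24 * (60 * Real.pi ^ 2)) := by gcongr
        _ = _ := by field_simp; ring
    have hS2 : 0 ≤ lam ε ^ 2 / (2 * Real.pi ^ 2) * S := by positivity
    have : 0 ≤ 100000 * (1 + ‖w‖ ^ 2) * 120 * lam ε ^ 2 := by positivity
    rw [abs_le]
    constructor <;> nlinarith

/-! ### The operators preserve the spaces of kernels -/

theorem sqSummable_add {ι : Type*} {f g : ι → ℂ} (hf : Summable fun k => ‖f k‖ ^ 2)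
    (hg : Summable fun k => ‖g k‖ ^ 2) : Summable fun k => ‖f k + g k‖ ^ 2 := by
  refine Summable.of_nonneg_of_le (fun _ => sq_nonneg _) (fun k => ?_)
    ((hf.mul_left 2).add (hg.mul_left 2))
  have h := norm_add_le (f k) (g k)
  nlinarith [sq_nonneg (‖f k‖ - ‖g k‖), norm_nonneg (f k + g k), norm_nonneg (f k),
    norm_nonneg (g k)]

theorem sqSummable_sum {ι κ : Type*} {f : κ → ι → ℂ} (s : Finset κ)
    (hf : ∀ i ∈ s, Summable fun k => ‖f i k‖ ^ 2) : Summable fun k => ‖∑ i ∈ s, f i k‖ ^ 2 := by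
  classical
  induction s using Finset.induction_on with
  | empty => simp
  | insert a s ha ih =>
    simp only [Finset.sum_insert ha]
    exact sqSummable_add (hf a (Finset.mem_insert_self a s))
      (ih fun i hi => hf i (Finset.mem_insert_of_mem hi))

theorem sqSummable_of_le {ι : Type*} {f g : ι → ℂ} {M : ℝ} (hf : Summable fun k => ‖f k‖ ^ 2)
    (h : ∀ k, ‖g k‖ ≤ M * ‖f k‖) : Summable fun k => ‖g k‖ ^ 2 := by
  refine Summable.of_nonneg_of_le (fun _ => sq_nonneg _) (fun k => ?_) (hf.mul_left (M ^ 2))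
  rw [← mul_pow]
  exact pow_le_pow_left₀ (norm_nonneg _) (h k) 2

/-- Deleting index `j` before relabelling, or `σ j` after it, leaves momenta that differ by the
permutation `τ` induced by `σ`; the symmetry of `f` absorbs it. -/
theorem merge_comp_perm {n : ℕ} {f : (Fin n → Z2) → ℂ} (hf : IsKernel n f) (k : Fin (n + 1) → Z2)
    (σ : Equiv.Perm (Fin (n + 1))) (i j : Fin (n + 1)) :
    f (merge (k ∘ σ) i j) = f (merge k (σ i) (σ j)) := by
  let e : {x : Fin (n + 1) // x ≠ j} ≃ {x : Fin (n + 1) // x ≠ σ j} :=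
    σ.subtypeEquiv fun a => by rw [Ne, Ne, not_iff_not, σ.apply_eq_iff_eq]
  let τ : Equiv.Perm (Fin n) :=
    ((finSuccAboveEquiv j).trans e).trans (finSuccAboveEquiv (σ j)).symm
  have hτ : ∀ a, (σ j).succAbove (τ a) = σ (j.succAbove a) := by
    intro a
    have := (finSuccAboveEquiv (σ j)).apply_symm_apply (e (finSuccAboveEquiv j a))
    exact congrArg Subtype.val this
  rw [← hf.symm τ (merge k (σ i) (σ j))]
  congr 1
  funext a
  simp only [merge, Function.comp, Fin.removeNth, hτ]
  by_cases h : j.succAbove a = i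
  · rw [h, Function.update_self, Function.update_self]
  · rw [Function.update_of_ne h, Function.update_of_ne (fun h' => h (σ.injective h'))]
    rfl

theorem split_comp_perm {n : ℕ} {g : (Fin (n + 1) → Z2) → ℂ} (hg : IsKernel (n + 1) g)
    (k : Fin n → Z2) (σ : Equiv.Perm (Fin n)) (j : Fin n) (l : Z2) :
    g (split (k ∘ σ) j l) = g (split k (σ j) l) := by
  rw [← hg.symm (Equiv.Perm.decomposeFin.symm (0, σ)) (split k (σ j) l)]
  congr 1
  funext a
  refine Fin.cases ?_ (fun a => ?_) a
  · simp only [split, Function.comp, Equiv.Perm.decomposeFin_symm_apply_zero, Fin.cons_zero]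
  · simp only [split, Function.comp, Fin.cons_succ, Equiv.Perm.decomposeFin_symm_apply_succ,
      Equiv.swap_self, Equiv.refl_apply]
    by_cases h : a = j
    · rw [h, Function.update_self, Function.update_self]
    · rw [Function.update_of_ne h, Function.update_of_ne (fun h' => h (σ.injective h'))]
      rfl

/-- Twice the sum over `i < j` is the sum over ordered pairs with `i ≠ j`, which any relabelling
preserves. The diagonal is subtracted from a full double sum. -/
theorem sum_lt_comp_perm {n : ℕ} (σ : Equiv.Perm (Fin (n + 1)))
    (X Y : Fin (n + 1) → Fin (n + 1) → ℂ) (hX : ∀ i j, i ≠ j → X i j = X j i)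
    (hY : ∀ i j, Y i j = X (σ i) (σ j)) :
    ∑ i, ∑ j ∈ Finset.Ioi i, Y i j = ∑ i, ∑ j ∈ Finset.Ioi i, X i j := by
  have aux : ∀ Z : Fin (n + 1) → Fin (n + 1) → ℂ, (∀ i j, i ≠ j → Z i j = Z j i) →
      2 * ∑ i, ∑ j ∈ Finset.Ioi i, Z i j = ∑ j, ((∑ i, Z i j) - Z j j) := by
    intro Z hZ
    rw [sum_lt_eq Z hZ]
    refine Finset.sum_congr rfl fun j _ => ?_
    rw [Fin.sum_univ_succAbove _ j]
    ring
  have h2 : (2 : ℂ) ≠ 0 := two_ne_zero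
  refine mul_left_cancel₀ h2 ?_
  rw [aux X hX, aux Y fun i j h => by
    rw [hY, hY]; exact hX _ _ fun h' => h (σ.injective h')]
  rw [← Equiv.sum_comp σ fun j => (∑ i, X i j) - X j j]
  refine Finset.sum_congr rfl fun j _ => ?_
  rw [← Equiv.sum_comp σ fun i => X i (σ j)]
  simp only [hY]

theorem cutoff_zero_left (ε : ℝ) (m : Z2) : cutoff ε 0 m = 0 := by
  unfold cutoff
  simp [sqNorm_eq]

theorem cutoff_zero_right (ε : ℝ) (m : Z2) : cutoff ε m 0 = 0 := by
  rw [cutoff_comm, cutoff_zero_left]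

theorem merge_mem {n : ℕ} (k : Fin (n + 1) → Z2) {i j m : Fin (n + 1)} (hi : m ≠ i) (hj : m ≠ j) :
    ∃ a, merge k i j a = k m := by
  obtain ⟨a, ha⟩ := Fin.exists_succAbove_eq hj
  refine ⟨a, ?_⟩
  simp only [merge, Fin.removeNth, ha]
  rw [Function.update_of_ne hi]

/-- The cut-off makes the multiplication by `𝔴 · (l + m)` bounded. -/
theorem cutoff_mul_dot_bound {ε : ℝ} (h0 : 0 < ε) (w : EuclideanSpace ℝ (Fin 2)) :
    ∃ D : ℝ, 0 ≤ D ∧ ∀ l m, |dot w (l + m)| * cutoff ε l m ≤ D := by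
  obtain ⟨B, hB⟩ := cutoff_finite h0
  refine ⟨∑ p ∈ B, |dot w p|, Finset.sum_nonneg fun _ _ => abs_nonneg _, fun l m => ?_⟩
  by_cases h : cutoff ε l m = 0
  · rw [h, mul_zero]
    exact Finset.sum_nonneg fun _ _ => abs_nonneg _
  · refine le_trans (mul_le_of_le_one_right (abs_nonneg _) ((le_abs_self _).trans
      (cutoff_le_one ε l m))) ?_
    exact Finset.single_le_sum (f := fun p => |dot w p|) (fun _ _ => abs_nonneg _) (hB l m h).2

/-- For fixed `ε` the cut-off bounds `𝔴·(k_i + k_j)` and confines the new momentum to a finite set.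
The resulting bound depends on `ε` and serves only for membership. -/
theorem isKernel_Aplus {ε : ℝ} (h0 : 0 < ε) (w : EuclideanSpace ℝ (Fin 2)) {n : ℕ} {ψ : Family}
    (hψ : IsKernel n (ψ n)) : IsKernel (n + 1) (Aplus ε w ψ (n + 1)) where
  symm σ k := by
    simp only [Aplus]
    congr 1
    refine sum_lt_comp_perm σ (fun i j => (dot w (k i + k j) : ℂ) * (cutoff ε (k i) (k j) : ℂ) *
      ψ n (merge k i j)) _ (fun i j _ => ?_) (fun i j => ?_)
    · rw [add_comm, cutoff_comm, merge_comm hψ k j i]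
    · rw [merge_comp_perm hψ]
      rfl
  zero_mean k := by
    rintro ⟨m, hm⟩
    simp only [Aplus]
    rw [Finset.sum_eq_zero, mul_zero]
    refine fun i _ => Finset.sum_eq_zero fun j _ => ?_
    by_cases hi : m = i
    · rw [← hi, hm, cutoff_zero_left]; simp
    by_cases hj : m = j
    · rw [← hj, hm, cutoff_zero_right]; simp
    obtain ⟨a, ha⟩ := merge_mem k hi hj
    rw [hψ.zero_mean _ ⟨a, ha.trans hm⟩, mul_zero]
  sq_summable := by
    obtain ⟨D, hD0, hD⟩ := cutoff_mul_dot_bound h0 w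
    obtain ⟨B, hB⟩ := cutoff_finite h0
    simp only [Aplus]
    refine sqSummable_of_le (M := ‖-(2 * Complex.I / (2 * Real.pi)) * ((lam ε : ℂ) / (n + 1))‖)
      (sqSummable_sum _ fun i _ => sqSummable_sum _ fun j hj => ?_) fun k => (norm_mul _ _).le
    classical
    obtain ⟨a, rfl⟩ := Fin.exists_succAbove_eq (Finset.mem_Ioi.1 hj).ne
    -- In the coordinates (split momentum, merged configuration) the summand is bounded by the
    -- indicator of a finite set times `‖ψ n‖²`.
    rw [← (splitEquiv j a).summable_iff]
    have s1 : Summable fun p : Z2 × (Fin n → Z2) =>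
        (if p.1 ∈ B then (1 : ℝ) else 0) * ‖ψ n p.2‖ ^ 2 :=
      Summable.mul_of_nonneg (f := fun l : Z2 => if l ∈ B then (1 : ℝ) else 0)
        (summable_of_ne_finset_zero (s := B) fun b hb => by simp [hb]) hψ.sq_summable
        (fun l => by dsimp; split_ifs <;> simp) (fun _ => sq_nonneg _)
    refine Summable.of_nonneg_of_le (fun _ => sq_nonneg _) (fun p => ?_) (s1.mul_left (D ^ 2))
    obtain ⟨l, q⟩ := p
    have e1 : (splitEquiv j a (l, q)) j = l := by simp [splitEquiv]
    have e3 : merge (splitEquiv j a (l, q)) (j.succAbove a) j = q :=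
      congrArg Prod.snd ((splitEquiv j a).left_inv (l, q))
    simp only [Function.comp, e1, e3]
    set m := splitEquiv j a (l, q) (j.succAbove a)
    by_cases h : cutoff ε m l = 0
    · rw [h]
      simp only [Complex.ofReal_zero, mul_zero, zero_mul, norm_zero, ne_eq, OfNat.ofNat_ne_zero,
        not_false_eq_true, zero_pow]
      have : 0 ≤ (if l ∈ B then (1 : ℝ) else 0) := by split_ifs <;> simp
      positivity
    · have hl : l ∈ B := by
        rw [cutoff_comm] at h
        exact (hB _ _ h).1
      rw [if_pos hl, one_mul, ← mul_pow]
      refine pow_le_pow_left₀ (norm_nonneg _) ?_ 2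
      rw [norm_mul, norm_mul, Complex.norm_real, Complex.norm_real, Real.norm_eq_abs,
        Real.norm_of_nonneg (cutoff_nonneg _ _ _)]
      exact mul_le_mul_of_nonneg_right (hD m l) (norm_nonneg _)

theorem isKernel_Aminus {ε : ℝ} (h0 : 0 < ε) (w : EuclideanSpace ℝ (Fin 2)) {n : ℕ} {ψ : Family}
    (hψ : IsKernel (n + 1) (ψ (n + 1))) : IsKernel n (Aminus ε w ψ n) where
  symm σ k := by
    simp only [Aminus]
    congr 1
    rw [← Equiv.sum_comp σ fun j => (dot w (k j) : ℂ) *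
        ∑' l : Z2, (cutoff ε l (k j - l) : ℂ) * ψ (n + 1) (split k j l)]
    refine Finset.sum_congr rfl fun j _ => ?_
    simp only [split_comp_perm hψ, Function.comp]
  zero_mean k := by
    rintro ⟨m, hm⟩
    simp only [Aminus]
    rw [Finset.sum_eq_zero, mul_zero]
    intro j _
    by_cases h : m = j
    · rw [← h, hm]
      simp [dot]
    · have : ∀ l, ψ (n + 1) (split k j l) = 0 := fun l =>
        hψ.zero_mean _ ⟨m.succ, by rw [split, Fin.cons_succ, Function.update_of_ne h, hm]⟩
      simp [this]
  sq_summable := by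
    obtain ⟨D, hD0, hD⟩ := cutoff_mul_dot_bound h0 w
    obtain ⟨B, hB⟩ := cutoff_finite h0
    have e : ∀ (k : Fin n → Z2) (j : Fin n), ∑' l : Z2, (cutoff ε l (k j - l) : ℂ) *
        ψ (n + 1) (split k j l) = ∑ l ∈ B, (cutoff ε l (k j - l) : ℂ) * ψ (n + 1) (split k j l) := by
      intro k j
      refine tsum_eq_sum fun l hl => ?_
      have : cutoff ε l (k j - l) = 0 := by
        by_contra h
        exact hl (hB _ _ h).1
      simp [this]
    simp only [Aminus, e, Finset.mul_sum (s := B)]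
    refine sqSummable_of_le
      (M := ‖-(Complex.I / (2 * Real.pi)) * ((n : ℂ) + 1) * (lam ε : ℂ)‖)
      (sqSummable_sum _ fun j _ => sqSummable_sum _ fun l _ => ?_) fun k => (norm_mul _ _).le
    -- For a fixed split momentum `l`, merging undoes the splitting, so the sum over `k` runs
    -- through a subfamily of the square summable family `ψ (n + 1)`.
    have hinj : Function.Injective fun k : Fin n → Z2 => split k j l := by
      intro k k' h
      have h' := congrArg (fun κ => merge κ j.succ 0) h
      have aux : ∀ k : Fin n → Z2, merge (split k j l) j.succ 0 = k := by
        intro k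
        funext i
        simp only [merge, split, Fin.removeNth, Fin.succAbove_zero, Fin.cons_zero, Fin.cons_succ,
          Function.update_self, sub_add_cancel]
        by_cases hi : i = j
        · rw [hi, Function.update_self]
        · rw [Function.update_of_ne (by simpa using hi), Fin.cons_succ, Function.update_of_ne hi]
      simpa only [aux] using h'
    refine sqSummable_of_le (M := D) (f := fun k => ψ (n + 1) (split k j l))
      (hψ.sq_summable.comp_injective hinj) fun k => ?_
    have := hD l (k j - l)
    rw [add_sub_cancel] at this
    rw [← mul_assoc, norm_mul, norm_mul, Complex.norm_real, Complex.norm_real, Real.norm_eq_abs,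
      Real.norm_of_nonneg (cutoff_nonneg _ _ _)]
    exact mul_le_mul_of_nonneg_right this (norm_nonneg _)

/-- The symbol need be bounded only at nonzero momenta, since kernels vanish elsewhere. -/
theorem isKernel_multiplier {n : ℕ} {f : (Fin n → Z2) → ℂ} (hf : IsKernel n f)
    {m : (Fin n → Z2) → ℝ} (hm : ∀ (σ : Equiv.Perm (Fin n)) k, m (k ∘ σ) = m k) {M : ℝ}
    (hM : ∀ k, (∀ i, k i ≠ 0) → |m k| ≤ M) : IsKernel n fun k => (m k : ℂ) * f k where
  symm σ k := by rw [hm, hf.symm]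
  zero_mean k hk := by rw [hf.zero_mean k hk, mul_zero]
  sq_summable := by
    refine sqSummable_of_le (M := M) hf.sq_summable fun k => ?_
    by_cases hk : ∃ i, k i = 0
    · rw [hf.zero_mean k hk]; simp
    · rw [norm_mul, Complex.norm_real, Real.norm_eq_abs]
      exact mul_le_mul_of_nonneg_right (hM k (not_exists.1 hk)) (norm_nonneg _)

theorem isKernel_add {n : ℕ} {f g : (Fin n → Z2) → ℂ} (hf : IsKernel n f) (hg : IsKernel n g) :
    IsKernel n (f + g) where
  symm σ k := by simp only [Pi.add_apply, hf.symm, hg.symm]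
  zero_mean k hk := by simp only [Pi.add_apply, hf.zero_mean k hk, hg.zero_mean k hk, add_zero]
  sq_summable := sqSummable_add hf.sq_summable hg.sq_summable

theorem isKernel_neg {n : ℕ} {f : (Fin n → Z2) → ℂ} (hf : IsKernel n f) : IsKernel n (-f) where
  symm σ k := by simp only [Pi.neg_apply, hf.symm]
  zero_mean k hk := by simp only [Pi.neg_apply, hf.zero_mean k hk, neg_zero]
  sq_summable := by simpa only [Pi.neg_apply, norm_neg] using hf.sq_summable

theorem sum_comp_perm {n : ℕ} (F : Z2 → ℝ) (σ : Equiv.Perm (Fin n)) (k : Fin n → Z2) :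
    ∑ i, F ((k ∘ σ) i) = ∑ i, F (k i) :=
  Equiv.sum_comp σ fun i => F (k i)

theorem symNegL0_comp_perm {n : ℕ} (σ : Equiv.Perm (Fin n)) (k : Fin n → Z2) :
    symNegL0 n (k ∘ σ) = symNegL0 n k := by
  rw [symNegL0, sum_comp_perm, symNegL0]

theorem symL0w_comp_perm (w : EuclideanSpace ℝ (Fin 2)) {n : ℕ} (σ : Equiv.Perm (Fin n))
    (k : Fin n → Z2) : symL0w w n (k ∘ σ) = symL0w w n k := by
  rw [symL0w, sum_comp_perm (fun p => dot w p ^ 2), symL0w]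

theorem symG_comp_perm (ε : ℝ) (w : EuclideanSpace ℝ (Fin 2)) {n : ℕ} (σ : Equiv.Perm (Fin n))
    (k : Fin n → Z2) : symG ε w n (k ∘ σ) = symG ε w n k := by
  rw [symG, symNegL0_comp_perm, symG]

theorem symNegL0_pos {n : ℕ} (hn : n ≠ 0) {k : Fin n → Z2} (hk : ∀ i, k i ≠ 0) :
    1 / 2 ≤ symNegL0 n k := by
  have h := Finset.single_le_sum (f := fun i => sqNorm (k i)) (fun i _ => sqNorm_nonneg _)
    (Finset.mem_univ (⟨0, Nat.pos_of_ne_zero hn⟩ : Fin n))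
  have := one_le_sqNorm (hk ⟨0, Nat.pos_of_ne_zero hn⟩)
  rw [symNegL0]
  linarith

theorem abs_symL0w_le (w : EuclideanSpace ℝ (Fin 2)) (n : ℕ) (k : Fin n → Z2) :
    |symL0w w n k| ≤ ‖w‖ ^ 2 * symNegL0 n k := by
  rw [symL0w, abs_neg, abs_of_nonneg (mul_nonneg (by norm_num)
    (Finset.sum_nonneg fun _ _ => sq_nonneg _)), symNegL0, mul_left_comm, Finset.mul_sum _ _ (‖w‖ ^ 2)]
  gcongr with i
  exact dot_sq_le w (k i)

theorem isKernel_resolvent {ε : ℝ} (w : EuclideanSpace ℝ (Fin 2)) {n : ℕ} {ψ : Family}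
    (hψ : IsKernel n (ψ n)) : IsKernel n (resolvent ε w ψ n) := by
  change IsKernel n fun k => (symRes ε w n k : ℂ) * ψ n k
  refine isKernel_multiplier (M := 2) hψ (fun σ k => ?_) fun k hk => ?_
  · rw [symRes, symRes, symNegL0_comp_perm, symL0w_comp_perm, symG_comp_perm]
  · rw [abs_of_nonneg (symRes_nonneg ε w n k)]
    have h := symNegL0_le_resolvent ε w n k
    -- On the zeroth chaos the inverted symbol is `0`, whose inverse is `0` by convention.
    rcases eq_or_ne n 0 with rfl | hn
    · simp [symRes, symNegL0, symL0w]
    · have := symNegL0_pos hn hk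
      rw [symRes, inv_le_comm₀ (by linarith) two_pos]
      linarith

/-- `ℒ₀^𝔴` alone is unbounded, but its symbol is at most `|𝔴|²y` and that of `𝒢^ε` at most
`λ_ε²/(ε²y)`. -/
theorem isKernel_L0w_Geps {ε : ℝ} (h0 : 0 < ε) {w : EuclideanSpace ℝ (Fin 2)} (hw : w ≠ 0) {n : ℕ}
    {ψ : Family} (hψ : IsKernel n (ψ n)) : IsKernel n (L0w w (Geps ε w ψ) n) := by
  have e : L0w w (Geps ε w ψ) n = fun k => ((symL0w w n k * symG ε w n k : ℝ) : ℂ) * ψ n k := by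
    funext k
    simp only [L0w, Geps, multiplier]
    push_cast
    ring
  rw [e]
  refine isKernel_multiplier (M := ‖w‖ ^ 2 * (lam ε ^ 2 * (1 / ε ^ 2))) hψ (fun σ k => ?_)
    fun k hk => ?_
  · rw [symL0w_comp_perm, symG_comp_perm]
  · rw [abs_mul, abs_of_nonneg (symG_nonneg ε w n k)]
    rcases eq_or_ne n 0 with rfl | hn
    · simp only [symL0w, Finset.univ_eq_empty, Finset.sum_empty, mul_zero, neg_zero, abs_zero,
        zero_mul]
      positivity
    · have hp : 0 < symNegL0 n k := by linarith [symNegL0_pos hn hk]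
      calc |symL0w w n k| * symG ε w n k
          ≤ (‖w‖ ^ 2 * symNegL0 n k) * (lam ε ^ 2 * (1 / (ε ^ 2 * symNegL0 n k))) :=
            mul_le_mul (abs_symL0w_le w n k) (gSym_le_inv hw h0 hp) (symG_nonneg ε w n k)
              (by positivity)
        _ = _ := by field_simp

theorem isKernel_replacementOp {ε : ℝ} (h0 : 0 < ε) {w : EuclideanSpace ℝ (Fin 2)} (hw : w ≠ 0)
    {n : ℕ} {ψ : Family} (hψ : IsKernel n (ψ n)) : IsKernel n (replacementOp ε w ψ n) :=
  isKernel_add (isKernel_neg (isKernel_Aminus h0 w (isKernel_resolvent w (isKernel_Aplus h0 w hψ))))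
    (isKernel_L0w_Geps h0 hw hψ)

/-! ### Two distinct pairings: the weighted Cauchy–Schwarz estimate -/

/-- `‖(-ℒ₀)^{1/2} f‖²_{L²}`. -/
def energy (n : ℕ) (f : (Fin n → Z2) → ℂ) : ℝ := ∑' k, symNegL0 n k * ‖f k‖ ^ 2

theorem energy_nonneg (n : ℕ) (f : (Fin n → Z2) → ℂ) : 0 ≤ energy n f :=
  tsum_nonneg fun k => mul_nonneg (symNegL0_nonneg n k) (sq_nonneg _)

/-- Cauchy–Schwarz for sums in `ℝ≥0∞`. -/
theorem tsum_ofReal_le_sqrt_mul_sqrt {ι : Type*} {a b c : ι → ℝ} (ha : ∀ i, 0 ≤ a i)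
    (hb : ∀ i, 0 ≤ b i) (hc : ∀ i, c i ^ 2 ≤ a i * b i) {α β : ℝ} (hα : 0 ≤ α) (hβ : 0 ≤ β)
    (hA : ∑' i, ENNReal.ofReal (a i) ≤ ENNReal.ofReal α)
    (hB : ∑' i, ENNReal.ofReal (b i) ≤ ENNReal.ofReal β) :
    ∑' i, ENNReal.ofReal (c i) ≤ ENNReal.ofReal (√α * √β) := by
  have fin : ∀ (u : ι → ℝ) (γ : ℝ), (∀ i, 0 ≤ u i) → 0 ≤ γ →
      ∑' i, ENNReal.ofReal (u i) ≤ ENNReal.ofReal γ → ∀ s : Finset ι, ∑ i ∈ s, u i ≤ γ := by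
    intro u γ hu hγ h s
    rw [← ENNReal.ofReal_le_ofReal_iff hγ, ENNReal.ofReal_sum_of_nonneg fun i _ => hu i]
    exact (ENNReal.sum_le_tsum s).trans h
  rw [ENNReal.tsum_eq_iSup_sum]
  refine iSup_le fun s => ?_
  calc ∑ i ∈ s, ENNReal.ofReal (c i) ≤ ∑ i ∈ s, ENNReal.ofReal (√(a i) * √(b i)) := by
        refine Finset.sum_le_sum fun i _ => ENNReal.ofReal_le_ofReal ?_
        rw [← Real.sqrt_mul (ha i)]
        exact Real.le_sqrt_of_sq_le (hc i)
    _ = ENNReal.ofReal (∑ i ∈ s, √(a i) * √(b i)) :=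
        (ENNReal.ofReal_sum_of_nonneg fun i _ => by positivity).symm
    _ ≤ _ := by
        refine ENNReal.ofReal_le_ofReal ((Real.sum_sqrt_mul_sqrt_le s ha hb).trans ?_)
        gcongr
        · exact fin a α ha hα hA s
        · exact fin b β hb hβ hB s

/-- By symmetry all coordinates carry the same share of the energy. The resulting `1/n` compensates
the sum over the split index `j` in `offDiagonal_bound`. -/
theorem tsum_sqNorm_coord {n : ℕ} {f : (Fin n → Z2) → ℂ} (hf : IsKernel n f)
    (hE : Summable fun k => symNegL0 n k * ‖f k‖ ^ 2) (a : Fin n) :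
    ∑' k, ENNReal.ofReal (sqNorm (k a) * ‖f k‖ ^ 2) = ENNReal.ofReal (2 / n * energy n f) := by
  have hs : ∀ i : Fin n, Summable fun k : Fin n → Z2 => sqNorm (k i) * ‖f k‖ ^ 2 := by
    intro i
    refine Summable.of_nonneg_of_le (fun k => mul_nonneg (sqNorm_nonneg _) (sq_nonneg _))
      (fun k => ?_) (hE.mul_left 2)
    have : sqNorm (k i) ≤ ∑ i, sqNorm (k i) :=
      Finset.single_le_sum (f := fun i => sqNorm (k i)) (fun i _ => sqNorm_nonneg _)
        (Finset.mem_univ i)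
    rw [symNegL0, ← mul_assoc, ← mul_assoc]
    gcongr
    linarith
  have heq : ∀ i : Fin n, ∑' k : Fin n → Z2, sqNorm (k i) * ‖f k‖ ^ 2 =
      ∑' k : Fin n → Z2, sqNorm (k a) * ‖f k‖ ^ 2 := by
    intro i
    rw [← ((Equiv.swap a i).arrowCongr (Equiv.refl Z2)).tsum_eq]
    refine tsum_congr fun k => ?_
    have e : (Equiv.swap a i).arrowCongr (Equiv.refl Z2) k = k ∘ (Equiv.swap a i) := by
      funext x; simp [Equiv.arrowCongr]
    rw [e, hf.symm]
    simp
  have hn : (n : ℝ) ≠ 0 := by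
    have := a.pos
    positivity
  have hsum : (n : ℝ) * ∑' k : Fin n → Z2, sqNorm (k a) * ‖f k‖ ^ 2 = 2 * energy n f := by
    rw [energy, ← tsum_mul_left (a := (2 : ℝ))]
    have : ∀ k : Fin n → Z2, 2 * (symNegL0 n k * ‖f k‖ ^ 2) =
        ∑ i, sqNorm (k i) * ‖f k‖ ^ 2 := fun k => by
      rw [symNegL0, ← Finset.sum_mul]; ring
    simp only [this]
    rw [Summable.tsum_finsetSum fun i _ => hs i]
    simp only [heq, Finset.sum_const, Finset.card_univ, Fintype.card_fin, nsmul_eq_mul]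
  rw [← ENNReal.ofReal_tsum_of_nonneg (fun k => mul_nonneg (sqNorm_nonneg _) (sq_nonneg _)) (hs a)]
  congr 1
  rw [div_mul_eq_mul_div, eq_div_iff hn, ← hsum, mul_comm]

open Classical in
/-- Indicator of the configurations of nonzero momenta. -/
def nonzero {n : ℕ} (k : Fin n → Z2) : ℝ := if ∀ i, k i ≠ 0 then 1 else 0

theorem nonzero_nonneg {n : ℕ} (k : Fin n → Z2) : 0 ≤ nonzero k := by
  unfold nonzero; split_ifs <;> simp

theorem inv_mul_div_le_weight {p l : Z2} (hp : p ≠ 0) (hl : l ≠ 0) :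
    2 / (sqNorm l + sqNorm p) * (√(sqNorm p) / √(sqNorm l)) ≤ 4 * weight √(sqNorm p) l := by
  have h1 := one_le_sqNorm hl
  have h2 := one_le_sqNorm hp
  have h3 : √(sqNorm l + 1) ≤ 2 * √(sqNorm l) := by
    rw [Real.sqrt_le_left (by positivity), mul_pow, Real.sq_sqrt (by linarith)]
    linarith
  have h4 : 0 < √(sqNorm l) := Real.sqrt_pos.2 (by linarith)
  have h5 : 0 < √(sqNorm l + 1) := Real.sqrt_pos.2 (by linarith)
  rw [weight, Real.sq_sqrt (by linarith), div_mul_div_comm, mul_div_assoc',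
    div_le_div_iff₀ (by positivity) (by positivity)]
  calc 2 * √(sqNorm p) * (√(sqNorm l + 1) * (sqNorm l + sqNorm p))
      ≤ 2 * √(sqNorm p) * ((2 * √(sqNorm l)) * (sqNorm l + sqNorm p)) := by gcongr
    _ = _ := by ring

/-- With the merged configuration `q` fixed, the only free variable is `l = κ_b`, and `κ_d`, being
untouched by the merging, stays fixed. The sum over `l` is at most four times the weight sum at
scale `|κ_d|`; what remains is the energy in the merged coordinate. -/
theorem weighted_pair_bound {n : ℕ} {f : (Fin n → Z2) → ℂ} (hf : IsKernel n f)
    (hE : Summable fun k => symNegL0 n k * ‖f k‖ ^ 2) {a b d : Fin (n + 1)} (hab : a ≠ b)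
    (hdb : d ≠ b) (hda : d ≠ a) :
    ∑' κ : Fin (n + 1) → Z2, ENNReal.ofReal (nonzero κ *
      (2 / (sqNorm (κ b) + sqNorm (κ d)) * (√(sqNorm (κ d)) / √(sqNorm (κ b)))) *
        (sqNorm (κ a + κ b) * ‖f (merge κ a b)‖ ^ 2)) ≤
      ENNReal.ofReal (480 * Real.pi ^ 2 / n * energy n f) := by
  obtain ⟨a', rfl⟩ := Fin.exists_succAbove_eq hab
  obtain ⟨d', rfl⟩ := Fin.exists_succAbove_eq hdb
  have hd' : d' ≠ a' := fun h => hda (by rw [h])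
  have e0 : 480 * Real.pi ^ 2 / n * energy n f =
      4 * (60 * Real.pi ^ 2) * (2 / n * energy n f) := by ring
  rw [e0, ENNReal.ofReal_mul (by positivity), ← tsum_sqNorm_coord hf hE a', ← ENNReal.tsum_mul_left,
    ← (splitEquiv b a').tsum_eq, ENNReal.tsum_prod', ENNReal.tsum_comm]
  refine ENNReal.tsum_le_tsum fun q => ?_
  have e1 : ∀ l, (splitEquiv b a' (l, q)) b = l := fun l => by simp [splitEquiv]
  have e2 : ∀ l, (splitEquiv b a' (l, q)) (b.succAbove a') = q a' - l := fun l => by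
    simp [splitEquiv]
  have e3 : ∀ l, merge (splitEquiv b a' (l, q)) (b.succAbove a') b = q := fun l =>
    congrArg Prod.snd ((splitEquiv b a').left_inv (l, q))
  have e4 : ∀ l, (splitEquiv b a' (l, q)) (b.succAbove d') = q d' := fun l => by
    simp [splitEquiv, hd']
  simp only [e1, e2, e3, e4, sub_add_cancel]
  by_cases hq : q d' = 0
  · have : ∀ l, nonzero (splitEquiv b a' (l, q)) = 0 := fun l => by
      rw [nonzero, if_neg]
      intro h
      exact h _ ((e4 l).trans hq)
    simp only [this, zero_mul, ENNReal.ofReal_zero, tsum_zero, zero_le]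
  · have hK : 1 / 2 ≤ √(sqNorm (q d')) := Real.le_sqrt_of_sq_le (by
      have := one_le_sqNorm hq
      linarith)
    have hS : 0 ≤ sqNorm (q a') * ‖f q‖ ^ 2 := mul_nonneg (sqNorm_nonneg _) (sq_nonneg _)
    calc _ ≤ ∑' l, ENNReal.ofReal 4 * ENNReal.ofReal (weight √(sqNorm (q d')) l) *
          ENNReal.ofReal (sqNorm (q a') * ‖f q‖ ^ 2) := by
          refine ENNReal.tsum_le_tsum fun l => ?_
          have hw0 := weight_nonneg (Real.sqrt_nonneg (sqNorm (q d'))) l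
          rw [← ENNReal.ofReal_mul (by norm_num), ← ENNReal.ofReal_mul (by positivity)]
          refine ENNReal.ofReal_le_ofReal (mul_le_mul_of_nonneg_right ?_ hS)
          rw [nonzero]
          split_ifs with h
          · rw [one_mul]
            exact inv_mul_div_le_weight hq (by have := h b; rwa [e1] at this)
          · rw [zero_mul]; positivity
      _ ≤ _ := by
          rw [ENNReal.tsum_mul_right, ENNReal.tsum_mul_left,
            ENNReal.ofReal_mul (q := 60 * Real.pi ^ 2) (by norm_num)]
          gcongr
          exact tsum_weight_le hK

theorem symRes_le {ε : ℝ} {w : EuclideanSpace ℝ (Fin 2)} {n : ℕ} {κ : Fin n → Z2} {b d : Fin n}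
    (hbd : b ≠ d) (hb : κ b ≠ 0) :
    symRes ε w n κ ≤ 2 / (sqNorm (κ b) + sqNorm (κ d)) := by
  have h1 := one_le_sqNorm hb
  have h2 := sqNorm_nonneg (κ d)
  have h3 : sqNorm (κ b) + sqNorm (κ d) ≤ ∑ i, sqNorm (κ i) := by
    rw [← Finset.sum_pair (f := fun i => sqNorm (κ i)) hbd]
    exact Finset.sum_le_sum_of_subset_of_nonneg (Finset.subset_univ _) fun i _ _ => sqNorm_nonneg _
  have h4 := symNegL0_le_resolvent ε w n κ
  have h5 : 1 / 2 * (sqNorm (κ b) + sqNorm (κ d)) ≤ symNegL0 n κ := by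
    rw [symNegL0]; linarith
  rw [symRes, inv_le_comm₀ (by linarith) (by positivity), inv_div]
  linarith

/-- Here `b` lies outside `{c, d}` and `d` outside `{a, b}`. The resolvent is bounded using these
two momenta alone, and the factor `1` is written as `|κ_d|/|κ_b|` times its inverse, so that each
factor of Cauchy–Schwarz has its own summable free momentum. -/
theorem pair_bound_aux (ε : ℝ) (w : EuclideanSpace ℝ (Fin 2)) {n : ℕ} {f g : (Fin n → Z2) → ℂ}
    (hf : IsKernel n f) (hg : IsKernel n g) (hfE : Summable fun k => symNegL0 n k * ‖f k‖ ^ 2)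
    (hgE : Summable fun k => symNegL0 n k * ‖g k‖ ^ 2) {a b c d : Fin (n + 1)} (hab : a ≠ b)
    (hcd : c ≠ d) (hbc : b ≠ c) (hbd : b ≠ d) (hda : d ≠ a) :
    ∑' κ : Fin (n + 1) → Z2, ENNReal.ofReal (nonzero κ * symRes ε w (n + 1) κ *
      (√(sqNorm (κ a + κ b)) * ‖f (merge κ a b)‖) * (√(sqNorm (κ c + κ d)) * ‖g (merge κ c d)‖)) ≤
      ENNReal.ofReal (480 * Real.pi ^ 2 / n * (√(energy n f) * √(energy n g))) := by
  have hEf := energy_nonneg n f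
  have hEg := energy_nonneg n g
  have hC : 0 ≤ 480 * Real.pi ^ 2 / n := by positivity
  have hA := weighted_pair_bound hf hfE hab hbd.symm hda
  have hB := weighted_pair_bound hg hgE hcd hbd hbc
  have e : 480 * Real.pi ^ 2 / n * (√(energy n f) * √(energy n g)) =
      √(480 * Real.pi ^ 2 / n * energy n f) * √(480 * Real.pi ^ 2 / n * energy n g) := by
    rw [Real.sqrt_mul hC, Real.sqrt_mul hC, mul_mul_mul_comm, Real.mul_self_sqrt hC]
  rw [e]
  have hpos : ∀ (κ : Fin (n + 1) → Z2) (x y u v : Fin (n + 1)) (h : (Fin n → Z2) → ℂ),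
      0 ≤ nonzero κ * (2 / (sqNorm (κ x) + sqNorm (κ y)) * (√(sqNorm (κ y)) / √(sqNorm (κ x)))) *
        (sqNorm (κ u + κ v) * ‖h (merge κ u v)‖ ^ 2) := by
    intro κ x y u v h
    have := nonzero_nonneg κ
    have := sqNorm_nonneg (κ x)
    have := sqNorm_nonneg (κ y)
    have := sqNorm_nonneg (κ u + κ v)
    positivity
  refine tsum_ofReal_le_sqrt_mul_sqrt (fun κ => hpos κ _ _ _ _ f) (fun κ => hpos κ _ _ _ _ g)
    (fun κ => ?_) (by positivity) (by positivity) hA hB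
  by_cases hκ : ∀ i, κ i ≠ 0
  · have hr := symRes_le (ε := ε) (w := w) hbd (hκ b)
    have hr0 := symRes_nonneg ε w (n + 1) κ
    have hb := one_le_sqNorm (hκ b)
    have hd := one_le_sqNorm (hκ d)
    have s1 := Real.sq_sqrt (sqNorm_nonneg (κ a + κ b))
    have s2 := Real.sq_sqrt (sqNorm_nonneg (κ c + κ d))
    have s3 : 0 < √(sqNorm (κ b)) := Real.sqrt_pos.2 (by linarith)
    have s4 : 0 < √(sqNorm (κ d)) := Real.sqrt_pos.2 (by linarith)
    rw [nonzero, if_pos hκ]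
    simp only [one_mul]
    rw [mul_pow, mul_pow, mul_pow, mul_pow, s1, s2, add_comm (sqNorm (κ d))]
    have := sqNorm_nonneg (κ a + κ b)
    have := sqNorm_nonneg (κ c + κ d)
    calc _ ≤ (2 / (sqNorm (κ b) + sqNorm (κ d))) ^ 2 * (sqNorm (κ a + κ b) * ‖f (merge κ a b)‖ ^ 2) *
          (sqNorm (κ c + κ d) * ‖g (merge κ c d)‖ ^ 2) := by gcongr
      _ = _ := by field_simp
  · rw [nonzero, if_neg hκ]
    simp

/-- Estimate of the product of two distinct pairings. -/
theorem pair_bound (ε : ℝ) (w : EuclideanSpace ℝ (Fin 2)) {n : ℕ} {f g : (Fin n → Z2) → ℂ}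
    (hf : IsKernel n f) (hg : IsKernel n g) (hfE : Summable fun k => symNegL0 n k * ‖f k‖ ^ 2)
    (hgE : Summable fun k => symNegL0 n k * ‖g k‖ ^ 2) {a b c d : Fin (n + 1)} (hab : a < b)
    (hcd : c < d) (hne : (a, b) ≠ (c, d)) :
    ∑' κ : Fin (n + 1) → Z2, ENNReal.ofReal (nonzero κ * symRes ε w (n + 1) κ *
      (√(sqNorm (κ a + κ b)) * ‖f (merge κ a b)‖) * (√(sqNorm (κ d + κ c)) * ‖g (merge κ d c)‖)) ≤
      ENNReal.ofReal (480 * Real.pi ^ 2 / n * (√(energy n f) * √(energy n g))) := by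
  have key : ∀ a b c d : Fin (n + 1), a ≠ b → c ≠ d → b ≠ c → b ≠ d → d ≠ a → _ :=
    fun a b c d h1 h2 h3 h4 h5 => pair_bound_aux ε w hf hg hfE hgE h1 h2 h3 h4 h5
  have sf : ∀ κ, √(sqNorm (κ b + κ a)) * ‖f (merge κ b a)‖ =
      √(sqNorm (κ a + κ b)) * ‖f (merge κ a b)‖ := fun κ => by rw [add_comm, merge_comm hf]
  have sg : ∀ κ, √(sqNorm (κ c + κ d)) * ‖g (merge κ c d)‖ =
      √(sqNorm (κ d + κ c)) * ‖g (merge κ d c)‖ := fun κ => by rw [add_comm, merge_comm hg]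
  have hne' : a ≠ c ∨ b ≠ d := by
    by_contra! h
    exact hne (by rw [h.1, h.2])
  -- Distinct pairs share at most one index, so each has an index outside the other. The cases
  -- select these indices, and symmetry under swapping the two entries of a pair puts them in the
  -- places of `b` and `d`.
  by_cases hb : b = c ∨ b = d
  · have ha : a ≠ c ∧ a ≠ d := by
      rcases hb with hb | hb <;> constructor <;> intro h <;> subst_vars <;>
        first | exact absurd hab (lt_asymm hcd) | exact absurd hab (lt_irrefl _) | simp at hne'
    by_cases hd : d = a ∨ d = b
    · have hc : c ≠ a ∧ c ≠ b := by
        rcases hd with hd | hd <;> constructor <;> intro h <;> subst_vars <;> simp_all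
      have := key b a d c hab.ne' hcd.ne' ha.2 ha.1 hc.2
      simpa only [sf] using this
    · rw [not_or] at hd
      have := key b a c d hab.ne' hcd.ne ha.1 ha.2 hd.2
      simpa only [sf, sg] using this
  · rw [not_or] at hb
    by_cases hd : d = a ∨ d = b
    · have hc : c ≠ a := by
        rcases hd with hd | hd <;> intro h <;> subst_vars <;> simp_all
      exact key a b d c hab.ne hcd.ne' hb.2 hb.1 hc
    · rw [not_or] at hd
      have := key a b c d hab.ne hcd.ne hb.1 hb.2 hd.1
      simpa only [sg] using this

/-! ### Decomposition into diagonal and off-diagonal parts -/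

theorem splitEquiv_zero {n : ℕ} (j : Fin n) (l : Z2) (k : Fin n → Z2) :
    splitEquiv 0 j (l, k) = split k j l := by
  simp only [splitEquiv, split, Equiv.coe_fn_mk, Fin.insertNth_zero']

theorem merge_split {n : ℕ} (k : Fin n → Z2) (j : Fin n) (l : Z2) :
    merge (split k j l) j.succ 0 = k := by
  have := congrArg Prod.snd ((splitEquiv 0 j).left_inv (l, k))
  rw [← splitEquiv_zero]
  exact this

theorem split_zero {n : ℕ} (k : Fin n → Z2) (j : Fin n) (l : Z2) : split k j l 0 = l := rfl

theorem split_succ_self {n : ℕ} (k : Fin n → Z2) (j : Fin n) (l : Z2) :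
    split k j l j.succ = k j - l := by
  rw [split, Fin.cons_succ, Function.update_self]

/-- The pairs of indices in `{0, …, n}` other than `{0, j + 1}`. -/
def otherPairs {n : ℕ} (j : Fin n) : Finset (Fin (n + 1) × Fin (n + 1)) :=
  (Finset.univ.filter fun p => p.1 < p.2).erase (0, j.succ)

theorem sum_Ioi_eq {n : ℕ} (X : Fin (n + 1) → Fin (n + 1) → ℂ) (j : Fin n) :
    ∑ a, ∑ b ∈ Finset.Ioi a, X a b = X 0 j.succ + ∑ p ∈ otherPairs j, X p.1 p.2 := by
  have h := Finset.add_sum_erase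
    (Finset.univ.filter fun p : Fin (n + 1) × Fin (n + 1) => p.1 < p.2)
    (fun p => X p.1 p.2) (a := (0, j.succ)) (by simp [Fin.succ_pos])
  exact (Finset.sum_finset_product' _ _ _ (by simp)).symm.trans h.symm

theorem card_otherPairs_le {n : ℕ} (j : Fin n) : (otherPairs j).card ≤ (n + 1) ^ 2 := by
  refine (Finset.card_le_card (Finset.subset_univ _)).trans ?_
  simp [sq]

/-- The off-diagonal part of `-𝒜^ε_- (-ℒ₀ - ℒ₀^𝔴 𝒢^ε)⁻¹ 𝒜^ε_+`. -/
def offDiagonal (ε : ℝ) (w : EuclideanSpace ℝ (Fin 2)) {n : ℕ} (f : (Fin n → Z2) → ℂ)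
    (k : Fin n → Z2) : ℂ :=
  ((lam ε ^ 2 / (2 * Real.pi ^ 2) : ℝ) : ℂ) * ∑ j : Fin n, ∑ p ∈ otherPairs j, ∑' l : Z2,
    ((dot w (k j) * cutoff ε l (k j - l) * symRes ε w (n + 1) (split k j l) : ℝ) : ℂ) *
      ((dot w (split k j l p.1 + split k j l p.2) : ℂ) *
        (cutoff ε (split k j l p.1) (split k j l p.2) : ℂ) * f (merge (split k j l) p.1 p.2))

/-- The pair `{0, j + 1}` carries the momenta just split, so merging it restores `k` and squares
both `𝔴·k_j` and the cut-off, the latter being idempotent. The prefactor is `(ι/2π)(n+1)λ_ε ·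
(-2ι/2π)λ_ε/(n+1) = λ_ε²/(2π²)`. -/
theorem replacementOp_eq {ε : ℝ} (h0 : 0 < ε) (w : EuclideanSpace ℝ (Fin 2)) {n : ℕ} {ψ : Family}
    (hψ : IsKernel n (ψ n)) (k : Fin n → Z2) :
    replacementOp ε w ψ n k = ((∑ j, dot w (k j) ^ 2 * (lam ε ^ 2 / (2 * Real.pi ^ 2) *
        (∑' l, cutoff ε l (k j - l) * symRes ε w (n + 1) (split k j l)) -
        1 / 2 * symG ε w n k) : ℝ) : ℂ) * ψ n k + offDiagonal ε w (ψ n) k := by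
  obtain ⟨B, hB⟩ := cutoff_finite h0
  set X : (Fin (n + 1) → Z2) → Fin (n + 1) → Fin (n + 1) → ℂ := fun κ a b =>
    (dot w (κ a + κ b) : ℂ) * (cutoff ε (κ a) (κ b) : ℂ) * ψ n (merge κ a b) with hX
  have hsum : ∀ (j : Fin n) (F : Z2 → ℂ), Summable fun l =>
      ((dot w (k j) * cutoff ε l (k j - l) * symRes ε w (n + 1) (split k j l) : ℝ) : ℂ) * F l := by
    intro j F
    refine summable_of_ne_finset_zero (s := B) fun l hl => ?_
    have : cutoff ε l (k j - l) = 0 := by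
      by_contra h
      exact hl (hB _ _ h).1
    simp [this]
  have hdiag : ∀ j l, ((dot w (k j) * cutoff ε l (k j - l) *
      symRes ε w (n + 1) (split k j l) : ℝ) : ℂ) * X (split k j l) 0 j.succ =
      ((dot w (k j) ^ 2 * (cutoff ε l (k j - l) * symRes ε w (n + 1) (split k j l)) : ℝ) : ℂ) *
        ψ n k := by
    intro j l
    have hJ : cutoff ε l (k j - l) * cutoff ε l (k j - l) = cutoff ε l (k j - l) := by
      unfold cutoff; split_ifs <;> simp
    simp only [hX]
    rw [merge_comm hψ (split k j l) j.succ 0, merge_split, split_zero, split_succ_self,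
      add_sub_cancel]
    calc _ = ((dot w (k j) ^ 2 * (cutoff ε l (k j - l) * cutoff ε l (k j - l)) *
          symRes ε w (n + 1) (split k j l) : ℝ) : ℂ) * ψ n k := by push_cast; ring
      _ = _ := by rw [hJ, mul_assoc]
  have hj : ∀ j : Fin n, ∑' l, ((dot w (k j) * cutoff ε l (k j - l) *
      symRes ε w (n + 1) (split k j l) : ℝ) : ℂ) *
        ∑ a, ∑ b ∈ Finset.Ioi a, X (split k j l) a b =
      ((dot w (k j) ^ 2 * ∑' l, cutoff ε l (k j - l) *
        symRes ε w (n + 1) (split k j l) : ℝ) : ℂ) * ψ n k +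
      ∑ p ∈ otherPairs j, ∑' l, ((dot w (k j) * cutoff ε l (k j - l) *
      symRes ε w (n + 1) (split k j l) : ℝ) : ℂ) * X (split k j l) p.1 p.2 := by
    intro j
    have e : ∀ l, ((dot w (k j) * cutoff ε l (k j - l) *
      symRes ε w (n + 1) (split k j l) : ℝ) : ℂ) *
        ∑ a, ∑ b ∈ Finset.Ioi a, X (split k j l) a b =
        ((dot w (k j) * cutoff ε l (k j - l) *
          symRes ε w (n + 1) (split k j l) : ℝ) : ℂ) * X (split k j l) 0 j.succ +
        ∑ p ∈ otherPairs j, ((dot w (k j) * cutoff ε l (k j - l) *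
          symRes ε w (n + 1) (split k j l) : ℝ) : ℂ) * X (split k j l) p.1 p.2 := fun l => by
      rw [sum_Ioi_eq _ j, mul_add, Finset.mul_sum]
    simp only [e]
    rw [Summable.tsum_add (hsum j _) (summable_sum fun p _ => hsum j _),
      Summable.tsum_finsetSum fun p _ => hsum j _]
    congr 1
    simp only [hdiag]
    rw [tsum_mul_right, ← Complex.ofReal_tsum, tsum_mul_left]
  have hA : -Aminus ε w (resolvent ε w (Aplus ε w ψ)) n k =
      ((lam ε ^ 2 / (2 * Real.pi ^ 2) : ℝ) : ℂ) * ∑ j : Fin n,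
        ∑' l, ((dot w (k j) * cutoff ε l (k j - l) * symRes ε w (n + 1) (split k j l) : ℝ) : ℂ) *
          ∑ a, ∑ b ∈ Finset.Ioi a, X (split k j l) a b := by
    simp only [Aminus, resolvent, multiplier, Aplus]
    have e : ∀ j l, (cutoff ε l (k j - l) : ℂ) *
        (((symNegL0 (n + 1) (split k j l) - symL0w w (n + 1) (split k j l) *
          symG ε w (n + 1) (split k j l))⁻¹ : ℝ) *
        (-(2 * Complex.I / (2 * Real.pi)) * ((lam ε : ℂ) / (n + 1)) *
          ∑ a, ∑ b ∈ Finset.Ioi a, X (split k j l) a b)) =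
        (-(2 * Complex.I / (2 * Real.pi)) * ((lam ε : ℂ) / (n + 1))) *
          ((cutoff ε l (k j - l) * symRes ε w (n + 1) (split k j l) : ℝ) *
          ∑ a, ∑ b ∈ Finset.Ioi a, X (split k j l) a b) := fun j l => by
      rw [symRes]; push_cast; ring
    have e2 : ∀ j l, ((dot w (k j) * cutoff ε l (k j - l) *
        symRes ε w (n + 1) (split k j l) : ℝ) : ℂ) *
          ∑ a, ∑ b ∈ Finset.Ioi a, X (split k j l) a b = (dot w (k j) : ℂ) *
          ((cutoff ε l (k j - l) * symRes ε w (n + 1) (split k j l) : ℝ) *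
          ∑ a, ∑ b ∈ Finset.Ioi a, X (split k j l) a b) := fun j l => by
      push_cast; ring
    simp only [hX] at e e2 ⊢
    simp only [e, e2, tsum_mul_left]
    have hn : (n : ℂ) + 1 ≠ 0 := by exact_mod_cast n.succ_ne_zero
    have hpi : (Real.pi : ℂ) ≠ 0 := by exact_mod_cast Real.pi_ne_zero
    rw [Finset.mul_sum, Finset.mul_sum, ← Finset.sum_neg_distrib]
    refine Finset.sum_congr rfl fun j _ => ?_
    generalize (∑' l, _ : ℂ) = T
    push_cast
    field_simp
    linear_combination (-(lam ε : ℂ) ^ 2 * dot w (k j) * T) * Complex.I_sq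
  have hL : L0w w (Geps ε w ψ) n k =
      -((∑ j, dot w (k j) ^ 2 * (1 / 2 * symG ε w n k) : ℝ) : ℂ) * ψ n k := by
    simp only [L0w, Geps, multiplier, symL0w]
    rw [← Finset.sum_mul]
    push_cast
    ring
  change -Aminus ε w (resolvent ε w (Aplus ε w ψ)) n k + L0w w (Geps ε w ψ) n k = _
  rw [hA, hL]
  simp only [hj]
  rw [Finset.sum_add_distrib, mul_add, ← Finset.sum_mul, offDiagonal]
  have e3 : ∑ j, dot w (k j) ^ 2 * (lam ε ^ 2 / (2 * Real.pi ^ 2) *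
        (∑' l, cutoff ε l (k j - l) * symRes ε w (n + 1) (split k j l)) -
        1 / 2 * symG ε w n k) = lam ε ^ 2 / (2 * Real.pi ^ 2) * ∑ j, (dot w (k j) ^ 2 *
        ∑' l, cutoff ε l (k j - l) * symRes ε w (n + 1) (split k j l)) -
        ∑ j, dot w (k j) ^ 2 * (1 / 2 * symG ε w n k) := by
    rw [Finset.mul_sum, ← Finset.sum_sub_distrib]
    refine Finset.sum_congr rfl fun j _ => ?_
    ring
  rw [e3, Complex.ofReal_sub, Complex.ofReal_mul (lam ε ^ 2 / (2 * Real.pi ^ 2)),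
    Complex.ofReal_sum (f := fun j => dot w (k j) ^ 2 *
        ∑' l, cutoff ε l (k j - l) * symRes ε w (n + 1) (split k j l))]
  ring

/-! ### Bounds on a single chaos -/

theorem abs_dot_le (w : EuclideanSpace ℝ (Fin 2)) (k : Z2) : |dot w k| ≤ ‖w‖ * √(sqNorm k) := by
  rw [← Real.sqrt_sq (norm_nonneg w), ← Real.sqrt_mul (sq_nonneg _)]
  exact Real.abs_le_sqrt (dot_sq_le w k)

/-- Summing over `k` and `l` amounts to summing over all `κ = split k j l`, and `k` is recovered by
merging `j + 1` and `0`. The test function `g` thus takes the role of the second merged kernel in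
`pair_bound`. -/
theorem offDiagonal_bound {ε : ℝ} (w : EuclideanSpace ℝ (Fin 2)) {n : ℕ}
    {f g : (Fin n → Z2) → ℂ}
    (hf : IsKernel n f) (hg : IsKernel n g) (hfE : Summable fun k => symNegL0 n k * ‖f k‖ ^ 2)
    (hgE : Summable fun k => symNegL0 n k * ‖g k‖ ^ 2) :
    ∑' k, ENNReal.ofReal (‖offDiagonal ε w f k‖ * ‖g k‖) ≤
      ENNReal.ofReal (1000 * ‖w‖ ^ 2 * lam ε ^ 2 * n ^ 2 * (√(energy n f) * √(energy n g))) := by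
  have hEE : 0 ≤ √(energy n f) * √(energy n g) := by positivity
  set EE := √(energy n f) * √(energy n g)
  set c : ℝ := lam ε ^ 2 / (2 * Real.pi ^ 2) with hc
  have hc0 : 0 ≤ c := by positivity
  set Z : (j : Fin n) → Fin (n + 1) × Fin (n + 1) → Z2 → (Fin n → Z2) → ℂ := fun j p l k =>
    ((dot w (k j) * cutoff ε l (k j - l) * symRes ε w (n + 1) (split k j l) : ℝ) : ℂ) *
      ((dot w (split k j l p.1 + split k j l p.2) : ℂ) *
        (cutoff ε (split k j l p.1) (split k j l p.2) : ℂ) * f (merge (split k j l) p.1 p.2))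
    with hZ
  have hstep : ∀ (j : Fin n), ∀ p ∈ otherPairs j,
      ∑' k, ∑' l, ENNReal.ofReal (‖Z j p l k‖ * ‖g k‖) ≤
        ENNReal.ofReal (‖w‖ ^ 2 * (480 * Real.pi ^ 2 / n * EE)) := by
    intro j p hp
    obtain ⟨hp1, hp2⟩ := Finset.mem_erase.1 hp
    have hp3 : p.1 < p.2 := by simpa using hp2
    have hmain := pair_bound ε w hf hg hfE hgE hp3 (Fin.succ_pos j) (by simpa using hp1)
    rw [ENNReal.ofReal_mul (sq_nonneg _)]
    refine le_trans ?_ (mul_le_mul_right hmain _)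
    rw [← ENNReal.tsum_mul_left, ← (splitEquiv 0 j).tsum_eq, ENNReal.tsum_prod', ENNReal.tsum_comm]
    refine ENNReal.tsum_le_tsum fun l => ENNReal.tsum_le_tsum fun k => ?_
    rw [splitEquiv_zero, merge_split, split_succ_self, split_zero, sub_add_cancel,
      ← ENNReal.ofReal_mul (sq_nonneg _)]
    refine ENNReal.ofReal_le_ofReal ?_
    have hr := symRes_nonneg ε w (n + 1) (split k j l)
    -- A vanishing momentum kills the term: through the cut-off if it is one of the two split
    -- momenta, through the zero mean of `g` otherwise.
    by_cases hnz : ∀ i, split k j l i ≠ 0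
    · rw [nonzero, if_pos hnz]
      simp only [hZ, norm_mul, Complex.norm_real, Real.norm_eq_abs,
        abs_of_nonneg hr]
      have d1 := abs_dot_le w (k j)
      have d2 := abs_dot_le w (split k j l p.1 + split k j l p.2)
      have j1 := cutoff_le_one ε l (k j - l)
      have j2 := cutoff_le_one ε (split k j l p.1) (split k j l p.2)
      calc _ ≤ ((‖w‖ * √(sqNorm (k j))) * 1 * symRes ε w (n + 1) (split k j l)) *
            ((‖w‖ * √(sqNorm (split k j l p.1 + split k j l p.2))) * 1 *
              ‖f (merge (split k j l) p.1 p.2)‖) * ‖g k‖ := by gcongr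
        _ = _ := by ring
    · rw [nonzero, if_neg hnz]
      have hz : ‖Z j p l k‖ * ‖g k‖ = 0 := by
        push Not at hnz
        obtain ⟨i, hi⟩ := hnz
        refine Fin.cases (fun hi => ?_) (fun i hi => ?_) i hi
        · rw [split_zero] at hi
          simp only [hZ, hi, cutoff_zero_left]
          simp
        · by_cases hij : i = j
          · rw [hij, split_succ_self] at hi
            simp only [hZ, hi, cutoff_zero_right]
            simp
          · rw [split, Fin.cons_succ, Function.update_of_ne hij] at hi
            rw [hg.zero_mean k ⟨i, hi⟩]
            simp
      rw [hz]
      simp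
  have hpt : ∀ k, ENNReal.ofReal (‖offDiagonal ε w f k‖ * ‖g k‖) ≤
      ENNReal.ofReal c * ∑ j : Fin n, ∑ p ∈ otherPairs j,
        ∑' l, ENNReal.ofReal (‖Z j p l k‖ * ‖g k‖) := by
    intro k
    have e : ∀ j p l, ENNReal.ofReal (‖Z j p l k‖ * ‖g k‖) = ‖Z j p l k‖ₑ * ‖g k‖ₑ := fun j p l => by
      rw [ENNReal.ofReal_mul (norm_nonneg _), ofReal_norm, ofReal_norm]
    simp only [e, ENNReal.tsum_mul_right, ← Finset.sum_mul]
    rw [ENNReal.ofReal_mul (norm_nonneg _), ofReal_norm, ofReal_norm, offDiagonal, enorm_mul,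
      ← mul_assoc]
    gcongr
    · rw [← ofReal_norm, Complex.norm_real, Real.norm_of_nonneg hc0]
    · refine (enorm_sum_le _ _).trans (Finset.sum_le_sum fun j _ => ?_)
      exact (enorm_sum_le _ _).trans (Finset.sum_le_sum fun p _ => enorm_tsum_le_tsum_enorm)
  calc _ ≤ ∑' k, ENNReal.ofReal c * ∑ j : Fin n, ∑ p ∈ otherPairs j,
        ∑' l, ENNReal.ofReal (‖Z j p l k‖ * ‖g k‖) := ENNReal.tsum_le_tsum hpt
    _ = ENNReal.ofReal c * ∑ j : Fin n, ∑ p ∈ otherPairs j,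
        ∑' k, ∑' l, ENNReal.ofReal (‖Z j p l k‖ * ‖g k‖) := by
      rw [ENNReal.tsum_mul_left, Summable.tsum_finsetSum fun _ _ => ENNReal.summable]
      congr 1
      refine Finset.sum_congr rfl fun j _ => ?_
      rw [Summable.tsum_finsetSum fun _ _ => ENNReal.summable]
    _ ≤ ENNReal.ofReal c * ∑ j : Fin n, ∑ p ∈ otherPairs j,
        ENNReal.ofReal (‖w‖ ^ 2 * (480 * Real.pi ^ 2 / n * EE)) := by
      gcongr with j _ p hp
      exact hstep j p hp
    _ = ENNReal.ofReal (c * ∑ j : Fin n, (otherPairs j).card *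
        (‖w‖ ^ 2 * (480 * Real.pi ^ 2 / n * EE))) := by
      rw [ENNReal.ofReal_mul hc0, ENNReal.ofReal_sum_of_nonneg fun _ _ => by positivity]
      congr 1
      refine Finset.sum_congr rfl fun j _ => ?_
      rw [Finset.sum_const, nsmul_eq_mul, ENNReal.ofReal_mul (Nat.cast_nonneg _),
        ENNReal.ofReal_natCast]
    _ ≤ _ := by
      refine ENNReal.ofReal_le_ofReal ?_
      rcases Nat.eq_zero_or_pos n with rfl | hn
      · simp
      have hn1 : (1 : ℝ) ≤ n := by exact_mod_cast hn
      -- There are at most `(n + 1)² ≤ 4n²` pairs for each of the `n` indices `j`; the `1/n` from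
      -- the energy leaves `n²`, with constant `4 · 480/2 = 960`.
      calc c * ∑ j : Fin n, (otherPairs j).card * (‖w‖ ^ 2 * (480 * Real.pi ^ 2 / n * EE))
          ≤ c * ∑ j : Fin n, (4 * (n : ℝ) ^ 2) * (‖w‖ ^ 2 * (480 * Real.pi ^ 2 / n * EE)) := by
            gcongr with j
            calc ((otherPairs j).card : ℝ) ≤ ((n : ℝ) + 1) ^ 2 := by
                  exact_mod_cast card_otherPairs_le j
              _ ≤ _ := by nlinarith
        _ = 960 * ‖w‖ ^ 2 * lam ε ^ 2 * n ^ 2 * EE := by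
            rw [Finset.sum_const, Finset.card_univ, Fintype.card_fin, nsmul_eq_mul, hc]
            field_simp
            ring
        _ ≤ _ := by gcongr; norm_num

/-- The replacement estimate on a single chaos. -/
theorem chaos_bound {w : EuclideanSpace ℝ (Fin 2)} (hw : w ≠ 0) :
    ∃ C : ℝ, 0 < C ∧ ∀ ε : ℝ, 0 < ε → ε < 1 → ∀ (n : ℕ) (ψ : Family) (g : (Fin n → Z2) → ℂ),
      IsKernel n (ψ n) → IsKernel n g → (Summable fun k => symNegL0 n k * ‖ψ n k‖ ^ 2) →
      (Summable fun k => symNegL0 n k * ‖g k‖ ^ 2) →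
      ∑' k, ENNReal.ofReal (‖replacementOp ε w ψ n k‖ * ‖g k‖) ≤
        ENNReal.ofReal (C * lam ε ^ 2 * n ^ 2 * (√(energy n (ψ n)) * √(energy n g))) := by
  obtain ⟨C, hC, hdiag⟩ := diagonal_estimate hw
  refine ⟨2 * C * ‖w‖ ^ 2 + 1000 * ‖w‖ ^ 2, ?_, fun ε h0 h1 n ψ g hψ hg hψE hgE => ?_⟩
  · have : 0 < ‖w‖ := norm_pos_iff.2 hw
    positivity
  have hEE : 0 ≤ √(energy n (ψ n)) * √(energy n g) := by positivity
  have hoff := offDiagonal_bound (ε := ε) w hψ hg hψE hgE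
  -- The diagonal multiplier is form-bounded by `-ℒ₀` with no power of `n`, because `∑_j (𝔴·k_j)² ≤
  -- 2|𝔴|² · ½|k_{1:n}|²`.
  have hn : ∀ k : Fin n → Z2, (∀ i, k i ≠ 0) →
      |∑ j, dot w (k j) ^ 2 * (lam ε ^ 2 / (2 * Real.pi ^ 2) *
        (∑' l, cutoff ε l (k j - l) * symRes ε w (n + 1) (split k j l)) -
        1 / 2 * symG ε w n k)| ≤ 2 * C * ‖w‖ ^ 2 * lam ε ^ 2 * symNegL0 n k := by
    intro k hk
    calc _ ≤ ∑ j, (‖w‖ ^ 2 * sqNorm (k j)) * (C * lam ε ^ 2) := by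
          refine (Finset.abs_sum_le_sum_abs _ _).trans (Finset.sum_le_sum fun j _ => ?_)
          rw [abs_mul, abs_of_nonneg (sq_nonneg _)]
          exact mul_le_mul (dot_sq_le w (k j)) (hdiag ε h0 h1 n k j (hk j)) (abs_nonneg _)
            (mul_nonneg (sq_nonneg _) (sqNorm_nonneg _))
      _ = _ := by
          rw [← Finset.sum_mul, ← Finset.mul_sum, symNegL0]
          ring
  have hd : ∑' k, ENNReal.ofReal (2 * C * ‖w‖ ^ 2 * lam ε ^ 2 *
      (symNegL0 n k * ‖ψ n k‖ * ‖g k‖)) ≤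
      ENNReal.ofReal (2 * C * ‖w‖ ^ 2 * lam ε ^ 2 * (√(energy n (ψ n)) * √(energy n g))) := by
    have hK : 0 ≤ 2 * C * ‖w‖ ^ 2 * lam ε ^ 2 := by positivity
    rw [ENNReal.ofReal_mul hK]
    simp only [ENNReal.ofReal_mul hK, ENNReal.tsum_mul_left]
    refine mul_le_mul_right ?_ _
    have hnn : ∀ (h : (Fin n → Z2) → ℂ) k, 0 ≤ symNegL0 n k * ‖h k‖ ^ 2 := fun h k =>
      mul_nonneg (symNegL0_nonneg n k) (sq_nonneg _)
    refine tsum_ofReal_le_sqrt_mul_sqrt (hnn (ψ n)) (hnn g) (fun k => le_of_eq (by ring))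
      (energy_nonneg _ _) (energy_nonneg _ _) ?_ ?_
    · exact (ENNReal.ofReal_tsum_of_nonneg (hnn _) hψE).ge
    · exact (ENNReal.ofReal_tsum_of_nonneg (hnn _) hgE).ge
  have hpt : ∀ k, ENNReal.ofReal (‖replacementOp ε w ψ n k‖ * ‖g k‖) ≤
      ENNReal.ofReal (2 * C * ‖w‖ ^ 2 * lam ε ^ 2 * (symNegL0 n k * ‖ψ n k‖ * ‖g k‖)) +
        ENNReal.ofReal (‖offDiagonal ε w (ψ n) k‖ * ‖g k‖) := by
    intro k
    have hs := symNegL0_nonneg n k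
    rw [← ENNReal.ofReal_add (by positivity) (by positivity)]
    refine ENNReal.ofReal_le_ofReal ?_
    by_cases hk : ∃ i, k i = 0
    · rw [hg.zero_mean k hk]; simp
    · rw [replacementOp_eq h0 w hψ k]
      have h2 := hn k (not_exists.1 hk)
      calc _ ≤ (‖((∑ j, dot w (k j) ^ 2 * (lam ε ^ 2 / (2 * Real.pi ^ 2) *
            (∑' l, cutoff ε l (k j - l) * symRes ε w (n + 1) (split k j l)) -
            1 / 2 * symG ε w n k) : ℝ) : ℂ) * ψ n k‖ + ‖offDiagonal ε w (ψ n) k‖) * ‖g k‖ := by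
            gcongr
            exact norm_add_le _ _
        _ ≤ ((2 * C * ‖w‖ ^ 2 * lam ε ^ 2 * symNegL0 n k) * ‖ψ n k‖ +
              ‖offDiagonal ε w (ψ n) k‖) * ‖g k‖ := by
            rw [norm_mul, Complex.norm_real, Real.norm_eq_abs]
            gcongr
        _ = _ := by ring
  calc _ ≤ _ := ENNReal.tsum_le_tsum hpt
    _ = _ := ENNReal.tsum_add
    _ ≤ _ := add_le_add hd hoff
    _ = ENNReal.ofReal (2 * C * ‖w‖ ^ 2 * lam ε ^ 2 * (√(energy n (ψ n)) * √(energy n g)) +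
        1000 * ‖w‖ ^ 2 * lam ε ^ 2 * n ^ 2 * (√(energy n (ψ n)) * √(energy n g))) :=
      (ENNReal.ofReal_add (by positivity) (by positivity)).symm
    _ ≤ _ := by
      refine ENNReal.ofReal_le_ofReal ?_
      -- On the zeroth chaos the energies vanish; for `n ≥ 1` the diagonal bound is absorbed through
      -- `1 ≤ n²`.
      rcases Nat.eq_zero_or_pos n with rfl | hn0
      · simp [energy, symNegL0]
      have hn1 : (1 : ℝ) ≤ (n : ℝ) ^ 2 := one_le_pow₀ (by exact_mod_cast hn0)
      have hK : 0 ≤ 2 * C * ‖w‖ ^ 2 * lam ε ^ 2 * (√(energy n (ψ n)) * √(energy n g)) := by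
        positivity
      nlinarith only [mul_le_mul_of_nonneg_left hn1 hK]

/-! ### Summation over the chaoses, and duality -/

theorem summable_and_tsum_le {ι : Type*} {t : ι → ℝ} (ht : ∀ i, 0 ≤ t i) {M : ℝ} (hM : 0 ≤ M)
    (h : ∑' i, ENNReal.ofReal (t i) ≤ ENNReal.ofReal M) : Summable t ∧ ∑' i, t i ≤ M := by
  have hs : ∀ s : Finset ι, ∑ i ∈ s, t i ≤ M := by
    intro s
    rw [← ENNReal.ofReal_le_ofReal_iff hM, ENNReal.ofReal_sum_of_nonneg fun i _ => ht i]
    exact (ENNReal.sum_le_tsum s).trans h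
  have h1 := summable_of_sum_le ht hs
  exact ⟨h1, h1.tsum_le_of_sum_le hs⟩

theorem norm_sq_number_sqrtNegL0 (ψ : Family) (n : ℕ) (k : Fin n → Z2) :
    ‖number (sqrtNegL0 ψ) n k‖ ^ 2 = (n : ℝ) ^ 2 * (symNegL0 n k * ‖ψ n k‖ ^ 2) := by
  simp only [number, sqrtNegL0, multiplier, norm_mul, Complex.norm_real, Real.norm_eq_abs, mul_pow,
    sq_abs]
  rw [Real.sq_sqrt (symNegL0_nonneg n k)]

theorem summable_energy {ψ : Family} (h : MemFock (number (sqrtNegL0 ψ))) (n : ℕ) :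
    Summable fun k => symNegL0 n k * ‖ψ n k‖ ^ 2 := by
  rcases Nat.eq_zero_or_pos n with rfl | hn
  · simp [symNegL0]
  · have := (h.kernel n).sq_summable
    simp only [norm_sq_number_sqrtNegL0] at this
    exact (summable_mul_left_iff (by positivity)).1 this

theorem tsum_norm_sq_number_sqrtNegL0 (ψ : Family) (n : ℕ) :
    ∑' k, ‖number (sqrtNegL0 ψ) n k‖ ^ 2 = (n : ℝ) ^ 2 * energy n (ψ n) := by
  simp only [norm_sq_number_sqrtNegL0, tsum_mul_left, energy]

theorem isKernel_invSqrtNegL0 {ψ : Family} {n : ℕ} (hψ : IsKernel n (ψ n)) :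
    IsKernel n (invSqrtNegL0 ψ n) := by
  change IsKernel n fun k => (((√(symNegL0 n k))⁻¹ : ℝ) : ℂ) * ψ n k
  refine isKernel_multiplier (M := 2) hψ (fun σ k => ?_) fun k hk => ?_
  · rw [symNegL0_comp_perm]
  · rw [abs_of_nonneg (by positivity)]
    rcases eq_or_ne n 0 with rfl | hn
    · simp [symNegL0]
    · have h1 : 1 / 2 ≤ √(symNegL0 n k) := Real.le_sqrt_of_sq_le (by
        linarith [symNegL0_pos hn hk])
      rw [inv_le_comm₀ (by linarith) two_pos]
      linarith

/-- Only an inequality holds in general: where the symbol of `-ℒ₀` is zero, its inverse is zero by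
convention. -/
theorem energy_invSqrtNegL0_le {ψ : Family} {n : ℕ} (hψ : IsKernel n (ψ n)) :
    (Summable fun k => symNegL0 n k * ‖invSqrtNegL0 ψ n k‖ ^ 2) ∧
      energy n (invSqrtNegL0 ψ n) ≤ ∑' k, ‖ψ n k‖ ^ 2 := by
  have h : ∀ k, symNegL0 n k * ‖invSqrtNegL0 ψ n k‖ ^ 2 ≤ ‖ψ n k‖ ^ 2 := by
    intro k
    have hs := symNegL0_nonneg n k
    simp only [invSqrtNegL0, multiplier, norm_mul, Complex.norm_real, Real.norm_eq_abs, mul_pow,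
      sq_abs, inv_pow]
    rw [Real.sq_sqrt hs, ← mul_assoc]
    exact mul_le_of_le_one_left (sq_nonneg _) (mul_inv_le_one)
  have h1 := Summable.of_nonneg_of_le
    (fun k => mul_nonneg (symNegL0_nonneg n k) (sq_nonneg _)) h hψ.sq_summable
  exact ⟨h1, h1.tsum_le_tsum h hψ.sq_summable⟩

theorem offDiagonal_zero (ε : ℝ) (w : EuclideanSpace ℝ (Fin 2)) {n : ℕ} (k : Fin n → Z2) :
    offDiagonal ε w (0 : (Fin n → Z2) → ℂ) k = 0 := by
  simp [offDiagonal]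

theorem isKernel_zero (n : ℕ) : IsKernel n (0 : (Fin n → Z2) → ℂ) where
  symm _ _ := rfl
  zero_mean _ _ := rfl
  sq_summable := by simp

theorem inChaos_invSqrtNegL0 {n : ℕ} {ψ : Family} (h : InChaos n ψ) :
    InChaos n (invSqrtNegL0 ψ) := fun m hm => by
  funext k
  simp [invSqrtNegL0, multiplier, h m hm]

theorem inChaos_replacementOp {ε : ℝ} (h0 : 0 < ε) (w : EuclideanSpace ℝ (Fin 2)) {n : ℕ}
    {ψ : Family} (h : InChaos n ψ) : InChaos n (replacementOp ε w ψ) := fun m hm => by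
  have hk : IsKernel m (ψ m) := by rw [h m hm]; exact isKernel_zero m
  funext k
  rw [replacementOp_eq h0 w hk, h m hm, offDiagonal_zero]
  simp

theorem fockNorm_of_inChaos {n : ℕ} {ψ : Family} (h : InChaos n ψ) :
    fockNorm ψ = √((n.factorial : ℝ) * ∑' k, ‖ψ n k‖ ^ 2) := by
  rw [fockNorm, tsum_eq_single n]
  intro m hm
  simp [h m hm]

theorem memFock_of_inChaos {n : ℕ} {ψ : Family} (h : InChaos n ψ) (hk : ∀ m, IsKernel m (ψ m)) :
    MemFock ψ where
  kernel := hk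
  summable := by
    refine summable_of_ne_finset_zero (s := {n}) fun m hm => ?_
    simp [h m (by simpa using hm)]

/-- The factor `n²` of the single-chaos bound is shared between the two arguments, giving one `𝒩` to
each. -/
theorem replacement_bound {w : EuclideanSpace ℝ (Fin 2)} {C ε : ℝ} (hC : 0 < C)
    (hbound : ∀ (n : ℕ) (ψ : Family) (g : (Fin n → Z2) → ℂ),
      IsKernel n (ψ n) → IsKernel n g → (Summable fun k => symNegL0 n k * ‖ψ n k‖ ^ 2) →
      (Summable fun k => symNegL0 n k * ‖g k‖ ^ 2) →
      ∑' k, ENNReal.ofReal (‖replacementOp ε w ψ n k‖ * ‖g k‖) ≤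
        ENNReal.ofReal (C * lam ε ^ 2 * n ^ 2 * (√(energy n (ψ n)) * √(energy n g))))
    {ψ₁ ψ₂ : Family} (h₁ : MemFock ψ₁) (h₂ : MemFock ψ₂)
    (hd₁ : MemFock (number (sqrtNegL0 ψ₁))) (hd₂ : MemFock (number (sqrtNegL0 ψ₂))) :
    (Summable fun n : ℕ => (n.factorial : ℝ) *
        ‖∑' k, replacementOp ε w ψ₁ n k * (starRingEnd ℂ) (ψ₂ n k)‖) ∧
      ‖fockInner (replacementOp ε w ψ₁) ψ₂‖ ≤
        C * lam ε ^ 2 * fockNorm (number (sqrtNegL0 ψ₁)) * fockNorm (number (sqrtNegL0 ψ₂)) := by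
  have hn : ∀ n, ‖∑' k, replacementOp ε w ψ₁ n k * (starRingEnd ℂ) (ψ₂ n k)‖ ≤
      C * lam ε ^ 2 * n ^ 2 * (√(energy n (ψ₁ n)) * √(energy n (ψ₂ n))) := by
    intro n
    obtain ⟨s1, s2⟩ := summable_and_tsum_le (fun k => by positivity) (by positivity)
      (hbound n ψ₁ (ψ₂ n) (h₁.kernel n) (h₂.kernel n) (summable_energy hd₁ n)
        (summable_energy hd₂ n))
    have e : ∀ k, ‖replacementOp ε w ψ₁ n k * (starRingEnd ℂ) (ψ₂ n k)‖ =
        ‖replacementOp ε w ψ₁ n k‖ * ‖ψ₂ n k‖ := fun k => by rw [norm_mul, RCLike.norm_conj]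
    refine (norm_tsum_le_tsum_norm (by simpa only [e] using s1)).trans ?_
    simpa only [e] using s2
  have hA := hd₁.summable
  have hB := hd₂.summable
  simp only [tsum_norm_sq_number_sqrtNegL0] at hA hB
  have hpos : ∀ (ψ : Family) (n : ℕ), 0 ≤ (n.factorial : ℝ) * ((n : ℝ) ^ 2 * energy n (ψ n)) :=
    fun ψ n => by
      have := energy_nonneg n (ψ n)
      positivity
  have hK : 0 ≤ C * lam ε ^ 2 := by positivity
  have hsum : ∑' n : ℕ, ENNReal.ofReal ((n.factorial : ℝ) *
        ‖∑' k, replacementOp ε w ψ₁ n k * (starRingEnd ℂ) (ψ₂ n k)‖) ≤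
      ENNReal.ofReal (C * lam ε ^ 2 * (fockNorm (number (sqrtNegL0 ψ₁)) *
        fockNorm (number (sqrtNegL0 ψ₂)))) := by
    rw [ENNReal.ofReal_mul hK]
    -- Cauchy–Schwarz over `n` with weights `n! n²`, which reproduce the two Fock norms.
    have hcs := tsum_ofReal_le_sqrt_mul_sqrt (hpos ψ₁) (hpos ψ₂)
      (c := fun n : ℕ => (n.factorial : ℝ) * (n : ℝ) ^ 2 * (√(energy n (ψ₁ n)) * √(energy n (ψ₂ n))))
      (fun n => le_of_eq (by
        rw [mul_pow, mul_pow (√_), Real.sq_sqrt (energy_nonneg _ _),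
          Real.sq_sqrt (energy_nonneg _ _)]
        ring)) (tsum_nonneg (hpos ψ₁)) (tsum_nonneg (hpos ψ₂))
      (ENNReal.ofReal_tsum_of_nonneg (hpos ψ₁) hA).ge
      (ENNReal.ofReal_tsum_of_nonneg (hpos ψ₂) hB).ge
    simp only [fockNorm, tsum_norm_sq_number_sqrtNegL0]
    refine le_trans ?_ (mul_le_mul_right hcs _)
    rw [← ENNReal.tsum_mul_left]
    refine ENNReal.tsum_le_tsum fun n => ?_
    rw [← ENNReal.ofReal_mul hK]
    refine ENNReal.ofReal_le_ofReal ?_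
    calc _ ≤ (n.factorial : ℝ) *
          (C * lam ε ^ 2 * n ^ 2 * (√(energy n (ψ₁ n)) * √(energy n (ψ₂ n)))) := by
          gcongr
          exact hn n
      _ = _ := by ring
  have hM : 0 ≤ C * lam ε ^ 2 * (fockNorm (number (sqrtNegL0 ψ₁)) *
      fockNorm (number (sqrtNegL0 ψ₂))) :=
    mul_nonneg hK (mul_nonneg (Real.sqrt_nonneg _) (Real.sqrt_nonneg _))
  obtain ⟨s1, s2⟩ := summable_and_tsum_le (fun n => by positivity) hM hsum
  refine ⟨s1, ?_⟩
  have e : ∀ n : ℕ, ‖(n.factorial : ℂ) *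
      ∑' k, replacementOp ε w ψ₁ n k * (starRingEnd ℂ) (ψ₂ n k)‖ = (n.factorial : ℝ) *
        ‖∑' k, replacementOp ε w ψ₁ n k * (starRingEnd ℂ) (ψ₂ n k)‖ := fun n => by
    rw [norm_mul, Complex.norm_natCast]
  rw [fockInner, mul_assoc (C * lam ε ^ 2)]
  refine (norm_tsum_le_tsum_norm (by simpa only [e] using s1)).trans ?_
  simpa only [e] using s2

/-- The output `u` is used to test itself: pairing the replacement operator applied to `φ =
(-ℒ₀)^{-1/2}ψ` with `(-ℒ₀)^{-1/2}u` gives `‖u‖²`, as the real multiplier can be moved across the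
product, and the form bound then applies. -/
theorem approximate_fixed_point {w : EuclideanSpace ℝ (Fin 2)} (hw : w ≠ 0) {C ε : ℝ} (hC : 0 < C)
    (h0 : 0 < ε)
    (hbound : ∀ (n : ℕ) (ψ : Family) (g : (Fin n → Z2) → ℂ),
      IsKernel n (ψ n) → IsKernel n g → (Summable fun k => symNegL0 n k * ‖ψ n k‖ ^ 2) →
      (Summable fun k => symNegL0 n k * ‖g k‖ ^ 2) →
      ∑' k, ENNReal.ofReal (‖replacementOp ε w ψ n k‖ * ‖g k‖) ≤
        ENNReal.ofReal (C * lam ε ^ 2 * n ^ 2 * (√(energy n (ψ n)) * √(energy n g))))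
    {n : ℕ} {ψ : Family} (h : MemFock ψ) (hc : InChaos n ψ) :
    MemFock (invSqrtNegL0 (replacementOp ε w (invSqrtNegL0 ψ))) ∧
      fockNorm (invSqrtNegL0 (replacementOp ε w (invSqrtNegL0 ψ))) ≤
        C * lam ε ^ 2 * (n : ℝ) ^ 2 * fockNorm ψ := by
  set φ := invSqrtNegL0 ψ with hφ
  set u := invSqrtNegL0 (replacementOp ε w φ) with hu
  have hφk : ∀ m, IsKernel m (φ m) := fun m => isKernel_invSqrtNegL0 (h.kernel m)
  have huk : ∀ m, IsKernel m (u m) := fun m =>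
    isKernel_invSqrtNegL0 (isKernel_replacementOp h0 hw (hφk m))
  have huc : InChaos n u := inChaos_invSqrtNegL0
    (inChaos_replacementOp h0 w (inChaos_invSqrtNegL0 hc))
  refine ⟨memFock_of_inChaos huc huk, ?_⟩
  obtain ⟨sφ, eφ⟩ := energy_invSqrtNegL0_le (h.kernel n)
  obtain ⟨sg, eg⟩ := energy_invSqrtNegL0_le (huk n)
  have hmain := hbound n φ (invSqrtNegL0 u n) (hφk n) (isKernel_invSqrtNegL0 (huk n)) sφ sg
  have e : ∀ k, ‖replacementOp ε w φ n k‖ * ‖invSqrtNegL0 u n k‖ = ‖u n k‖ ^ 2 := by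
    intro k
    simp only [hu, invSqrtNegL0, multiplier, norm_mul]
    ring
  simp only [e] at hmain
  obtain ⟨-, hU⟩ := summable_and_tsum_le (fun k => sq_nonneg _) (by positivity) hmain
  rw [fockNorm_of_inChaos huc, fockNorm_of_inChaos hc, Real.sqrt_mul (Nat.cast_nonneg _),
    Real.sqrt_mul (Nat.cast_nonneg _)]
  have hU0 : 0 ≤ ∑' k, ‖u n k‖ ^ 2 := tsum_nonneg fun _ => sq_nonneg _
  set U := ∑' k, ‖u n k‖ ^ 2
  set P := ∑' k, ‖ψ n k‖ ^ 2
  have hU1 : U ≤ C * lam ε ^ 2 * n ^ 2 * (√P * √U) := by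
    refine hU.trans ?_
    gcongr
  -- Dividing by `√U` is legitimate because `U` is a finite sum of squares: `u` is already known to
  -- be a kernel.
  have hU2 : √U ≤ C * lam ε ^ 2 * n ^ 2 * √P := by
    rcases (Real.sqrt_nonneg U).eq_or_lt with h3 | h3
    · rw [← h3]; positivity
    · refine le_of_mul_le_mul_right ?_ h3
      rw [Real.mul_self_sqrt hU0]
      linarith
  calc √(n.factorial : ℝ) * √U ≤ √(n.factorial : ℝ) * (C * lam ε ^ 2 * n ^ 2 * √P) := by gcongr
    _ = _ := by ring

end Burgers2D

end

theorem lemma4p2 (w : EuclideanSpace ℝ (Fin 2)) (hw : w ≠ 0) :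
    ∃ C : ℝ, 0 < C ∧ ∀ ε : ℝ, 0 < ε → ε < 1 →
      (∀ ψ₁ ψ₂ : Family, MemFock ψ₁ → MemFock ψ₂ →
        MemFock (number (sqrtNegL0 ψ₁)) → MemFock (number (sqrtNegL0 ψ₂)) →
        (∀ n, IsKernel n (replacementOp ε w ψ₁ n)) ∧
        (Summable fun n : ℕ => (n.factorial : ℝ) *
          ‖∑' k, replacementOp ε w ψ₁ n k * (starRingEnd ℂ) (ψ₂ n k)‖) ∧
        ‖fockInner (replacementOp ε w ψ₁) ψ₂‖ ≤
          C * lam ε ^ 2 * fockNorm (number (sqrtNegL0 ψ₁)) * fockNorm (number (sqrtNegL0 ψ₂))) ∧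
      (∀ n : ℕ, 1 ≤ n → ∀ ψ : Family, MemFock ψ → InChaos n ψ →
        MemFock (invSqrtNegL0 (replacementOp ε w (invSqrtNegL0 ψ))) ∧
        fockNorm (invSqrtNegL0 (replacementOp ε w (invSqrtNegL0 ψ))) ≤
          C * lam ε ^ 2 * (n : ℝ) ^ 2 * fockNorm ψ) := by
  obtain ⟨C, hC, hbound⟩ := chaos_bound hw
  refine ⟨C, hC, fun ε h0 h1 => ⟨fun ψ₁ ψ₂ h₁ h₂ hd₁ hd₂ =>
    ⟨fun n => isKernel_replacementOp h0 hw (h₁.kernel n), ?_⟩, fun n _ ψ h hc => ?_⟩⟩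
  · exact replacement_bound hC (hbound ε h0 h1) h₁ h₂ hd₁ hd₂
  · exact approximate_fixed_point hw hC h0 (hbound ε h0 h1) h hc
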